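/- Let $\Omega\subset\mathbb R^2$ be a bounded simply connected domain with $C^2$ boundary, let $T,\lambda,\varepsilon>0$, $N\in\mathbb N$, and let $h_1,\dots,h_N\in C^\infty(\overline\Omega)\cap H^1_0(\Omega)$ be linearly independent (functions in $C^\infty(\overline\Omega)$ being restrictions of $C^\infty$ functions on $\mathbb R^2$). Let $\gamma_0\in W^{2,\infty}([0,1];\overline\Omega)$ (continuous representative; $\gamma_0'$ denotes its classical, continuous derivative on $[0,1]$). Put $J=\begin{pmatrix}0&-1\\1&0\end{pmatrix}$, $\ell_\varepsilon(z)=\sqrt{|z|^2+\varepsilon^2}$, $M_{kl}=(h_k,h_l)_{L^2(\Omega)}$. For $u\in L^2(0,T;\mathbb R^N)$ let $\psi(t,x)=\sum_{k=1}^N u_k(t)h_k(x)$ and consider, for $(t,s)\in[0,T]\times[0,1]$, the state system $$\partial_tX=J\nabla_x\psi(t,X),\qquad \partial_ta=J\nabla_x^2\psi(t,X)\,a,\qquad X(0,s)=\gamma_0(s),\quad a(0,s)=\gamma_0'(s),$$ with $X$ taking values in $\overline\Omega$, and along a solution the backward adjoint system $$-\partial_tp=\bigl(J\nabla_x^2\psi(t,X)\bigr)^{\!\top}p+\bigl(J\nabla_x^3\psi(t,X)[\,\cdot\,,a]\bigr)^{\!\top}q,\qquad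 -\partial_tq=\bigl(J\nabla_x^2\psi(t,X)\bigr)^{\!\top}q,$$ $$p(T,s)=0,\qquad q(T,s)=-\nabla\ell_\varepsilon(a(T,s)),$$ solutions being continuous on $[0,T]\times[0,1]$ and satisfying the equations in the integrated (Carathéodory) sense. Then for every $u\in L^2(0,T;\mathbb R^N)$ the state system has exactly one solution $(X,a)$ and, along it, the adjoint system has exactly one solution $(p,q)$. The reduced cost $$j_{\lambda,\varepsilon}(u)=-\int_0^1\ell_\varepsilon(a(T,s))\,ds+\frac\lambda2\int_0^T\|\psi(t,\cdot)\|_{L^2(\Omega)}^2\,dt$$ is therefore well defined on $L^2(0,T;\mathbb R^N)$. It is Fréchet differentiable there, and for all $u,\delta u\in L^2(0,T;\mathbb R^N)$, with $\eta=\sum_{k=1}^N\delta u_kh_k$ and all integrals converging absolutely, $$Dj_{\lambda,\varepsilon}(u)[\delta u]=\lambda\int_0^T(Mu(t))\cdot\delta u(t)\,dt+\int_0^T\!\!\int_0^1\Bigl[p\cdot J\nabla_x\eta(t,X)+q\cdot J\nabla_x^2\eta(t,X)\,a\Bigr]ds\,dt.$$ Componentwise, the $L^2(0,T;\mathbb R^N)$-gradient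 of $j_{\lambda,\varepsilon}$ at $u$ is given, for $k=1,\dots,N$ and a.e. $t\in(0,T)$, by $$\frac{\partial j_{\lambda,\varepsilon}}{\partial u_k}(t)=\lambda(Mu(t))_k+\int_0^1\Bigl[p(t,s)\cdot J\nabla h_k(X(t,s))+q(t,s)\cdot J\nabla_x^2h_k(X(t,s))\,a(t,s)\Bigr]ds.$$ -/

import Mathlib

open MeasureTheory Set Filter Topology
open scoped ContDiff Matrix ENNReal

noncomputable section

namespace InterfaceControl

/-- The plane `ℝ²` with its Euclidean norm. -/
abbrev Plane : Type := EuclideanSpace ℝ (Fin 2)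

/-- The control space `L²(0,T;ℝᴺ)`. -/
abbrev ControlSpace (N : ℕ) (T : ℝ) : Type :=
  Lp (EuclideanSpace ℝ (Fin N)) 2 (volume.restrict (Ioo (0 : ℝ) T))

/-! ### The domain, the basis functions and the initial curve -/

/-- `Ω` has a boundary of class `C²`: near each boundary point, `Ω` is the negativity set of a `C²`
function whose differential does not vanish at that point. -/
def HasC2Boundary (Ω : Set Plane) : Prop :=
  ∀ x₀ ∈ frontier Ω, ∃ ρ : Plane → ℝ,
    ContDiffAt ℝ 2 ρ x₀ ∧ fderiv ℝ ρ x₀ ≠ 0 ∧ ∀ᶠ y in 𝓝 x₀, (y ∈ Ω ↔ ρ y < 0)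

/-- Bounded simply connected planar domains with `C²` boundary. -/
structure IsC2Domain (Ω : Set Plane) : Prop where
  isOpen : IsOpen Ω
  isBounded : Bornology.IsBounded Ω
  simplyConnected : IsSimplyConnected Ω
  c2Boundary : HasC2Boundary Ω

/-- `f ∈ H¹₀(Ω)`: `f` lies in the closure of `C_c^∞(Ω)` for the `H¹(Ω)`-norm. Here `G` is the
limit in `L²(Ω)` of the gradients, i.e. the weak gradient of `f`. -/
def MemH10 (Ω : Set Plane) (f : Plane → ℝ) : Prop :=
  MemLp f 2 (volume.restrict Ω) ∧
  ∃ G : Plane → Plane, MemLp G 2 (volume.restrict Ω) ∧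
    ∀ δ : ℝ≥0∞, 0 < δ → ∃ φ : Plane → ℝ,
      ContDiff ℝ ∞ φ ∧ HasCompactSupport φ ∧ tsupport φ ⊆ Ω ∧
      eLpNorm (fun x => φ x - f x) 2 (volume.restrict Ω) < δ ∧
      eLpNorm (fun x => gradient φ x - G x) 2 (volume.restrict Ω) < δ

/-- `g` is a weak derivative of `f` on the interval `(0,1)`. -/
def HasWeakDeriv (f g : ℝ → Plane) : Prop :=
  ∀ φ : ℝ → ℝ, ContDiff ℝ ∞ φ → HasCompactSupport φ → tsupport φ ⊆ Ioo (0 : ℝ) 1 →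
    ∫ s in Ioo (0 : ℝ) 1, deriv φ s • f s = - ∫ s in Ioo (0 : ℝ) 1, φ s • g s

/-- `γ ∈ W^{2,∞}((0,1);ℝ²)`: `γ` and its weak derivatives up to order two are in `L^∞`. -/
def MemW2Infty (γ : ℝ → Plane) : Prop :=
  MemLp γ ∞ (volume.restrict (Ioo (0 : ℝ) 1)) ∧
  ∃ γ₁ γ₂ : ℝ → Plane,
    MemLp γ₁ ∞ (volume.restrict (Ioo (0 : ℝ) 1)) ∧
    MemLp γ₂ ∞ (volume.restrict (Ioo (0 : ℝ) 1)) ∧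
    HasWeakDeriv γ γ₁ ∧ HasWeakDeriv γ₁ γ₂

/-! ### Differential operators -/

/-- The symplectic matrix `J = (0 -1; 1 0)`, as a linear map of the plane. -/
def J : Plane →L[ℝ] Plane :=
  Matrix.toEuclideanCLM (n := Fin 2) (𝕜 := ℝ) !![0, -1; 1, 0]

/-- The Hessian `∇²f(x)`, as a linear map of the plane. -/
def hess (f : Plane → ℝ) (x : Plane) : Plane →L[ℝ] Plane :=
  fderiv ℝ (gradient f) x

/-- The linear map `δ ↦ ∇³f(x)[δ, a]`. -/
def third (f : Plane → ℝ) (x a : Plane) : Plane →L[ℝ] Plane :=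
  (fderiv ℝ (hess f) x).flip a

/-- The stream function `∑ₖ cₖ hₖ`. -/
def stream {N : ℕ} (h : Fin N → Plane → ℝ) (c : EuclideanSpace ℝ (Fin N)) (x : Plane) : ℝ :=
  ∑ k, c k * h k x

/-! ### State system, cost, adjoint system -/

/-- `(X,a)` is a continuous (Carathéodory) solution, with `X` in `closure Ω`, of
`∂ₜX = J∇ψ(t,X)`, `∂ₜa = J∇²ψ(t,X)a`, `X(0,s) = γ₀(s)`, `a(0,s) = γ₀'(s)` for `0 ≤ t ≤ T`,
`0 ≤ s ≤ 1`, where `ψ(t,·) = ∑ₖ uₖ(t) hₖ`. The equations are written in integrated form. -/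
structure IsState {N : ℕ} (Ω : Set Plane) (h : Fin N → Plane → ℝ) (γ₀ : ℝ → Plane) (T : ℝ)
    (u : ControlSpace N T) (X a : ℝ → ℝ → Plane) : Prop where
  continuous_X : ContinuousOn (fun z : ℝ × ℝ => X z.1 z.2) (Icc 0 T ×ˢ Icc 0 1)
  continuous_a : ContinuousOn (fun z : ℝ × ℝ => a z.1 z.2) (Icc 0 T ×ˢ Icc 0 1)
  mem_closure : ∀ t ∈ Icc 0 T, ∀ s ∈ Icc (0 : ℝ) 1, X t s ∈ closure Ω
  eq_X : ∀ t ∈ Icc 0 T, ∀ s ∈ Icc (0 : ℝ) 1,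
    X t s = γ₀ s + ∫ τ in (0 : ℝ)..t, J (gradient (stream h (u τ)) (X τ s))
  eq_a : ∀ t ∈ Icc 0 T, ∀ s ∈ Icc (0 : ℝ) 1,
    a t s = derivWithin γ₀ (Icc 0 1) s
      + ∫ τ in (0 : ℝ)..t, J (hess (stream h (u τ)) (X τ s) (a τ s))

/-- The regularized norm `ℓ_ε(z) = √(|z|² + ε²)`. -/
def ell (ε : ℝ) (z : Plane) : ℝ := √(‖z‖ ^ 2 + ε ^ 2)

/-- The cost `-∫₀¹ ℓ_ε(a(T,s)) ds + (λ/2) ∫₀ᵀ ‖ψ(t,·)‖²_{L²(Ω)} dt`. -/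
def cost {N : ℕ} (Ω : Set Plane) (h : Fin N → Plane → ℝ) (T lam ε : ℝ)
    (u : ControlSpace N T) (a : ℝ → ℝ → Plane) : ℝ :=
  -(∫ s in (0 : ℝ)..1, ell ε (a T s))
    + lam / 2 * ∫ t in (0 : ℝ)..T, ∫ x in Ω, (stream h (u t) x) ^ 2

open Classical in
/-- The reduced cost `j_{λ,ε}(u)`: the cost along the solution of the state system driven by `u`
(the value `0` is used only if there were no solution). -/
def reducedCost {N : ℕ} (Ω : Set Plane) (h : Fin N → Plane → ℝ) (γ₀ : ℝ → Plane) (T lam ε : ℝ)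
    (u : ControlSpace N T) : ℝ :=
  if H : ∃ Xa : (ℝ → ℝ → Plane) × (ℝ → ℝ → Plane), IsState Ω h γ₀ T u Xa.1 Xa.2 then
    cost Ω h T lam ε u H.choose.2
  else 0

/-- `(p,q)` is a continuous (Carathéodory) solution of the backward adjoint system
`-∂ₜp = (J∇²ψ(t,X))ᵀ p + (J∇³ψ(t,X)[·,a])ᵀ q`, `-∂ₜq = (J∇²ψ(t,X))ᵀ q`,
`p(T,s) = 0`, `q(T,s) = -∇ℓ_ε(a(T,s))`, written in integrated form. -/
structure IsAdjoint {N : ℕ} (h : Fin N → Plane → ℝ) (T ε : ℝ)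
    (u : ControlSpace N T) (X a p q : ℝ → ℝ → Plane) : Prop where
  continuous_p : ContinuousOn (fun z : ℝ × ℝ => p z.1 z.2) (Icc 0 T ×ˢ Icc 0 1)
  continuous_q : ContinuousOn (fun z : ℝ × ℝ => q z.1 z.2) (Icc 0 T ×ˢ Icc 0 1)
  eq_p : ∀ t ∈ Icc 0 T, ∀ s ∈ Icc (0 : ℝ) 1,
    p t s = ∫ τ in t..T,
      (ContinuousLinearMap.adjoint (J ∘L hess (stream h (u τ)) (X τ s)) (p τ s)
        + ContinuousLinearMap.adjoint (J ∘L third (stream h (u τ)) (X τ s) (a τ s)) (q τ s))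
  eq_q : ∀ t ∈ Icc 0 T, ∀ s ∈ Icc (0 : ℝ) 1,
    q t s = - gradient (ell ε) (a T s)
      + ∫ τ in t..T, ContinuousLinearMap.adjoint (J ∘L hess (stream h (u τ)) (X τ s)) (q τ s)

/-- The Gram matrix `M_{kl} = (h_k, h_l)_{L²(Ω)}`. -/
def gram {N : ℕ} (Ω : Set Plane) (h : Fin N → Plane → ℝ) : Matrix (Fin N) (Fin N) ℝ :=
  Matrix.of fun k l => ∫ x in Ω, h k x * h l x

/-- The density `p · J∇f(X) + q · J∇²f(X)a` at the point `(t,s)`. -/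
def density (f : Plane → ℝ) (X a p q : ℝ → ℝ → Plane) (t s : ℝ) : ℝ :=
  inner ℝ (p t s) (J (gradient f (X t s))) + inner ℝ (q t s) (J (hess f (X t s) (a t s)))

end InterfaceControl

end

noncomputable section

namespace InterfaceControl

/-! ### Integral inequalities -/

/-! For fixed `s`, the pair `(X, a)` solves an ordinary differential equation that is affine in the
control, `z' = ∑ₖ uₖ Fₖ(z)` with `Fₖ = curveField h k`. The pair `(p, q)`, read as a linear
functional through `pairing`, solves the costate equation `-r' = ∑ₖ uₖ r ∘ DFₖ(z)`. The analysis
therefore takes place for control-affine systems whose controls are merely integrable in time, with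
`s` as a parameter.

Well-posedness rests on the stability estimate `IsTraj.norm_sub_le`, a Gronwall bound in which two
controls enter only through their `L¹` distance. It gives uniqueness, joint continuity in `(t, s)`,
and existence by approximating the control by continuous ones. Fields of linear growth are reduced
to bounded ones by a cut-off (`exists_isTraj_of_growth`). The costate is handled by reversing time:
state and costate together again form a control-affine system, with fields `hamField`. The initial
value `γ₀'` is continuous because `γ₀` is `W^{2,∞}` (`MemW2Infty.continuousOn_derivWithin`).

The geometric point is that `X` stays in `closure Ω`. A continuous function in `H¹₀(Ω)` vanishes on
the boundary (`MemH10.eq_zero_of_mem_frontier`), so each `J∇hₖ` is tangent to it, and Gronwall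
applied to a defining function of `Ω` rules out an exit (`IsTraj.mem_closure`). Consequently `hₖ`
may be replaced by a compactly supported function equal to it near `closure Ω`, which provides
linear growth.

Differentiability comes from `exists_expansion`. Pairing the difference of two trajectories with the
costate cancels the terms linear in that difference; the rest is quadratic in the `L¹` distance of
the controls, with a constant independent of `s`. Integration over `s`, Cauchy–Schwarz in time and
Fubini identify the gradient of the terminal part as `densityVec`, while the energy is a bounded
quadratic form (`energy_expansion`). `hasGradientAt_reducedCost` adds the two. -/

theorem gronwall_integral {T A : ℝ} {φ k : ℝ → ℝ} (hφ : ContinuousOn φ (Icc 0 T))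
    (hk : IntegrableOn k (Icc 0 T)) (hk0 : ∀ t, 0 ≤ k t) (hφ0 : ∀ t ∈ Icc 0 T, 0 ≤ φ t)
    (hA : 0 ≤ A) (h : ∀ t ∈ Icc 0 T, φ t ≤ A + ∫ τ in (0 : ℝ)..t, k τ * φ τ) :
    ∀ t ∈ Icc 0 T, φ t ≤ A * Real.exp (2 * ∫ τ in (0 : ℝ)..T, k τ) := by
  intro t₁ ht₁
  have hT : 0 ≤ T := ht₁.1.trans ht₁.2
  have hkφ : IntegrableOn (fun τ => k τ * φ τ) (Icc 0 T) := hk.mul_continuousOn hφ isCompact_Icc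
  have hii : ∀ {f : ℝ → ℝ}, IntegrableOn f (Icc 0 T) → ∀ s ∈ Icc 0 T, ∀ t ∈ Icc 0 T,
      IntervalIntegrable f volume s t := by
    intro f hf s hs t ht
    exact (hf.mono_set (uIcc_subset_Icc hs ht)).intervalIntegrable
  have h0 : (0 : ℝ) ∈ Icc 0 T := ⟨le_rfl, hT⟩
  set G : ℝ → ℝ := fun t => A + ∫ τ in (0 : ℝ)..t, k τ * φ τ with hG
  set K : ℝ → ℝ := fun t => ∫ τ in (0 : ℝ)..t, k τ with hK
  have hprim : ∀ {f : ℝ → ℝ}, IntegrableOn f (Icc 0 T) →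
      ContinuousOn (fun t => ∫ τ in (0 : ℝ)..t, f τ) (Icc 0 T) := by
    intro f hf
    have := intervalIntegral.continuousOn_primitive_interval (μ := volume) (f := f) (a := 0) (b := T)
      (by rwa [uIcc_of_le hT])
    rwa [uIcc_of_le hT] at this
  have hGc : ContinuousOn G (Icc 0 T) := continuousOn_const.add (hprim hkφ)
  have hKc : ContinuousOn K (Icc 0 T) := hprim hk
  have hGsub : ∀ s ∈ Icc 0 T, ∀ t ∈ Icc 0 T, G t - G s = ∫ τ in s..t, k τ * φ τ := by
    intro s hs t ht
    have := intervalIntegral.integral_interval_sub_left (hii hkφ 0 h0 t ht) (hii hkφ 0 h0 s hs)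
    simp only [hG]; linarith
  have hKsub : ∀ s ∈ Icc 0 T, ∀ t ∈ Icc 0 T, K t - K s = ∫ τ in s..t, k τ := by
    intro s hs t ht
    exact intervalIntegral.integral_interval_sub_left (hii hk 0 h0 t ht) (hii hk 0 h0 s hs)
  have hGmono : ∀ s ∈ Icc 0 T, ∀ t ∈ Icc 0 T, s ≤ t → G s ≤ G t := by
    intro s hs t ht hst
    have : 0 ≤ ∫ τ in s..t, k τ * φ τ := intervalIntegral.integral_nonneg hst
      fun τ hτ => mul_nonneg (hk0 τ) (hφ0 τ ⟨hs.1.trans hτ.1, hτ.2.trans ht.2⟩)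
    linarith [hGsub s hs t ht]
  have hKmono : ∀ s ∈ Icc 0 T, ∀ t ∈ Icc 0 T, s ≤ t → K s ≤ K t := by
    intro s hs t ht hst
    have : 0 ≤ ∫ τ in s..t, k τ := intervalIntegral.integral_nonneg hst fun τ hτ => hk0 τ
    linarith [hKsub s hs t ht]
  have hG0 : G 0 = A := by simp [hG]
  have hGnn : ∀ t ∈ Icc 0 T, 0 ≤ G t := fun t ht => by
    have := hGmono 0 h0 t ht ht.1
    rw [hG0] at this; exact hA.trans this
  have step : ∀ s ∈ Icc 0 T, ∀ t ∈ Icc 0 T, s ≤ t → K t - K s ≤ 1 / 2 →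
      G t ≤ G s * Real.exp (2 * (K t - K s)) := by
    intro s hs t ht hst hx
    have hx0 : 0 ≤ K t - K s := by linarith [hKmono s hs t ht hst]
    have h1 : G t - G s ≤ G t * (K t - K s) := by
      rw [hGsub s hs t ht, hKsub s hs t ht, mul_comm, ← intervalIntegral.integral_mul_const]
      refine intervalIntegral.integral_mono_on hst (hii hkφ s hs t ht)
        ((hii hk s hs t ht).mul_const _) fun τ hτ => ?_
      have hτ' : τ ∈ Icc 0 T := ⟨hs.1.trans hτ.1, hτ.2.trans ht.2⟩
      exact mul_le_mul_of_nonneg_left ((h τ hτ').trans (hGmono τ hτ' t ht hτ.2)) (hk0 τ)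
    have h2 : 2 * (K t - K s) + 1 ≤ Real.exp (2 * (K t - K s)) := Real.add_one_le_exp _
    have h3 := hGnn t ht
    have h4 := hGnn s hs
    set x := K t - K s
    -- `h1` reads `G t * (1 - x) ≤ G s`, and `(1 - x) * (1 + 2 * x) ≥ 1` for `0 ≤ x ≤ 1 / 2`. This
    -- is the origin of the factor `2` in the exponent; it avoids differentiating `G`, which is only
    -- absolutely continuous.
    have h5 : G t ≤ G s * (2 * x + 1) := by
      nlinarith [mul_nonneg h3 (mul_nonneg hx0 (by linarith : 0 ≤ 1 - 2 * x)),
        mul_le_mul_of_nonneg_right h1 (by linarith : 0 ≤ 2 * x + 1)]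
    exact h5.trans (mul_le_mul_of_nonneg_left h2 h4)
  -- Continuous induction: the bound is a closed condition, and it propagates to the right because
  -- the continuous function `K` grows by less than `1 / 2` over a short time.
  have key : Icc 0 T ⊆ {t | G t ≤ A * Real.exp (2 * K t)} := by
    refine IsClosed.Icc_subset_of_forall_exists_gt ?_ ?_ ?_
    · have : ({t | G t ≤ A * Real.exp (2 * K t)} ∩ Icc 0 T)
          = {t ∈ Icc 0 T | G t ≤ A * Real.exp (2 * K t)} := by ext; simp [and_comm]
      rw [this]
      exact isClosed_Icc.isClosed_le hGc (by fun_prop)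
    · simp [hG, hK]
    · rintro x ⟨hx, hxT⟩ y hy
      have hxI : x ∈ Icc 0 T := ⟨hxT.1, hxT.2.le⟩
      have e1 : ∀ᶠ t in 𝓝[Icc 0 T] x, K t < K x + 1 / 2 :=
        (hKc x hxI).eventually_lt_const (by linarith)
      have e2 : 𝓝[>] x ≤ 𝓝[Icc 0 T] x := by
        rw [← nhdsWithin_Ioc_eq_nhdsGT hxT.2]
        exact nhdsWithin_mono _ fun t ht => ⟨hxT.1.trans ht.1.le, ht.2⟩
      have e3 : ∀ᶠ t in 𝓝[>] x, t ∈ Ioc x (min y T) := Ioc_mem_nhdsGT (lt_min hy hxT.2)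
      obtain ⟨t, ht1, ht2⟩ := ((e1.filter_mono e2).and e3).exists
      have htI : t ∈ Icc 0 T := ⟨hxT.1.trans ht2.1.le, ht2.2.trans (min_le_right _ _)⟩
      refine ⟨t, ?_, ht2.1, ht2.2.trans (min_le_left _ _)⟩
      have := step x hxI t htI ht2.1.le (by linarith)
      change G x ≤ _ at hx
      change G t ≤ _
      calc G t ≤ G x * Real.exp (2 * (K t - K x)) := this
        _ ≤ A * Real.exp (2 * K x) * Real.exp (2 * (K t - K x)) := by gcongr
        _ = A * Real.exp (2 * K t) := by rw [mul_assoc, ← Real.exp_add]; ring_nf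
  refine (h t₁ ht₁).trans ((key ht₁).trans ?_)
  gcongr
  exact hKmono t₁ ht₁ T ⟨hT, le_rfl⟩ ht₁.2

/-! ### Integration by parts for primitives of integrable functions -/

section Bilinear

variable {F G H : Type*} [NormedAddCommGroup F] [NormedSpace ℝ F] [CompleteSpace F]
  [NormedAddCommGroup G] [NormedSpace ℝ G] [CompleteSpace G]
  [NormedAddCommGroup H] [NormedSpace ℝ H] [CompleteSpace H]

/-- Both sides are the integral of `B (f τ) (g σ)` over the triangle `σ ≤ τ`, so this is Fubini. It
replaces integration by parts in the duality between state and costate and in the treatment of weak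
derivatives. -/
theorem integral_bilin_primitive (B : F →L[ℝ] G →L[ℝ] H) {a b : ℝ} (hab : a ≤ b)
    {f : ℝ → F} {g : ℝ → G} (hf : IntegrableOn f (Icc a b)) (hg : IntegrableOn g (Icc a b)) :
    ∫ τ in a..b, B (f τ) (∫ σ in a..τ, g σ) = ∫ σ in a..b, B (∫ τ in σ..b, f τ) (g σ) := by
  have hf' : IntegrableOn f (Ioc a b) := hf.mono_set Ioc_subset_Icc_self
  have hg' : IntegrableOn g (Ioc a b) := hg.mono_set Ioc_subset_Icc_self
  have hprod : Integrable (fun z : ℝ × ℝ => B (f z.1) (g z.2))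
      ((volume.restrict (Ioc a b)).prod (volume.restrict (Ioc a b))) :=
    hf'.op_fst_snd (op := fun x y => B x y) (by simpa [Function.uncurry_def] using by fun_prop)
      ⟨‖B‖, fun x y => B.le_opNorm₂ x y⟩ hg'
  have hS : MeasurableSet {z : ℝ × ℝ | z.2 ≤ z.1} := measurableSet_le measurable_snd measurable_fst
  have hprod' := hprod.indicator hS
  have hswap := integral_integral_swap (f := fun τ σ =>
    ({z : ℝ × ℝ | z.2 ≤ z.1}).indicator (fun z : ℝ × ℝ => B (f z.1) (g z.2)) (τ, σ)) hprod'
  rw [intervalIntegral.integral_of_le hab, intervalIntegral.integral_of_le hab]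
  have hL : ∀ τ ∈ Ioc a b, B (f τ) (∫ σ in a..τ, g σ) = ∫ σ in Ioc a b,
      ({z : ℝ × ℝ | z.2 ≤ z.1}).indicator (fun z : ℝ × ℝ => B (f z.1) (g z.2)) (τ, σ) := by
    intro τ hτ
    have : ∀ σ, ({z : ℝ × ℝ | z.2 ≤ z.1}).indicator (fun z : ℝ × ℝ => B (f z.1) (g z.2)) (τ, σ)
        = (Iic τ).indicator (fun σ => B (f τ) (g σ)) σ := by
      intro σ; simp [indicator]
    simp_rw [this]
    rw [setIntegral_indicator measurableSet_Iic, Ioc_inter_Iic, min_eq_right hτ.2,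
      intervalIntegral.integral_of_le hτ.1.le, ContinuousLinearMap.integral_comp_comm]
    exact hg'.mono_set (Ioc_subset_Ioc_right hτ.2)
  have hR : ∀ σ ∈ Ioc a b, B (∫ τ in σ..b, f τ) (g σ) = ∫ τ in Ioc a b,
      ({z : ℝ × ℝ | z.2 ≤ z.1}).indicator (fun z : ℝ × ℝ => B (f z.1) (g z.2)) (τ, σ) := by
    intro σ hσ
    have : ∀ τ, ({z : ℝ × ℝ | z.2 ≤ z.1}).indicator (fun z : ℝ × ℝ => B (f z.1) (g z.2)) (τ, σ)
        = (Ici σ).indicator (fun τ => B.flip (g σ) (f τ)) τ := by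
      intro τ; simp [indicator]
    simp_rw [this]
    have e : (Ioc a b ∩ Ici σ) = Icc σ b := by
      ext τ; simp only [mem_inter_iff, mem_Ioc, mem_Ici, mem_Icc]
      exact ⟨fun h => ⟨h.2, h.1.2⟩, fun h => ⟨⟨hσ.1.trans_le h.1, h.2⟩, h.1⟩⟩
    rw [setIntegral_indicator measurableSet_Ici, e, integral_Icc_eq_integral_Ioc,
      intervalIntegral.integral_of_le hσ.2, ContinuousLinearMap.integral_comp_comm]
    · rfl
    · exact hf'.mono_set (Ioc_subset_Ioc_left hσ.1.le)
  rw [setIntegral_congr_fun measurableSet_Ioc hL, setIntegral_congr_fun measurableSet_Ioc hR, hswap]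

end Bilinear

/-! ### Control-affine differential equations with integrable controls -/

section ControlAffine

variable {N : ℕ} {X : Type*} [NormedAddCommGroup X] [NormedSpace ℝ X]

theorem norm_sum_smul_le (c : EuclideanSpace ℝ (Fin N)) {G : Fin N → X} {B : ℝ}
    (hB : ∀ k, ‖G k‖ ≤ B) : ‖∑ k, c k • G k‖ ≤ N * B * ‖c‖ := by
  calc ‖∑ k, c k • G k‖ ≤ ∑ k : Fin N, ‖c‖ * B := by
        refine norm_sum_le_of_le _ fun k _ => ?_
        rw [norm_smul]
        exact mul_le_mul (PiLp.norm_apply_le c k) (hB k) (norm_nonneg _) (norm_nonneg _)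
    _ = N * B * ‖c‖ := by simp; ring

theorem integrableOn_coord {S : Set ℝ} {u : ℝ → EuclideanSpace ℝ (Fin N)} (hu : IntegrableOn u S)
    (k : Fin N) : IntegrableOn (fun τ => u τ k) S :=
  ContinuousLinearMap.integrable_comp (EuclideanSpace.proj (𝕜 := ℝ) k) hu

theorem integrableOn_sum_smul {T : ℝ} {u : ℝ → EuclideanSpace ℝ (Fin N)}
    (hu : IntegrableOn u (Icc 0 T)) {G : Fin N → ℝ → X} (hG : ∀ k, ContinuousOn (G k) (Icc 0 T)) :
    IntegrableOn (fun τ => ∑ k, u τ k • G k τ) (Icc 0 T) :=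
  integrable_finsetSum _ fun k _ =>
    (integrableOn_coord hu k).smul_continuousOn (hG k) isCompact_Icc

/-- The vector field `∑ₖ cₖ Fₖ`. -/
def affineField (F : Fin N → X → X) (c : EuclideanSpace ℝ (Fin N)) (z : X) : X :=
  ∑ k, c k • F k z

/-- `z` is a continuous solution on `[0,T]` of `z' = ∑ₖ uₖ Fₖ(z)`, `z(0) = z₀`, in integrated
form. -/
structure IsTraj (F : Fin N → X → X) (T : ℝ) (u : ℝ → EuclideanSpace ℝ (Fin N)) (z₀ : X)
    (z : ℝ → X) : Prop where
  continuousOn : ContinuousOn z (Icc 0 T)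
  eq : ∀ t ∈ Icc 0 T, z t = z₀ + ∫ τ in (0 : ℝ)..t, affineField F (u τ) (z τ)

/-- Split at the mixed term `affineField F c y`: changing the control costs the sup bound of the
fields, changing the point costs their Lipschitz constant. -/
theorem affineField_sub_le {F : Fin N → X → X} {S : Set X} {L : NNReal} {B : ℝ}
    (hL : ∀ k, LipschitzOnWith L (F k) S) (hB : ∀ k, ∀ x ∈ S, ‖F k x‖ ≤ B)
    (c d : EuclideanSpace ℝ (Fin N)) {x y : X} (hx : x ∈ S) (hy : y ∈ S) :
    ‖affineField F c x - affineField F d y‖ ≤ N * B * ‖c - d‖ + N * L * ‖c‖ * ‖x - y‖ := by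
  have e : affineField F c x - affineField F d y
      = ∑ k, (c - d) k • F k y + ∑ k, c k • (F k x - F k y) := by
    simp only [affineField, PiLp.sub_apply, ← Finset.sum_sub_distrib, ← Finset.sum_add_distrib]
    refine Finset.sum_congr rfl fun k _ => ?_
    module
  rw [e]
  refine (norm_add_le _ _).trans (add_le_add (norm_sum_smul_le _ fun k => hB k y hy) ?_)
  refine (norm_sum_smul_le c fun k => (hL k).norm_sub_le hx hy).trans (le_of_eq (by ring))

variable {F : Fin N → X → X} {T : ℝ} {u v : ℝ → EuclideanSpace ℝ (Fin N)} {z₀ y₀ : X} {z y : ℝ → X}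

theorem integrableOn_affineField (hF : ∀ k, Continuous (F k)) (hu : IntegrableOn u (Icc 0 T))
    (hz : ContinuousOn z (Icc 0 T)) :
    IntegrableOn (fun τ => affineField F (u τ) (z τ)) (Icc 0 T) :=
  integrableOn_sum_smul hu fun k => (hF k).comp_continuousOn hz

theorem intervalIntegrable_of_Icc {Y : Type*} [NormedAddCommGroup Y] {f : ℝ → Y}
    (hf : IntegrableOn f (Icc 0 T)) {s t : ℝ} (hs : s ∈ Icc 0 T) (ht : t ∈ Icc 0 T) : IntervalIntegrable f volume s t :=
  (hf.mono_set (uIcc_subset_Icc hs ht)).intervalIntegrable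

theorem intervalIntegral_mono_right {f : ℝ → ℝ} (hf : IntegrableOn f (Icc 0 T)) (hf0 : ∀ t, 0 ≤ f t)
    {t : ℝ} (ht : t ∈ Icc 0 T) : ∫ τ in (0 : ℝ)..t, f τ ≤ ∫ τ in (0 : ℝ)..T, f τ :=
  intervalIntegral.integral_mono_interval le_rfl ht.1 ht.2 (ae_of_all _ hf0)
    (intervalIntegrable_of_Icc hf ⟨le_rfl, ht.1.trans ht.2⟩ ⟨ht.1.trans ht.2, le_rfl⟩)

theorem continuousOn_primitive_Icc (hT : 0 ≤ T) {f : ℝ → X} (hf : IntegrableOn f (Icc 0 T)) :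
    ContinuousOn (fun t => ∫ τ in (0 : ℝ)..t, f τ) (Icc 0 T) := by
  have := intervalIntegral.continuousOn_primitive_interval (μ := volume) (f := f) (a := 0) (b := T)
    (by rwa [uIcc_of_le hT])
  rwa [uIcc_of_le hT] at this

/-- Only the values of the fields along the trajectory matter. This licenses every passage between
cut-off and original fields. -/
theorem IsTraj.congr_field {F' : Fin N → X → X} (hz : IsTraj F T u z₀ z)
    (hF : ∀ k, ∀ t ∈ Icc 0 T, F k (z t) = F' k (z t)) : IsTraj F' T u z₀ z := by
  refine ⟨hz.continuousOn, fun t ht => ?_⟩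
  rw [hz.eq t ht]
  congr 1
  refine intervalIntegral.integral_congr fun τ hτ => ?_
  rw [uIcc_of_le ht.1] at hτ
  simp only [affineField, hF _ τ ⟨hτ.1, hτ.2.trans ht.2⟩]

theorem IsTraj.zero_eq (hT : 0 ≤ T) (hz : IsTraj F T u z₀ z) : z 0 = z₀ := by
  simpa using hz.eq 0 ⟨le_rfl, hT⟩

/-- Gronwall for `‖z - y‖`, based on `affineField_sub_le`. Since the bounds are needed only on a set
`S` containing both trajectories, it also serves for fields that are merely locally Lipschitz. -/
theorem IsTraj.norm_sub_le {S : Set X} {L : NNReal} {B : ℝ} (hB0 : 0 ≤ B)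
    (hL : ∀ k, LipschitzOnWith L (F k) S) (hB : ∀ k, ∀ x ∈ S, ‖F k x‖ ≤ B)
    (hF : ∀ k, Continuous (F k)) (hu : IntegrableOn u (Icc 0 T)) (hv : IntegrableOn v (Icc 0 T))
    (hz : IsTraj F T u z₀ z) (hy : IsTraj F T v y₀ y)
    (hzS : ∀ t ∈ Icc 0 T, z t ∈ S) (hyS : ∀ t ∈ Icc 0 T, y t ∈ S) :
    ∀ t ∈ Icc 0 T, ‖z t - y t‖ ≤ (‖z₀ - y₀‖ + N * B * ∫ τ in (0 : ℝ)..T, ‖u τ - v τ‖)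
      * Real.exp (2 * ∫ τ in (0 : ℝ)..T, N * L * ‖u τ‖) := by
  intro t₁ ht₁
  have hT : 0 ≤ T := ht₁.1.trans ht₁.2
  have h0 : (0 : ℝ) ∈ Icc 0 T := ⟨le_rfl, hT⟩
  have huv : IntegrableOn (fun τ => ‖u τ - v τ‖) (Icc 0 T) := (hu.sub hv).norm
  have hcont : ContinuousOn (fun t => ‖z t - y t‖) (Icc 0 T) :=
    (hz.continuousOn.sub hy.continuousOn).norm
  have hk : IntegrableOn (fun τ => N * L * ‖u τ‖) (Icc 0 T) := hu.norm.const_mul _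
  have hI : 0 ≤ ∫ τ in (0 : ℝ)..T, ‖u τ - v τ‖ :=
    intervalIntegral.integral_nonneg hT fun _ _ => norm_nonneg _
  refine gronwall_integral hcont hk (fun _ => by positivity) (fun _ _ => norm_nonneg _)
    (by positivity) (fun t ht => ?_) t₁ ht₁
  have iz := intervalIntegrable_of_Icc (integrableOn_affineField hF hu hz.continuousOn) h0 ht
  have iy := intervalIntegrable_of_Icc (integrableOn_affineField hF hv hy.continuousOn) h0 ht
  have i1 := (intervalIntegrable_of_Icc huv h0 ht).const_mul (N * B)
  have i2 := intervalIntegrable_of_Icc (hk.mul_continuousOn hcont isCompact_Icc) h0 ht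
  have e : z t - y t = (z₀ - y₀)
      + ∫ τ in (0 : ℝ)..t, (affineField F (u τ) (z τ) - affineField F (v τ) (y τ)) := by
    rw [intervalIntegral.integral_sub iz iy, hz.eq t ht, hy.eq t ht]; abel
  have hb : ‖∫ τ in (0 : ℝ)..t, (affineField F (u τ) (z τ) - affineField F (v τ) (y τ))‖
      ≤ ∫ τ in (0 : ℝ)..t, (N * B * ‖u τ - v τ‖ + N * L * ‖u τ‖ * ‖z τ - y τ‖) := by
    refine intervalIntegral.norm_integral_le_of_norm_le ht.1 (ae_of_all _ fun τ hτ => ?_) (i1.add i2)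
    have hτ' : τ ∈ Icc 0 T := ⟨hτ.1.le, hτ.2.trans ht.2⟩
    exact affineField_sub_le hL hB _ _ (hzS τ hτ') (hyS τ hτ')
  rw [intervalIntegral.integral_add i1 i2, intervalIntegral.integral_const_mul] at hb
  rw [e]
  have hm := mul_le_mul_of_nonneg_left (intervalIntegral_mono_right huv (fun _ => norm_nonneg _) ht)
    (by positivity : 0 ≤ N * B)
  linarith [norm_add_le (z₀ - y₀)
    (∫ τ in (0 : ℝ)..t, (affineField F (u τ) (z τ) - affineField F (v τ) (y τ)))]

/-- Solutions exist for continuous controls and bounded Lipschitz fields. -/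
theorem exists_isTraj_of_continuous [CompleteSpace X] (hT : 0 ≤ T) {L : NNReal} {B : ℝ}
    (hB0 : 0 ≤ B) (hL : ∀ k, LipschitzWith L (F k)) (hB : ∀ k x, ‖F k x‖ ≤ B) (hu : Continuous u)
    (z₀ : X) : ∃ z, IsTraj F T u z₀ z := by
  obtain ⟨C, hC⟩ := isCompact_Icc.exists_bound_of_continuousOn (hu.continuousOn (s := Icc 0 T))
  have hC0 : 0 ≤ C := (norm_nonneg _).trans (hC 0 ⟨le_rfl, hT⟩)
  -- The speed is at most `N * B * C`, so a ball of radius `N * B * C * T` holds the motion on all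
  -- of `[0, T]` and no continuation argument is needed.
  have hPL : IsPicardLindelof (fun t => affineField F (u t)) (⟨0, le_rfl, hT⟩ : Icc 0 T) z₀
      ⟨N * B * C * T, by positivity⟩ 0 ⟨N * B * C, by positivity⟩ ⟨N * L * C, by positivity⟩ := by
    refine ⟨fun t ht => ?_, fun x _ => ?_, fun t ht x _ => ?_, ?_⟩
    · refine (LipschitzWith.of_dist_le_mul fun x y => ?_).lipschitzOnWith
      rw [dist_eq_norm, dist_eq_norm]
      refine (affineField_sub_le (S := univ) (fun k => (hL k).lipschitzOnWith)
        (fun k x _ => hB k x) (u t) (u t) (mem_univ x) (mem_univ y)).trans ?_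
      simp only [sub_self, norm_zero, mul_zero, zero_add]
      change _ ≤ N * L * C * ‖x - y‖
      gcongr
      exact hC t ht
    · unfold affineField
      fun_prop
    · refine (norm_sum_smul_le (u t) fun k => hB k x).trans ?_
      change _ ≤ N * B * C
      gcongr
      exact hC t ht
    · change N * B * C * max (T - 0) (0 - 0) ≤ N * B * C * T - 0
      simp [hT]
  obtain ⟨z, hz0, hz⟩ := hPL.exists_eq_forall_mem_Icc_hasDerivWithinAt (x := z₀) (by simp)
  have hzc : ContinuousOn z (Icc 0 T) := fun t ht => (hz t ht).continuousWithinAt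
  have hVc : ContinuousOn (fun t => affineField F (u t) (z t)) (Icc 0 T) := by
    unfold affineField
    refine continuousOn_finsetSum _ fun k _ => ?_
    exact ContinuousOn.smul (by fun_prop) ((hL k).continuous.comp_continuousOn hzc)
  refine ⟨z, hzc, fun t ht => ?_⟩
  have hsub : Icc 0 t ⊆ Icc 0 T := Icc_subset_Icc_right ht.2
  have := intervalIntegral.integral_eq_sub_of_hasDerivAt_of_le ht.1 (hzc.mono hsub)
    (fun x hx => (hz x (hsub (Ioo_subset_Icc_self hx))).hasDerivAt
      (Icc_mem_nhds hx.1 (hx.2.trans_le ht.2)))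
    ((hVc.mono hsub).intervalIntegrable_of_Icc ht.1)
  rw [this]
  simp only at hz0
  rw [hz0]; abel

/-- A uniform limit of solutions, with controls converging in `L¹`, is a solution. -/
theorem IsTraj.of_tendsto (hT : 0 ≤ T) {L : NNReal} {B : ℝ} (hB0 : 0 ≤ B)
    (hL : ∀ k, LipschitzWith L (F k)) (hB : ∀ k x, ‖F k x‖ ≤ B) (hu : IntegrableOn u (Icc 0 T))
    {v : ℕ → ℝ → EuclideanSpace ℝ (Fin N)} (hv : ∀ n, IntegrableOn (v n) (Icc 0 T))
    (hvu : Tendsto (fun n => ∫ τ in (0 : ℝ)..T, ‖u τ - v n τ‖) atTop (𝓝 0))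
    {y : ℕ → ℝ → X} (hy : ∀ n, IsTraj F T (v n) z₀ (y n))
    (hyz : TendstoUniformlyOn y z atTop (Icc 0 T)) : IsTraj F T u z₀ z := by
  have hF : ∀ k, Continuous (F k) := fun k => (hL k).continuous
  have hzc : ContinuousOn z (Icc 0 T) :=
    hyz.continuousOn (Frequently.of_forall fun n => (hy n).continuousOn)
  refine ⟨hzc, fun t ht => ?_⟩
  have h0 : (0 : ℝ) ∈ Icc 0 T := ⟨le_rfl, hT⟩
  have iz := intervalIntegrable_of_Icc (integrableOn_affineField hF hu hzc) h0 ht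
  set I := ∫ τ in (0 : ℝ)..T, ‖u τ‖ with hI
  refine eq_of_forall_dist_le fun ε hε => ?_
  -- A uniform error `δ` in the trajectory and an `L¹` error `δ` in the control violate the integral
  -- equation by at most `δ * (1 + N * B + N * L * I) = ε / 2`.
  have hδ : 0 < ε / (2 * (1 + N * B + N * L * I)) := by
    have : 0 ≤ I := intervalIntegral.integral_nonneg hT fun _ _ => norm_nonneg _
    positivity
  set δ := ε / (2 * (1 + N * B + N * L * I)) with hδd
  obtain ⟨n, hn1, hn2⟩ := ((Metric.tendstoUniformlyOn_iff.1 hyz δ hδ).and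
    (hvu.eventually_lt_const hδ)).exists
  have iy := intervalIntegrable_of_Icc
    (integrableOn_affineField hF (hv n) (hy n).continuousOn) h0 ht
  have huv : IntegrableOn (fun τ => ‖u τ - v n τ‖) (Icc 0 T) := (hu.sub (hv n)).norm
  have i1 := (intervalIntegrable_of_Icc huv h0 ht).const_mul (N * B)
  have i2 := (intervalIntegrable_of_Icc hu.norm h0 ht).const_mul (N * L * δ)
  have e : z t - (z₀ + ∫ τ in (0 : ℝ)..t, affineField F (u τ) (z τ)) = (z t - y n t)
      - ∫ τ in (0 : ℝ)..t, (affineField F (u τ) (z τ) - affineField F (v n τ) (y n τ)) := by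
    rw [intervalIntegral.integral_sub iz iy, (hy n).eq t ht]; abel
  have hb : ‖∫ τ in (0 : ℝ)..t, (affineField F (u τ) (z τ) - affineField F (v n τ) (y n τ))‖
      ≤ ∫ τ in (0 : ℝ)..t, (N * B * ‖u τ - v n τ‖ + N * L * δ * ‖u τ‖) := by
    refine intervalIntegral.norm_integral_le_of_norm_le ht.1 (ae_of_all _ fun τ hτ => ?_) (i1.add i2)
    refine (affineField_sub_le (S := univ) (fun k => (hL k).lipschitzOnWith)
      (fun k x _ => hB k x) _ _ (mem_univ _) (mem_univ _)).trans ?_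
    have := hn1 τ ⟨hτ.1.le, hτ.2.trans ht.2⟩
    rw [dist_eq_norm] at this
    rw [mul_right_comm _ δ]
    gcongr
  rw [intervalIntegral.integral_add i1 i2, intervalIntegral.integral_const_mul,
    intervalIntegral.integral_const_mul] at hb
  have hm1 := mul_le_mul_of_nonneg_left
    (intervalIntegral_mono_right huv (fun _ => norm_nonneg _) ht) (by positivity : 0 ≤ N * B)
  have hm2 := mul_le_mul_of_nonneg_left
    (intervalIntegral_mono_right hu.norm (fun _ => norm_nonneg _) ht)
    (by positivity : 0 ≤ N * L * δ)
  have hm3 := mul_le_mul_of_nonneg_left hn2.le (by positivity : 0 ≤ N * B)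
  have h4 := hn1 t ht
  rw [dist_eq_norm] at h4
  rw [dist_eq_norm, e]
  have hε' : δ * (1 + N * B + N * L * I) = ε / 2 := by
    have : 0 ≤ I := intervalIntegral.integral_nonneg hT fun _ _ => norm_nonneg _
    rw [hδd]; field_simp
  have := _root_.norm_sub_le (z t - y n t)
    (∫ τ in (0 : ℝ)..t, (affineField F (u τ) (z τ) - affineField F (v n τ) (y n τ)))
  nlinarith

theorem exists_continuous_tendsto_L1 (hT : 0 ≤ T) (hu : IntegrableOn u (Icc 0 T)) :
    ∃ v : ℕ → ℝ → EuclideanSpace ℝ (Fin N), (∀ n, Continuous (v n)) ∧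
      ∀ n, ∫ τ in (0 : ℝ)..T, ‖u τ - v n τ‖ ≤ 1 / ((n : ℝ) + 1) := by
  have : ∀ n : ℕ, ∃ g : ℝ → EuclideanSpace ℝ (Fin N), Continuous g ∧
      ∫ τ in (0 : ℝ)..T, ‖u τ - g τ‖ ≤ 1 / ((n : ℝ) + 1) := by
    intro n
    obtain ⟨g, hg, -⟩ := Integrable.exists_boundedContinuous_integral_sub_le
      (μ := volume.restrict (Icc 0 T)) hu (ε := 1 / ((n : ℝ) + 1)) (by positivity)
    refine ⟨g, g.continuous, ?_⟩
    rwa [intervalIntegral.integral_of_le hT, ← integral_Icc_eq_integral_Ioc]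
  choose g hg1 hg2 using this
  exact ⟨g, hg1, hg2⟩

/-- Trajectories of continuous controls that converge to `u` in `L¹` are uniformly Cauchy by
`IsTraj.norm_sub_le`, and their limit is a solution by `IsTraj.of_tendsto`. -/
theorem exists_isTraj_of_bounded [CompleteSpace X] (hT : 0 ≤ T) {L : NNReal} {B : ℝ}
    (hB0 : 0 ≤ B) (hL : ∀ k, LipschitzWith L (F k)) (hB : ∀ k x, ‖F k x‖ ≤ B)
    (hu : IntegrableOn u (Icc 0 T)) (z₀ : X) : ∃ z, IsTraj F T u z₀ z := by
  obtain ⟨v, hvc, hvu⟩ := exists_continuous_tendsto_L1 hT hu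
  have hv : ∀ n, IntegrableOn (v n) (Icc 0 T) := fun n => (hvc n).continuousOn.integrableOn_Icc
  choose y hy using fun n => exists_isTraj_of_continuous hT hB0 hL hB (hvc n) z₀
  have hlim : Tendsto (fun n : ℕ => 1 / ((n : ℝ) + 1)) atTop (𝓝 0) :=
    tendsto_one_div_add_atTop_nhds_zero_nat
  have h0 : (0 : ℝ) ∈ Icc 0 T := ⟨le_rfl, hT⟩
  have hTT : T ∈ Icc 0 T := ⟨hT, le_rfl⟩
  have huv0 : ∀ n, 0 ≤ ∫ τ in (0 : ℝ)..T, ‖u τ - v n τ‖ := fun n =>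
    intervalIntegral.integral_nonneg hT fun _ _ => norm_nonneg _
  have hvu' : Tendsto (fun n => ∫ τ in (0 : ℝ)..T, ‖u τ - v n τ‖) atTop (𝓝 0) :=
    squeeze_zero huv0 hvu hlim
  have i1 : ∀ n, IntervalIntegrable (fun τ => ‖u τ - v n τ‖) volume 0 T := fun n =>
    intervalIntegrable_of_Icc (hu.sub (hv n)).norm h0 hTT
  have i2 : IntervalIntegrable (fun τ => ‖u τ‖) volume 0 T :=
    intervalIntegrable_of_Icc hu.norm h0 hTT
  set I := ∫ τ in (0 : ℝ)..T, ‖u τ‖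
  -- The exponential factor has to be uniform in `n`; the `L¹` error is at most `1`, hence `∫ ‖v n‖
  -- ≤ I + 1`.
  set M := Real.exp (2 * (N * L * (I + 1)))
  have hest : ∀ n m, ∀ t ∈ Icc 0 T, dist (y n t) (y m t)
      ≤ N * B * (1 / ((n : ℝ) + 1) + 1 / ((m : ℝ) + 1)) * M := by
    intro n m t ht
    have h1 := IsTraj.norm_sub_le hB0 (fun k => (hL k).lipschitzOnWith (s := univ))
      (fun k x _ => hB k x) (fun k => (hL k).continuous) (hv n) (hv m) (hy n) (hy m)
      (fun _ _ => mem_univ _) (fun _ _ => mem_univ _) t ht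
    rw [dist_eq_norm]
    refine h1.trans ?_
    rw [sub_self, norm_zero, zero_add, intervalIntegral.integral_const_mul]
    have iv : ∀ n, IntervalIntegrable (fun τ => ‖v n τ‖) volume 0 T := fun n =>
      intervalIntegrable_of_Icc (hv n).norm h0 hTT
    gcongr
    · calc ∫ τ in (0 : ℝ)..T, ‖v n τ - v m τ‖
          ≤ ∫ τ in (0 : ℝ)..T, (‖u τ - v n τ‖ + ‖u τ - v m τ‖) := by
            refine intervalIntegral.integral_mono_on hT
              (intervalIntegrable_of_Icc ((hv n).sub (hv m)).norm h0 hTT) ((i1 n).add (i1 m))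
              fun τ _ => ?_
            rw [norm_sub_rev (u τ) (v n τ)]
            exact norm_sub_le_norm_sub_add_norm_sub _ _ _
        _ ≤ _ := by
            rw [intervalIntegral.integral_add (i1 n) (i1 m)]
            exact add_le_add (hvu n) (hvu m)
    · refine Real.exp_le_exp.2 ?_
      gcongr
      calc ∫ τ in (0 : ℝ)..T, ‖v n τ‖ ≤ ∫ τ in (0 : ℝ)..T, (‖u τ‖ + ‖u τ - v n τ‖) := by
            refine intervalIntegral.integral_mono_on hT (iv n) (i2.add (i1 n)) fun τ _ => ?_
            have := _root_.norm_sub_le (u τ) (u τ - v n τ)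
            rwa [sub_sub_cancel] at this
        _ ≤ I + 1 := by
            rw [intervalIntegral.integral_add i2 (i1 n)]
            refine add_le_add le_rfl ((hvu n).trans ?_)
            rw [div_le_one (by positivity)]
            linarith [n.cast_nonneg (α := ℝ)]
  have hlim2 : Tendsto (fun p : ℕ × ℕ =>
      N * B * (1 / ((p.1 : ℝ) + 1) + 1 / ((p.2 : ℝ) + 1)) * M) atTop (𝓝 0) := by
    have := (((hlim.comp tendsto_fst).add (hlim.comp tendsto_snd)).const_mul (N * B)).mul_const M
    simpa [prod_atTop_atTop_eq, Function.comp_def] using this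
  have hcauchy : UniformCauchySeqOn y atTop (Icc 0 T) := by
    rw [Metric.uniformCauchySeqOn_iff]
    intro ε hε
    obtain ⟨⟨a, b⟩, hab⟩ := eventually_atTop.1 (hlim2.eventually_lt_const hε)
    refine ⟨max a b, fun m hm n hn t ht => (hest m n t ht).trans_lt ?_⟩
    exact hab (m, n) ⟨(le_max_left _ _).trans hm, (le_max_right _ _).trans hn⟩
  choose! z hz using fun t (ht : t ∈ Icc 0 T) =>
    cauchySeq_tendsto_of_complete (hcauchy.cauchySeq ht)
  exact ⟨z, IsTraj.of_tendsto hT hB0 hL hB hu hv hvu' hy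
    (hcauchy.tendstoUniformlyOn_of_tendsto hz)⟩

end ControlAffine

/-! ### Fields with linear growth and the adjoint equation -/

section SmoothFields

variable {N : ℕ} {E : Type*} [NormedAddCommGroup E] [NormedSpace ℝ E] [FiniteDimensional ℝ E]

theorem exists_cutoff (R : ℝ) : ∃ χ : E → ℝ, ContDiff ℝ ∞ χ ∧ HasCompactSupport χ ∧
    (∀ x, ‖x‖ ≤ R → χ x = 1) ∧ ∀ x, 0 ≤ χ x ∧ χ x ≤ 1 := by
  let b : ContDiffBump (0 : E) := ⟨max R 1, max R 1 + 1, by positivity, by linarith⟩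
  refine ⟨b, b.contDiff, b.hasCompactSupport, fun x hx => b.one_of_mem_closedBall ?_,
    fun x => ⟨b.nonneg, b.le_one⟩⟩
  simpa [b] using Or.inl hx

theorem exists_lipschitz_bound_closedBall {Y : Type*} [NormedAddCommGroup Y] [NormedSpace ℝ Y]
    {F : Fin N → E → Y} (hF : ∀ k, ContDiff ℝ 1 (F k)) (R : ℝ) :
    ∃ (L : NNReal) (B : ℝ), 0 ≤ B ∧
      (∀ k, LipschitzOnWith L (F k) (Metric.closedBall 0 R)) ∧
      ∀ k, ∀ x ∈ Metric.closedBall (0 : E) R, ‖F k x‖ ≤ B := by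
  have hK : IsCompact (Metric.closedBall (0 : E) R) := isCompact_closedBall _ _
  choose L hL using fun k => (hF k).contDiffOn.exists_lipschitzOnWith one_ne_zero
    (convex_closedBall (0 : E) R) hK
  choose B hB using fun k => hK.exists_bound_of_continuousOn ((hF k).continuous.continuousOn)
  refine ⟨∑ k, L k, ∑ k, |B k|, Finset.sum_nonneg fun _ _ => abs_nonneg _, fun k => ?_,
    fun k x hx => ?_⟩
  · exact (hL k).weaken (Finset.single_le_sum (fun _ _ => zero_le) (Finset.mem_univ k))
  · exact ((hB k x hx).trans (le_abs_self _)).trans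
      (Finset.single_le_sum (f := fun k => |B k|) (fun _ _ => abs_nonneg _) (Finset.mem_univ k))

theorem exists_lipschitz_bound_of_compactSupport {X Y : Type*} [NormedAddCommGroup X]
    [NormedSpace ℝ X] [NormedAddCommGroup Y] [NormedSpace ℝ Y] {F : Fin N → X → Y}
    (hF : ∀ k, ContDiff ℝ 1 (F k)) (hc : ∀ k, HasCompactSupport (F k)) :
    ∃ (L : NNReal) (B : ℝ), 0 ≤ B ∧ (∀ k, LipschitzWith L (F k)) ∧ ∀ k x, ‖F k x‖ ≤ B := by
  choose L hL using fun k => (hF k).lipschitzWith_of_hasCompactSupport (hc k) one_ne_zero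
  choose B hB using fun k => (hc k).exists_bound_of_continuous (hF k).continuous
  refine ⟨∑ k, L k, ∑ k, |B k|, Finset.sum_nonneg fun _ _ => abs_nonneg _, fun k => ?_,
    fun k x => ?_⟩
  · exact (hL k).weaken (Finset.single_le_sum (fun _ _ => zero_le) (Finset.mem_univ k))
  · exact ((hB k x).trans (le_abs_self _)).trans
      (Finset.single_le_sum (f := fun k => |B k|) (fun _ _ => abs_nonneg _) (Finset.mem_univ k))

/-- The derivative is Lipschitz on the ball, so along the segment it differs from its value at `x`
by at most `K * ‖y - x‖`; the mean value inequality supplies the second factor. -/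
theorem exists_taylor_bound_closedBall {Y : Type*} [NormedAddCommGroup Y] [NormedSpace ℝ Y]
    {f : E → Y} (hf : ContDiff ℝ 2 f) (R : ℝ) :
    ∃ Q : ℝ, 0 ≤ Q ∧ ∀ x ∈ Metric.closedBall (0 : E) R, ∀ y ∈ Metric.closedBall (0 : E) R,
      ‖f y - f x - fderiv ℝ f x (y - x)‖ ≤ Q * ‖y - x‖ ^ 2 := by
  have hd : ContDiff ℝ 1 (fderiv ℝ f) := hf.fderiv_right (by norm_num)
  obtain ⟨K, hK⟩ := hd.contDiffOn.exists_lipschitzOnWith one_ne_zero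
    (convex_closedBall (0 : E) R) (isCompact_closedBall _ _)
  refine ⟨K, K.2, fun x hx y hy => ?_⟩
  have hseg : segment ℝ x y ⊆ Metric.closedBall (0 : E) R :=
    (convex_closedBall (0 : E) R).segment_subset hx hy
  have := (convex_segment x y).norm_image_sub_le_of_norm_hasFDerivWithin_le' (f := f)
    (f' := fderiv ℝ f) (φ := fderiv ℝ f x) (C := K * ‖y - x‖)
    (fun w _ => ((hf.differentiable (by norm_num)) w).hasFDerivAt.hasFDerivWithinAt)
    (fun w hw => ?_) (left_mem_segment ℝ x y) (right_mem_segment ℝ x y)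
  · exact this.trans (le_of_eq (by ring))
  · refine (hK.norm_sub_le (hseg hw) hx).trans ?_
    gcongr
    rw [← dist_eq_norm, ← dist_eq_norm, dist_comm y]
    exact segment_subset_closedBall_left x y hw

variable {F : Fin N → E → E} {T : ℝ} {u v : ℝ → EuclideanSpace ℝ (Fin N)} {z₀ y₀ : E} {z y : ℝ → E}

/-- Gronwall for `1 + ‖z‖`, the quantity that controls the fields. -/
theorem IsTraj.norm_le_of_growth {X : Type*} [NormedAddCommGroup X] [NormedSpace ℝ X]
    {F : Fin N → X → X} {z₀ : X} {z : ℝ → X} {C : ℝ} (hC0 : 0 ≤ C)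
    (hC : ∀ k x, ‖F k x‖ ≤ C * (1 + ‖x‖)) (hu : IntegrableOn u (Icc 0 T))
    (hz : IsTraj F T u z₀ z) : ∀ t ∈ Icc 0 T,
      ‖z t‖ ≤ (1 + ‖z₀‖) * Real.exp (2 * ∫ τ in (0 : ℝ)..T, N * C * ‖u τ‖) := by
  intro t₁ ht₁
  have hcont : ContinuousOn (fun t => 1 + ‖z t‖) (Icc 0 T) :=
    continuousOn_const.add hz.continuousOn.norm
  have hk : IntegrableOn (fun τ => N * C * ‖u τ‖) (Icc 0 T) := hu.norm.const_mul _
  refine le_trans (by linarith : ‖z t₁‖ ≤ 1 + ‖z t₁‖) ?_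
  refine gronwall_integral hcont hk (fun _ => by positivity) (fun _ _ => by positivity)
    (by positivity) (fun t ht => ?_) t₁ ht₁
  have i2 := intervalIntegrable_of_Icc (hk.mul_continuousOn hcont isCompact_Icc)
    ⟨le_rfl, ht₁.1.trans ht₁.2⟩ ht
  have hb : ‖∫ τ in (0 : ℝ)..t, affineField F (u τ) (z τ)‖
      ≤ ∫ τ in (0 : ℝ)..t, N * C * ‖u τ‖ * (1 + ‖z τ‖) := by
    refine intervalIntegral.norm_integral_le_of_norm_le ht.1 (ae_of_all _ fun τ hτ => ?_) i2
    exact (norm_sum_smul_le _ fun k => hC k (z τ)).trans (le_of_eq (by ring))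
  rw [hz.eq t ht]
  linarith [norm_add_le z₀ (∫ τ in (0 : ℝ)..t, affineField F (u τ) (z τ))]

/-- Multiplying the fields by a cut-off with values in `[0, 1]` preserves the growth bound, hence
the a priori estimate. With the cut-off equal to `1` on the ball given by that estimate, the
solution of the truncated system never sees the truncation. -/
theorem exists_isTraj_of_growth (hT : 0 ≤ T) (hF : ∀ k, ContDiff ℝ 1 (F k)) {C : ℝ} (hC0 : 0 ≤ C)
    (hC : ∀ k x, ‖F k x‖ ≤ C * (1 + ‖x‖)) (hu : IntegrableOn u (Icc 0 T)) (z₀ : E) :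
    ∃ z, IsTraj F T u z₀ z := by
  have := FiniteDimensional.complete ℝ E
  obtain ⟨χ, hχ, hχc, hχ1, hχ01⟩ := exists_cutoff (E := E)
    ((1 + ‖z₀‖) * Real.exp (2 * ∫ τ in (0 : ℝ)..T, N * C * ‖u τ‖))
  have hG : ∀ k, ContDiff ℝ 1 (fun x => χ x • F k x) := fun k =>
    (hχ.of_le (mod_cast le_top)).smul (hF k)
  obtain ⟨L, B, hB0, hL, hB⟩ := exists_lipschitz_bound_of_compactSupport hG
    fun k => hχc.smul_right
  obtain ⟨z, hz⟩ := exists_isTraj_of_bounded hT hB0 hL hB hu z₀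
  refine ⟨z, hz.congr_field fun k t ht => ?_⟩
  have := hz.norm_le_of_growth hC0 (fun k x => ?_) hu t ht
  · simp [hχ1 _ this]
  · rw [norm_smul, Real.norm_of_nonneg (hχ01 x).1]
    exact (mul_le_of_le_one_left (norm_nonneg _) (hχ01 x).2).trans (hC k x)

theorem exists_norm_bound_Icc {X : Type*} [NormedAddCommGroup X] {z : ℝ → X}
    (hz : ContinuousOn z (Icc 0 T)) : ∃ R, ∀ t ∈ Icc 0 T, ‖z t‖ ≤ R :=
  isCompact_Icc.exists_bound_of_continuousOn hz

theorem IsTraj.unique (hF : ∀ k, ContDiff ℝ 1 (F k)) (hu : IntegrableOn u (Icc 0 T))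
    (hz : IsTraj F T u z₀ z) (hy : IsTraj F T u z₀ y) : ∀ t ∈ Icc 0 T, z t = y t := by
  intro t ht
  obtain ⟨R₁, h1⟩ := exists_norm_bound_Icc hz.continuousOn
  obtain ⟨R₂, h2⟩ := exists_norm_bound_Icc hy.continuousOn
  obtain ⟨L, B, hB0, hL, hB⟩ := exists_lipschitz_bound_closedBall hF (max R₁ R₂)
  have := IsTraj.norm_sub_le hB0 hL hB (fun k => (hF k).continuous) hu hu hz hy
    (fun t ht => by simpa using Or.inl (h1 t ht)) (fun t ht => by simpa using Or.inr (h2 t ht)) t ht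
  simpa [sub_eq_zero] using this

/-- Joint continuity in time and in a parameter on which the initial value depends continuously. -/
theorem continuousOn_prod_of_isTraj (hF : ∀ k, ContDiff ℝ 1 (F k)) {C : ℝ} (hC0 : 0 ≤ C)
    (hC : ∀ k x, ‖F k x‖ ≤ C * (1 + ‖x‖)) (hu : IntegrableOn u (Icc 0 T)) {ζ : ℝ → E}
    (hζ : ContinuousOn ζ (Icc 0 1)) {Z : ℝ → ℝ → E}
    (hZ : ∀ s ∈ Icc (0 : ℝ) 1, IsTraj F T u (ζ s) (fun t => Z t s)) :
    ContinuousOn (fun p : ℝ × ℝ => Z p.1 p.2) (Icc 0 T ×ˢ Icc 0 1) := by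
  obtain ⟨M, hM⟩ := isCompact_Icc.exists_bound_of_continuousOn hζ
  set R := (1 + M) * Real.exp (2 * ∫ τ in (0 : ℝ)..T, N * C * ‖u τ‖) with hR
  have hZR : ∀ s ∈ Icc (0 : ℝ) 1, ∀ t ∈ Icc 0 T, Z t s ∈ Metric.closedBall (0 : E) R := by
    intro s hs t ht
    rw [mem_closedBall_zero_iff]
    refine ((hZ s hs).norm_le_of_growth hC0 hC hu t ht).trans ?_
    rw [hR]; gcongr; exact hM s hs
  obtain ⟨L, B, hB0, hL, hB⟩ := exists_lipschitz_bound_closedBall hF R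
  set K := Real.exp (2 * ∫ τ in (0 : ℝ)..T, N * L * ‖u τ‖)
  have hlip : ∀ s ∈ Icc (0 : ℝ) 1, ∀ s' ∈ Icc (0 : ℝ) 1, ∀ t ∈ Icc 0 T,
      ‖Z t s - Z t s'‖ ≤ ‖ζ s - ζ s'‖ * K := by
    intro s hs s' hs' t ht
    simpa [K] using IsTraj.norm_sub_le hB0 hL hB (fun k => (hF k).continuous) hu hu (hZ s hs)
      (hZ s' hs') (hZR s hs) (hZR s' hs') t ht
  rintro ⟨t, s⟩ ⟨ht, hs⟩
  simp only at ht hs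
  rw [ContinuousWithinAt, tendsto_iff_norm_sub_tendsto_zero]
  have h1 : Tendsto (fun p : ℝ × ℝ => ‖ζ p.2 - ζ s‖ * K) (𝓝[Icc 0 T ×ˢ Icc 0 1] (t, s)) (𝓝 0) := by
    have : Tendsto (fun p : ℝ × ℝ => ζ p.2) (𝓝[Icc 0 T ×ˢ Icc 0 1] (t, s)) (𝓝 (ζ s)) := by
      rw [nhdsWithin_prod_eq]; exact Tendsto.comp (hζ s hs) tendsto_snd
    simpa using ((this.sub_const (ζ s)).norm).mul_const K
  have h2 : Tendsto (fun p : ℝ × ℝ => ‖Z p.1 s - Z t s‖) (𝓝[Icc 0 T ×ˢ Icc 0 1] (t, s)) (𝓝 0) := by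
    have : Tendsto (fun p : ℝ × ℝ => Z p.1 s) (𝓝[Icc 0 T ×ˢ Icc 0 1] (t, s)) (𝓝 (Z t s)) := by
      rw [nhdsWithin_prod_eq]; exact Tendsto.comp ((hZ s hs).continuousOn t ht) tendsto_fst
    simpa using (this.sub_const (Z t s)).norm
  have h3 := h1.add h2
  rw [add_zero] at h3
  refine squeeze_zero' (Eventually.of_forall fun _ => norm_nonneg _) ?_ h3
  filter_upwards [self_mem_nhdsWithin] with p hp
  -- First the parameter is moved at fixed time, where the Lipschitz bound is uniform in time; then
  -- time is moved along the single trajectory of `s`.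
  exact (norm_sub_le_norm_sub_add_norm_sub _ (Z p.1 s) _).trans
    (add_le_add (hlip p.2 hp.2 s hs p.1 hp.1) le_rfl)

theorem IsTraj.map {X Y : Type*} [NormedAddCommGroup X] [NormedSpace ℝ X] [CompleteSpace X]
    [NormedAddCommGroup Y] [NormedSpace ℝ Y] [CompleteSpace Y] {F : Fin N → X → X}
    {G : Fin N → Y → Y} (A : X →L[ℝ] Y) {z₀ : X} {z : ℝ → X} (hF : ∀ k, Continuous (F k))
    (hu : IntegrableOn u (Icc 0 T)) (hA : ∀ k, ∀ t ∈ Icc 0 T, A (F k (z t)) = G k (A (z t)))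
    (hz : IsTraj F T u z₀ z) : IsTraj G T u (A z₀) (fun t => A (z t)) := by
  refine ⟨A.continuous.comp_continuousOn hz.continuousOn, fun t ht => ?_⟩
  rw [hz.eq t ht, map_add, ← A.intervalIntegral_comp_comm (intervalIntegrable_of_Icc
    (integrableOn_affineField hF hu hz.continuousOn) ⟨le_rfl, ht.1.trans ht.2⟩ ht)]
  congr 1
  refine intervalIntegral.integral_congr fun τ hτ => ?_
  rw [uIcc_of_le ht.1] at hτ
  simp only [affineField, map_sum, map_smul, hA _ τ ⟨hτ.1, hτ.2.trans ht.2⟩]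

theorem integrableOn_reverse {X : Type*} [NormedAddCommGroup X] {f : ℝ → X}
    (hf : IntegrableOn f (Icc 0 T)) : IntegrableOn (fun t => f (T - t)) (Icc 0 T) := by
  have := (Measure.measurePreserving_sub_left volume T).integrableOn_comp_preimage
    (measurableEmbedding_subLeft T) (f := f) (s := Icc 0 T)
  simpa [Function.comp_def] using this.2 hf

theorem mapsTo_reverse : MapsTo (fun t => T - t) (Icc 0 T) (Icc 0 T) := fun t ht =>
  ⟨by linarith [ht.2], by linarith [ht.1]⟩

/-- Turns a terminal-value problem into an initial-value problem, so that the forward theory covers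
the adjoint equation. -/
theorem IsTraj.reverse {X : Type*} [NormedAddCommGroup X] [NormedSpace ℝ X]
    {F : Fin N → X → X} {z₀ : X} {z : ℝ → X} (hF : ∀ k, Continuous (F k))
    (hu : IntegrableOn u (Icc 0 T)) (hz : IsTraj F T u z₀ z) :
    IsTraj F T (fun t => - u (T - t)) (z T) (fun t => z (T - t)) := by
  refine ⟨hz.continuousOn.comp (by fun_prop) mapsTo_reverse, fun t ht => ?_⟩
  have hT : 0 ≤ T := ht.1.trans ht.2
  have h0 : (0 : ℝ) ∈ Icc 0 T := ⟨le_rfl, hT⟩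
  have hTT : T ∈ Icc 0 T := ⟨hT, le_rfl⟩
  have hi := integrableOn_affineField hF hu hz.continuousOn
  have e1 : ∀ τ, affineField F (-u (T - τ)) (z (T - τ))
      = -(fun σ => affineField F (u σ) (z σ)) (T - τ) := fun τ => by
    simp [affineField]
  simp_rw [e1]
  rw [intervalIntegral.integral_neg, intervalIntegral.integral_comp_sub_left
    (fun σ => affineField F (u σ) (z σ)), sub_zero, hz.eq _ (mapsTo_reverse ht), hz.eq T hTT,
    ← intervalIntegral.integral_add_adjacent_intervals
      (intervalIntegrable_of_Icc hi h0 (mapsTo_reverse ht))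
      (intervalIntegrable_of_Icc hi (mapsTo_reverse ht) hTT)]
  abel

end SmoothFields

/-! ### The costate equation and first-order expansion in the control -/

section AdjointEquation

variable {N : ℕ} {E : Type*} [NormedAddCommGroup E] [NormedSpace ℝ E]

/-- `r` is a continuous solution on `[0,T]` of the adjoint equation
`-r' = ∑ₖ uₖ DFₖ(z)ᵀ r`, `r(T) = ρ`, in integrated form. -/
structure IsCostate (F : Fin N → E → E) (T : ℝ) (u : ℝ → EuclideanSpace ℝ (Fin N)) (z : ℝ → E)
    (ρ : E →L[ℝ] ℝ) (r : ℝ → E →L[ℝ] ℝ) : Prop where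
  continuousOn : ContinuousOn r (Icc 0 T)
  eq : ∀ t ∈ Icc 0 T, r t = ρ + ∫ τ in t..T, ∑ k, u τ k • (r τ ∘L fderiv ℝ (F k) (z τ))

/-- The Hamiltonian lift of the fields `Fₖ` to states and costates. -/
def hamField (F : Fin N → E → E) (k : Fin N) (w : E × (E →L[ℝ] ℝ)) : E × (E →L[ℝ] ℝ) :=
  (F k w.1, -(w.2 ∘L fderiv ℝ (F k) w.1))

variable {F : Fin N → E → E} {T : ℝ} {u v : ℝ → EuclideanSpace ℝ (Fin N)} {z₀ y₀ : E} {z y : ℝ → E}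
  {ρ : E →L[ℝ] ℝ} {r r' : ℝ → E →L[ℝ] ℝ}

theorem contDiff_hamField (hF : ∀ k, ContDiff ℝ 2 (F k)) (k : Fin N) :
    ContDiff ℝ 1 (hamField F k) := by
  have h1 : ContDiff ℝ 1 (fderiv ℝ (F k)) := (hF k).fderiv_right (by norm_num)
  have h2 : ContDiff ℝ 1 (F k) := (hF k).of_le (by norm_num)
  unfold hamField
  fun_prop

theorem integrableOn_costate (hF : ∀ k, ContDiff ℝ 2 (F k)) (hu : IntegrableOn u (Icc 0 T))
    (hz : ContinuousOn z (Icc 0 T)) (hr : ContinuousOn r (Icc 0 T)) :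
    IntegrableOn (fun τ => ∑ k, u τ k • (r τ ∘L fderiv ℝ (F k) (z τ))) (Icc 0 T) :=
  integrableOn_sum_smul hu fun k =>
    hr.clm_comp (((hF k).continuous_fderiv (by norm_num)).comp_continuousOn hz)

variable [FiniteDimensional ℝ E]

/-- The costate equation has the control in its coefficients and depends on time also through `z`.
Adjoining the reversed state makes it control-affine and autonomous in the fields, so that
`IsTraj.unique` applies. -/
theorem IsCostate.isTraj (hF : ∀ k, ContDiff ℝ 2 (F k)) (hu : IntegrableOn u (Icc 0 T))
    (hz : IsTraj F T u z₀ z) (hr : IsCostate F T u z ρ r) :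
    IsTraj (hamField F) T (fun t => - u (T - t)) (z T, ρ) (fun t => (z (T - t), r (T - t))) := by
  have := FiniteDimensional.complete ℝ E
  have hzr := hz.reverse (fun k => (hF k).continuous) hu
  have hc : ContinuousOn (fun t => (z (T - t), r (T - t))) (Icc 0 T) :=
    hzr.continuousOn.prodMk (hr.continuousOn.comp (by fun_prop) mapsTo_reverse)
  refine ⟨hc, fun t ht => ?_⟩
  have h0 : (0 : ℝ) ∈ Icc 0 T := ⟨le_rfl, ht.1.trans ht.2⟩
  have hi := intervalIntegrable_of_Icc (integrableOn_affineField
    (fun k => (contDiff_hamField hF k).continuous) (integrableOn_reverse hu).neg hc) h0 ht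
  refine Prod.ext ?_ ?_
  · have h1 := (ContinuousLinearMap.fst ℝ E (E →L[ℝ] ℝ)).intervalIntegral_comp_comm hi
    simp only [ContinuousLinearMap.coe_fst', Pi.neg_apply] at h1
    rw [Prod.fst_add, ← h1, hzr.eq t ht]
    simp [affineField, hamField, Prod.fst_sum]
  · have h1 := (ContinuousLinearMap.snd ℝ E (E →L[ℝ] ℝ)).intervalIntegral_comp_comm hi
    simp only [ContinuousLinearMap.coe_snd', Pi.neg_apply] at h1
    rw [Prod.snd_add, ← h1, hr.eq (T - t) (mapsTo_reverse ht)]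
    have h2 := intervalIntegral.integral_comp_sub_left (a := 0) (b := t)
      (fun τ => ∑ k, u τ k • (r τ ∘L fderiv ℝ (F k) (z τ))) T
    rw [sub_zero] at h2
    rw [← h2]
    simp [affineField, hamField, Prod.snd_sum]

theorem IsCostate.unique (hF : ∀ k, ContDiff ℝ 2 (F k)) (hu : IntegrableOn u (Icc 0 T))
    (hz : IsTraj F T u z₀ z) (hr : IsCostate F T u z ρ r) (hr' : IsCostate F T u z ρ r') :
    ∀ t ∈ Icc 0 T, r t = r' t := by
  intro t ht
  have := (hr.isTraj hF hu hz).unique (fun k => contDiff_hamField hF k)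
    (integrableOn_reverse hu).neg (hr'.isTraj hF hu hz) (T - t) (mapsTo_reverse ht)
  simpa using congrArg Prod.snd this

theorem IsTraj.isCostate (hF : ∀ k, ContDiff ℝ 2 (F k)) (hu : IntegrableOn u (Icc 0 T)) {ζ : E}
    {w : ℝ → E × (E →L[ℝ] ℝ)} (hw : IsTraj (hamField F) T (fun t => - u (T - t)) (ζ, ρ) w)
    (hwz : ∀ t ∈ Icc 0 T, (w t).1 = z (T - t)) :
    IsCostate F T u z ρ (fun t => (w (T - t)).2) := by
  have := FiniteDimensional.complete ℝ E
  refine ⟨(continuous_snd.comp_continuousOn hw.continuousOn).comp (by fun_prop) mapsTo_reverse,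
    fun t ht => ?_⟩
  have h0 : (0 : ℝ) ∈ Icc 0 T := ⟨le_rfl, ht.1.trans ht.2⟩
  have ht' := mapsTo_reverse ht
  have hi := intervalIntegrable_of_Icc (integrableOn_affineField
    (fun k => (contDiff_hamField hF k).continuous) (integrableOn_reverse hu).neg
    hw.continuousOn) h0 ht'
  have h1 := (ContinuousLinearMap.snd ℝ E (E →L[ℝ] ℝ)).intervalIntegral_comp_comm hi
  simp only [ContinuousLinearMap.coe_snd', Pi.neg_apply] at h1
  have h2 := intervalIntegral.integral_comp_sub_left (a := 0) (b := T - t)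
    (fun τ => ∑ k, u τ k • ((w (T - τ)).2 ∘L fderiv ℝ (F k) (z τ))) T
  rw [sub_zero, sub_sub_cancel] at h2
  simp only [hw.eq (T - t) ht']
  rw [Prod.snd_add, ← h1, ← h2]
  congr 1
  refine intervalIntegral.integral_congr fun τ hτ => ?_
  rw [uIcc_of_le ht'.1] at hτ
  simp [affineField, hamField, Prod.snd_sum, hwz τ ⟨hτ.1, hτ.2.trans ht'.2⟩]

/-- `hamField` is linear in the costate, but its coefficients may be unbounded in the state. A
cut-off in the state variable alone therefore gives linear growth, and with it existence and joint
continuity. -/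
theorem exists_isCostate (hT : 0 ≤ T) (hF : ∀ k, ContDiff ℝ 2 (F k)) (hu : IntegrableOn u (Icc 0 T))
    {ζ : ℝ → E} {Z : ℝ → ℝ → E}
    (hZ : ∀ s ∈ Icc (0 : ℝ) 1, IsTraj F T u (ζ s) (fun t => Z t s))
    (hZc : ContinuousOn (fun p : ℝ × ℝ => Z p.1 p.2) (Icc 0 T ×ˢ Icc 0 1))
    {ρ : ℝ → E →L[ℝ] ℝ} (hρ : ContinuousOn ρ (Icc 0 1)) :
    ∃ r : ℝ → ℝ → E →L[ℝ] ℝ,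
      ContinuousOn (fun p : ℝ × ℝ => r p.1 p.2) (Icc 0 T ×ˢ Icc 0 1) ∧
      ∀ s ∈ Icc (0 : ℝ) 1, IsCostate F T u (fun t => Z t s) (ρ s) (fun t => r t s) := by
  have := FiniteDimensional.complete ℝ E
  obtain ⟨R, hR⟩ := (isCompact_Icc.prod isCompact_Icc).exists_bound_of_continuousOn hZc
  have hZR : ∀ s ∈ Icc (0 : ℝ) 1, ∀ t ∈ Icc 0 T, ‖Z t s‖ ≤ R := fun s hs t ht => hR (t, s) ⟨ht, hs⟩
  obtain ⟨χ, hχ, hχc, hχ1, hχ01⟩ := exists_cutoff (E := E) R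
  have hχ' : ContDiff ℝ 1 χ := hχ.of_le (mod_cast le_top)
  have hF1 : ∀ k, ContDiff ℝ 1 (F k) := fun k => (hF k).of_le (by norm_num)
  have hD : ∀ k, ContDiff ℝ 1 (fderiv ℝ (F k)) := fun k => (hF k).fderiv_right (by norm_num)
  obtain ⟨L₁, B₁, hB₁, hL₁, hb₁⟩ := exists_lipschitz_bound_of_compactSupport
    (F := fun k x => χ x • F k x) (fun k => hχ'.smul (hF1 k)) fun k => hχc.smul_right
  obtain ⟨-, B₂, hB₂, -, hb₂⟩ := exists_lipschitz_bound_of_compactSupport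
    (F := fun k x => χ x • fderiv ℝ (F k) x) (fun k => hχ'.smul (hD k)) fun k => hχc.smul_right
  set G : Fin N → E × (E →L[ℝ] ℝ) → E × (E →L[ℝ] ℝ) := fun k w => χ w.1 • hamField F k w with hG
  have hGc : ∀ k, ContDiff ℝ 1 (G k) := fun k =>
    (hχ'.comp contDiff_fst).smul (contDiff_hamField hF k)
  have hGg : ∀ k w, ‖G k w‖ ≤ (B₁ + B₂) * (1 + ‖w‖) := by
    intro k w
    have hw2 : ‖w.2‖ ≤ ‖w‖ := norm_snd_le w
    have hw0 := norm_nonneg w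
    refine norm_prod_le_iff.2 ⟨?_, ?_⟩
    · refine (hb₁ k w.1).trans ?_
      nlinarith [mul_nonneg hB₁ hw0, mul_nonneg hB₂ hw0]
    · have e : (G k w).2 = -(w.2 ∘L (χ w.1 • fderiv ℝ (F k) w.1)) := by
        simp [hG, hamField]
      rw [e, norm_neg]
      refine (ContinuousLinearMap.opNorm_comp_le _ _).trans ?_
      have := mul_le_mul hw2 (hb₂ k w.1) (norm_nonneg _) hw0
      nlinarith [mul_nonneg hB₁ hw0, mul_nonneg hB₂ hw0]
  have hu' : IntegrableOn (fun t => - u (T - t)) (Icc 0 T) := (integrableOn_reverse hu).neg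
  have hTT : T ∈ Icc 0 T := ⟨hT, le_rfl⟩
  choose W hW using fun s => exists_isTraj_of_growth hT hGc (add_nonneg hB₁ hB₂) hGg hu'
    (Z T s, ρ s)
  have hini : ContinuousOn (fun s => (Z T s, ρ s)) (Icc 0 1) :=
    (hZc.comp (f := fun s : ℝ => (T, s)) (by fun_prop) fun s hs => ⟨hTT, hs⟩).prodMk hρ
  have hWc := continuousOn_prod_of_isTraj hGc (add_nonneg hB₁ hB₂) hGg hu' hini
    (Z := fun t s => W s t) fun s _ => hW s
  -- The state component of the truncated system and the reversed trajectory solve the same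
  -- truncated equation, so they coincide. Hence the cut-off equals `1` along the solution.
  have hWZ : ∀ s ∈ Icc (0 : ℝ) 1, ∀ t ∈ Icc 0 T, (W s t).1 = Z (T - t) s := by
    intro s hs
    have h1 := (hW s).map (ContinuousLinearMap.fst ℝ E (E →L[ℝ] ℝ)) (G := fun k x => χ x • F k x)
      (fun k => (hGc k).continuous) hu' fun k t _ => by simp [hG, hamField]
    have h2 := ((hZ s hs).congr_field (F' := fun k x => χ x • F k x) fun k t ht => by
      simp [hχ1 _ (hZR s hs t ht)]).reverse (fun k => (hL₁ k).continuous) hu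
    exact h1.unique (fun k => hχ'.smul (hF1 k)) hu' h2
  refine ⟨fun t s => (W s (T - t)).2, ?_, fun s hs => ?_⟩
  · exact (continuous_snd.comp_continuousOn hWc).comp (f := fun p : ℝ × ℝ => (T - p.1, p.2))
      (by fun_prop) fun p hp => ⟨mapsTo_reverse hp.1, hp.2⟩
  · refine IsTraj.isCostate hF hu ((hW s).congr_field fun k t ht => ?_) (hWZ s hs)
    simp [hG, hWZ s hs t ht, hχ1 _ (hZR s hs _ (mapsTo_reverse ht))]

/-- First-order expansion of a terminal cost with respect to the control, with a remainder that is
quadratic in the `L¹`-distance of the controls and uniform in the initial value. -/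
theorem exists_expansion (hT : 0 ≤ T) (hF : ∀ k, ContDiff ℝ 2 (F k)) {g : E → ℝ}
    (hg : ContDiff ℝ 2 g) (hu : IntegrableOn u (Icc 0 T)) (R : ℝ) {P : ℝ} (hP : 0 ≤ P) :
    ∃ C : ℝ, 0 ≤ C ∧ ∀ (v : ℝ → EuclideanSpace ℝ (Fin N)) (z₀ : E) (z y : ℝ → E)
      (r : ℝ → E →L[ℝ] ℝ), IntegrableOn v (Icc 0 T) → IsTraj F T u z₀ z → IsTraj F T v z₀ y →
      IsCostate F T u z (fderiv ℝ g (z T)) r → (∀ t ∈ Icc 0 T, ‖z t‖ ≤ R) →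
      (∀ t ∈ Icc 0 T, ‖y t‖ ≤ R) → (∀ t ∈ Icc 0 T, ‖r t‖ ≤ P) →
      |g (y T) - g (z T) - ∫ τ in (0 : ℝ)..T, r τ (affineField F (v τ - u τ) (z τ))|
        ≤ C * (∫ τ in (0 : ℝ)..T, ‖v τ - u τ‖) ^ 2 := by
  have := FiniteDimensional.complete ℝ E
  have hF1 : ∀ k, ContDiff ℝ 1 (F k) := fun k => (hF k).of_le (by norm_num)
  have hFc : ∀ k, Continuous (F k) := fun k => (hF k).continuous
  obtain ⟨L, B, hB0, hL, hB⟩ := exists_lipschitz_bound_closedBall hF1 R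
  choose Q₀ hQ0 hQ using fun k => exists_taylor_bound_closedBall (hF k) R
  obtain ⟨q, hq0, hq⟩ := exists_taylor_bound_closedBall hg R
  set Q := ∑ k, Q₀ k with hQd
  have hQs : ∀ k, Q₀ k ≤ Q := fun k =>
    Finset.single_le_sum (f := Q₀) (fun k _ => hQ0 k) (Finset.mem_univ k)
  have hQn : 0 ≤ Q := Finset.sum_nonneg fun k _ => hQ0 k
  set I₀ := ∫ τ in (0 : ℝ)..T, ‖u τ‖ with hI₀
  have hI₀n : 0 ≤ I₀ := intervalIntegral.integral_nonneg hT fun _ _ => norm_nonneg _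
  set c := N * B * Real.exp (2 * ∫ τ in (0 : ℝ)..T, N * L * ‖u τ‖) with hc
  have hcn : 0 ≤ c := by positivity
  -- The three terms bound the Taylor remainder of `g`, the product of control and state
  -- differences, and the Taylor remainders of the fields. The trajectories differ by at most `c`
  -- times the `L¹` distance of the controls.
  refine ⟨q * c ^ 2 + P * (N * L * c) + P * (N * Q * c ^ 2) * I₀, by positivity, ?_⟩
  intro v z₀ z y r hv hz hy hr hzR hyR hrP
  set I := ∫ τ in (0 : ℝ)..T, ‖v τ - u τ‖ with hI
  have hIn : 0 ≤ I := intervalIntegral.integral_nonneg hT fun _ _ => norm_nonneg _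
  have hzS : ∀ t ∈ Icc 0 T, z t ∈ Metric.closedBall (0 : E) R := fun t ht => by
    simpa using hzR t ht
  have hyS : ∀ t ∈ Icc 0 T, y t ∈ Metric.closedBall (0 : E) R := fun t ht => by
    simpa using hyR t ht
  have h0 : (0 : ℝ) ∈ Icc 0 T := ⟨le_rfl, hT⟩
  have hTT : T ∈ Icc 0 T := ⟨hT, le_rfl⟩
  have hw : ∀ t ∈ Icc 0 T, ‖y t - z t‖ ≤ c * I := by
    intro t ht
    have := IsTraj.norm_sub_le hB0 hL hB hFc hu hv hz hy hzS hyS t ht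
    rw [sub_self, norm_zero, zero_add] at this
    rw [norm_sub_rev]
    refine this.trans (le_of_eq ?_)
    simp_rw [hc, hI, norm_sub_rev (v _)]
    ring
  have iz := integrableOn_affineField hFc hu hz.continuousOn
  have iy := integrableOn_affineField hFc hv hy.continuousOn
  have iW : IntegrableOn (fun τ => affineField F (v τ) (y τ) - affineField F (u τ) (z τ))
    (Icc 0 T) := iy.sub iz
  have iR := integrableOn_costate hF hu hz.continuousOn hr.continuousOn
  have hwint : ∀ t ∈ Icc 0 T, ∫ τ in (0 : ℝ)..t,
      (affineField F (v τ) (y τ) - affineField F (u τ) (z τ)) = y t - z t := by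
    intro t ht
    rw [intervalIntegral.integral_sub (intervalIntegrable_of_Icc iy h0 ht)
      (intervalIntegrable_of_Icc iz h0 ht), hy.eq t ht, hz.eq t ht]
    abel
  set ρ := fderiv ℝ g (z T)
  -- Duality: the derivative of the costate is paired with the state difference, itself a primitive.
  -- After `e1` and `e2` the linear response of the state appears through `ρ (y T - z T)` alone.
  have hparts := integral_bilin_primitive (ContinuousLinearMap.id ℝ (E →L[ℝ] ℝ)) hT iR iW
  simp only [ContinuousLinearMap.coe_id', id_eq] at hparts
  have e1 : ∫ τ in (0 : ℝ)..T, (∑ k, u τ k • (r τ ∘L fderiv ℝ (F k) (z τ)))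
      (∫ σ in (0 : ℝ)..τ, (affineField F (v σ) (y σ) - affineField F (u σ) (z σ)))
      = ∫ τ in (0 : ℝ)..T, (∑ k, u τ k • (r τ ∘L fderiv ℝ (F k) (z τ))) (y τ - z τ) := by
    refine intervalIntegral.integral_congr fun τ hτ => ?_
    rw [uIcc_of_le hT] at hτ
    simp only [hwint τ hτ]
  have irW : IntegrableOn (fun σ => r σ (affineField F (v σ) (y σ) - affineField F (u σ) (z σ)))
      (Icc 0 T) := by
    have := (integrableOn_sum_smul hv (G := fun k σ => r σ (F k (y σ)))
      fun k => hr.continuousOn.clm_apply ((hFc k).comp_continuousOn hy.continuousOn)).sub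
      (integrableOn_sum_smul hu (G := fun k σ => r σ (F k (z σ)))
      fun k => hr.continuousOn.clm_apply ((hFc k).comp_continuousOn hz.continuousOn))
    refine this.congr (ae_of_all _ fun σ => ?_)
    simp [affineField, map_sub, map_sum]
  have e2 : ∫ σ in (0 : ℝ)..T, (∫ τ in σ..T, ∑ k, u τ k • (r τ ∘L fderiv ℝ (F k) (z τ)))
      (affineField F (v σ) (y σ) - affineField F (u σ) (z σ))
      = (∫ σ in (0 : ℝ)..T, r σ (affineField F (v σ) (y σ) - affineField F (u σ) (z σ)))
        - ρ (y T - z T) := by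
    rw [← hwint T hTT, ← ρ.intervalIntegral_comp_comm (intervalIntegrable_of_Icc iW h0 hTT),
      ← intervalIntegral.integral_sub (intervalIntegrable_of_Icc irW h0 hTT)
        (intervalIntegrable_of_Icc (ρ.integrable_comp iW) h0 hTT)]
    refine intervalIntegral.integral_congr fun σ hσ => ?_
    rw [uIcc_of_le hT] at hσ
    have : ∫ τ in σ..T, ∑ k, u τ k • (r τ ∘L fderiv ℝ (F k) (z τ)) = r σ - ρ := by
      rw [hr.eq σ hσ]; abel
    simp only [this, _root_.sub_apply]
  rw [e1, e2] at hparts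
  have iRw : IntegrableOn (fun τ => (∑ k, u τ k • (r τ ∘L fderiv ℝ (F k) (z τ))) (y τ - z τ))
      (Icc 0 T) := by
    have := integrableOn_sum_smul hu (G := fun k τ => (r τ ∘L fderiv ℝ (F k) (z τ)) (y τ - z τ))
      fun k => (hr.continuousOn.clm_comp (((hF k).continuous_fderiv
        (by norm_num)).comp_continuousOn hz.continuousOn)).clm_apply
        (hy.continuousOn.sub hz.continuousOn)
    refine this.congr (ae_of_all _ fun σ => ?_)
    simp
  have irV : IntegrableOn (fun σ => r σ (affineField F (v σ - u σ) (z σ))) (Icc 0 T) := by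
    have := integrableOn_sum_smul (hv.sub hu) (G := fun k σ => r σ (F k (z σ)))
      fun k => hr.continuousOn.clm_apply ((hFc k).comp_continuousOn hz.continuousOn)
    refine this.congr (ae_of_all _ fun σ => ?_)
    simp [affineField, map_sum]
  have e3 : ρ (y T - z T) - ∫ τ in (0 : ℝ)..T, r τ (affineField F (v τ - u τ) (z τ))
      = ∫ τ in (0 : ℝ)..T, (r τ (affineField F (v τ) (y τ) - affineField F (u τ) (z τ))
        - (∑ k, u τ k • (r τ ∘L fderiv ℝ (F k) (z τ))) (y τ - z τ)
        - r τ (affineField F (v τ - u τ) (z τ))) := by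
    rw [intervalIntegral.integral_sub ((intervalIntegrable_of_Icc irW h0 hTT).sub
        (intervalIntegrable_of_Icc iRw h0 hTT)) (intervalIntegrable_of_Icc irV h0 hTT),
      intervalIntegral.integral_sub (intervalIntegrable_of_Icc irW h0 hTT)
        (intervalIntegrable_of_Icc iRw h0 hTT)]
    linarith
  have ib1 : IntervalIntegrable (fun τ => P * (N * L * (c * I)) * ‖v τ - u τ‖) volume 0 T :=
    (intervalIntegrable_of_Icc (hv.sub hu).norm h0 hTT).const_mul _
  have ib2 := (intervalIntegrable_of_Icc hu.norm h0 hTT).const_mul (P * (N * Q * (c * I) ^ 2))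
  have hbound : ‖ρ (y T - z T) - ∫ τ in (0 : ℝ)..T, r τ (affineField F (v τ - u τ) (z τ))‖
      ≤ ∫ τ in (0 : ℝ)..T, (P * (N * L * (c * I)) * ‖v τ - u τ‖
        + P * (N * Q * (c * I) ^ 2) * ‖u τ‖) := by
    rw [e3]
    refine intervalIntegral.norm_integral_le_of_norm_le hT (ae_of_all _ fun τ hτ => ?_)
      (ib1.add ib2)
    have hτ' : τ ∈ Icc 0 T := ⟨hτ.1.le, hτ.2⟩
    -- What is left after cancelling the first-order terms: a product of two differences, and the
    -- Taylor remainders of the fields weighted by `u`.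
    have e4 : r τ (affineField F (v τ) (y τ) - affineField F (u τ) (z τ))
        - (∑ k, u τ k • (r τ ∘L fderiv ℝ (F k) (z τ))) (y τ - z τ)
        - r τ (affineField F (v τ - u τ) (z τ))
        = r τ (∑ k, (v τ - u τ) k • (F k (y τ) - F k (z τ)))
          + r τ (∑ k, u τ k • (F k (y τ) - F k (z τ) - fderiv ℝ (F k) (z τ) (y τ - z τ))) := by
      simp only [affineField, map_sum, map_sub, map_smul, _root_.sum_apply,
        _root_.smul_apply, ContinuousLinearMap.comp_apply, PiLp.sub_apply,
        ← Finset.sum_sub_distrib, ← Finset.sum_add_distrib, smul_eq_mul]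
      exact Finset.sum_congr rfl fun k _ => by ring
    rw [e4]
    have hwτ := hw τ hτ'
    refine (norm_add_le _ _).trans (add_le_add ?_ ?_)
    · refine ((r τ).le_opNorm _).trans ?_
      rw [mul_assoc]
      refine mul_le_mul (hrP τ hτ') ?_ (norm_nonneg _) hP
      refine (norm_sum_smul_le (v τ - u τ) fun k =>
        ((hL k).norm_sub_le (hyS τ hτ') (hzS τ hτ')).trans
          (mul_le_mul_of_nonneg_left hwτ L.2)).trans (le_of_eq (by ring))
    · refine ((r τ).le_opNorm _).trans ?_
      rw [mul_assoc]
      refine mul_le_mul (hrP τ hτ') ?_ (norm_nonneg _) hP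
      refine (norm_sum_smul_le (u τ) (B := Q * (c * I) ^ 2) fun k =>
        (hQ k _ (hzS τ hτ') _ (hyS τ hτ')).trans ?_).trans (le_of_eq (by ring))
      gcongr
      exact hQs k
  rw [intervalIntegral.integral_add ib1 ib2, intervalIntegral.integral_const_mul,
    intervalIntegral.integral_const_mul] at hbound
  have hg' : ‖g (y T) - g (z T) - ρ (y T - z T)‖ ≤ q * (c * I) ^ 2 := by
    refine (hq _ (hzS T hTT) _ (hyS T hTT)).trans ?_
    gcongr
    exact hw T hTT
  rw [← Real.norm_eq_abs]
  have e5 : g (y T) - g (z T) - ∫ τ in (0 : ℝ)..T, r τ (affineField F (v τ - u τ) (z τ))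
      = (g (y T) - g (z T) - ρ (y T - z T))
        + (ρ (y T - z T) - ∫ τ in (0 : ℝ)..T, r τ (affineField F (v τ - u τ) (z τ))) := by ring
  rw [e5]
  refine (norm_add_le _ _).trans ((add_le_add hg' hbound).trans (le_of_eq ?_))
  rw [← hI, ← hI₀]
  ring

end AdjointEquation

/-! ### Boundary values of functions in `H¹₀` -/

section BoundaryValues

theorem gradient_eq_zero_of_notMem_tsupport {φ : Plane → ℝ} {x : Plane} (hx : x ∉ tsupport φ) :
    gradient φ x = 0 := by
  have : fderiv ℝ φ x = 0 := by
    have h := (notMem_tsupport_iff_eventuallyEq.1 hx).fderiv_eq (𝕜 := ℝ)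
    rw [h]
    exact fderiv_const_apply (𝕜 := ℝ) (0 : ℝ)
  simp [gradient, this]

/-- `-φ x` is the integral of the directional derivative over the segment from `x` to `x + w`.
Integrating `-2 * φ x * f ≤ φ x ^ 2 + f ^ 2` yields the needed case of Cauchy–Schwarz. -/
theorem enorm_sq_le_of_add_eq_zero {φ : Plane → ℝ} (hφ : ContDiff ℝ 1 φ) {x w : Plane}
    (hx : φ (x + w) = 0) :
    ‖φ x‖ₑ ^ 2 ≤ ‖w‖ₑ ^ 2 * ∫⁻ s in Ioc (0 : ℝ) 1, ‖gradient φ (x + s • w)‖ₑ ^ 2 := by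
  have hdc : Continuous (fderiv ℝ φ) := hφ.continuous_fderiv one_ne_zero
  set f : ℝ → ℝ := fun s => fderiv ℝ φ (x + s • w) w with hf
  have hfc : Continuous f := by fun_prop
  have hgc : Continuous fun s : ℝ => ‖fderiv ℝ φ (x + s • w)‖ ^ 2 := by fun_prop
  have hd : ∀ s ∈ uIcc (0 : ℝ) 1, HasDerivAt (fun s : ℝ => φ (x + s • w)) (f s) s := by
    intro s _
    have h1 : HasDerivAt (fun s : ℝ => x + s • w) w s := by
      simpa using ((hasDerivAt_id s).smul_const w).const_add x
    exact ((hφ.differentiable one_ne_zero) _).hasFDerivAt.comp_hasDerivAt s h1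
  have hint := intervalIntegral.integral_eq_sub_of_hasDerivAt hd (hfc.intervalIntegrable 0 1)
  simp only [one_smul, zero_smul, add_zero, hx, zero_sub] at hint
  have hsq : φ x ^ 2 ≤ ∫ s in (0 : ℝ)..1, f s ^ 2 := by
    have h1 : ∫ s in (0 : ℝ)..1, (-φ x) * (2 * f s) ≤ ∫ s in (0 : ℝ)..1, (φ x ^ 2 + f s ^ 2) :=
      intervalIntegral.integral_mono zero_le_one
        (Continuous.intervalIntegrable (by fun_prop) 0 1)
        (Continuous.intervalIntegrable (by fun_prop) 0 1)
        fun s => by nlinarith [sq_nonneg (φ x + f s)]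
    rw [intervalIntegral.integral_const_mul, intervalIntegral.integral_const_mul, hint,
      intervalIntegral.integral_add (by simp)
        (Continuous.intervalIntegrable (by fun_prop) 0 1)] at h1
    simp only [intervalIntegral.integral_const, sub_zero, one_smul] at h1
    nlinarith
  have hle : φ x ^ 2 ≤ ‖w‖ ^ 2 * ∫ s in (0 : ℝ)..1, ‖fderiv ℝ φ (x + s • w)‖ ^ 2 := by
    rw [← intervalIntegral.integral_const_mul]
    refine hsq.trans (intervalIntegral.integral_mono zero_le_one
      (Continuous.intervalIntegrable (by fun_prop) 0 1)
      ((hgc.const_mul _).intervalIntegrable 0 1) fun s => ?_)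
    have h2 := (fderiv ℝ φ (x + s • w)).le_opNorm w
    rw [← mul_pow, ← sq_abs (f s), mul_comm]
    exact pow_le_pow_left₀ (abs_nonneg _) h2 2
  have hnorm : ∀ y, ‖gradient φ y‖ₑ ^ 2 = ENNReal.ofReal (‖fderiv ℝ φ y‖ ^ 2) := by
    intro y
    rw [ENNReal.ofReal_pow (norm_nonneg _), ofReal_norm]
    simp [gradient, enorm_eq_nnnorm]
  have hmain := ENNReal.ofReal_le_ofReal hle
  rw [ENNReal.ofReal_mul (by positivity), intervalIntegral.integral_of_le zero_le_one,
    ofReal_integral_eq_lintegral_ofReal (hgc.integrableOn_Ioc) (ae_of_all _ fun _ => by positivity),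
    ← sq_abs, ENNReal.ofReal_pow (abs_nonneg _), ENNReal.ofReal_pow (norm_nonneg _),
    ofReal_norm, ← Real.norm_eq_abs, ofReal_norm] at hmain
  simpa only [hnorm] using hmain

/-- The pointwise bound is integrated over `S`; after exchanging the integrals, translation
invariance removes the shift `s • w`, and the gradient of `φ` vanishes off `Ω`. -/
theorem lintegral_sq_le_of_translate {Ω S : Set Plane} (hΩ : MeasurableSet Ω)
    {φ : Plane → ℝ} (hφ : ContDiff ℝ 1 φ) (hsupp : tsupport φ ⊆ Ω) {w : Plane}
    (hS : ∀ x ∈ S, x + w ∉ Ω) (hSm : MeasurableSet S) :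
    ∫⁻ x in S, ‖φ x‖ₑ ^ 2 ≤ ‖w‖ₑ ^ 2 * ∫⁻ x in Ω, ‖gradient φ x‖ₑ ^ 2 := by
  have hgc : Continuous (gradient φ) :=
    (InnerProductSpace.toDual ℝ Plane).symm.continuous.comp (hφ.continuous_fderiv one_ne_zero)
  have hg : Measurable fun x : Plane => ‖gradient φ x‖ₑ ^ 2 := by fun_prop
  calc ∫⁻ x in S, ‖φ x‖ₑ ^ 2
      ≤ ∫⁻ x in S, ‖w‖ₑ ^ 2 * ∫⁻ s in Ioc (0 : ℝ) 1, ‖gradient φ (x + s • w)‖ₑ ^ 2 := by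
        refine setLIntegral_mono' hSm fun x hx => enorm_sq_le_of_add_eq_zero hφ ?_
        by_contra h
        exact hS x hx (hsupp (subset_tsupport φ h))
    _ ≤ ∫⁻ x, ‖w‖ₑ ^ 2 * ∫⁻ s in Ioc (0 : ℝ) 1, ‖gradient φ (x + s • w)‖ₑ ^ 2 :=
        setLIntegral_le_lintegral _ _
    _ = ‖w‖ₑ ^ 2 * ∫⁻ x, ∫⁻ s in Ioc (0 : ℝ) 1, ‖gradient φ (x + s • w)‖ₑ ^ 2 :=
        lintegral_const_mul' _ _ (by simp)
    _ = ‖w‖ₑ ^ 2 * ∫⁻ s in Ioc (0 : ℝ) 1, ∫⁻ x, ‖gradient φ (x + s • w)‖ₑ ^ 2 := by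
        rw [lintegral_lintegral_swap]
        refine Measurable.aemeasurable ?_
        have : Continuous fun p : Plane × ℝ => gradient φ (p.1 + p.2 • w) :=
          hgc.comp (by fun_prop)
        exact this.measurable.enorm.pow_const 2
    _ = ‖w‖ₑ ^ 2 * ∫⁻ x, ‖gradient φ x‖ₑ ^ 2 := by
        have : ∀ s : ℝ, ∫⁻ x, ‖gradient φ (x + s • w)‖ₑ ^ 2 = ∫⁻ x, ‖gradient φ x‖ₑ ^ 2 :=
          fun s => lintegral_add_right_eq_self (fun x => ‖gradient φ x‖ₑ ^ 2) (s • w)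
        simp [this]
    _ = _ := by
        congr 1
        rw [← lintegral_indicator hΩ]
        refine lintegral_congr fun x => ?_
        by_cases hx : x ∈ Ω
        · rw [indicator_of_mem hx]
        · rw [indicator_of_notMem hx, gradient_eq_zero_of_notMem_tsupport fun h => hx (hsupp h)]
          simp

theorem eLpNorm_le_of_translate {Ω S : Set Plane} (hΩ : MeasurableSet Ω)
    {φ : Plane → ℝ} (hφ : ContDiff ℝ 1 φ) (hsupp : tsupport φ ⊆ Ω) {w : Plane}
    (hS : ∀ x ∈ S, x + w ∉ Ω) (hSm : MeasurableSet S) :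
    eLpNorm φ 2 (volume.restrict S) ≤ ‖w‖ₑ * eLpNorm (gradient φ) 2 (volume.restrict Ω) := by
  have h := lintegral_sq_le_of_translate hΩ hφ hsupp hS hSm
  have e : ∀ {Y : Type} [NormedAddCommGroup Y] (f : Plane → Y) (A : Set Plane),
      eLpNorm f 2 (volume.restrict A) ^ 2 = ∫⁻ x in A, ‖f x‖ₑ ^ 2 := by
    intro Y _ f A
    have := eLpNorm_nnreal_pow_eq_lintegral (f := f) (μ := volume.restrict A) (p := 2) two_ne_zero
    simpa using this
  rw [← e, ← e, ← mul_pow] at h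
  exact (ENNReal.pow_le_pow_left_iff two_ne_zero).1 h

/-- A Poincaré-type bound on the part of `Ω` that a translation pushes out, obtained by density from
test functions. The constant depends neither on `S` nor on `w`. -/
theorem MemH10.eLpNorm_le_of_translate {Ω : Set Plane} (hΩ : MeasurableSet Ω) {f : Plane → ℝ}
    (hfc : Continuous f) (hf : MemH10 Ω f) : ∃ K : ℝ≥0∞, K ≠ ⊤ ∧ ∀ (S : Set Plane) (w : Plane),
      MeasurableSet S → S ⊆ Ω → (∀ x ∈ S, x + w ∉ Ω) →
      eLpNorm f 2 (volume.restrict S) ≤ ‖w‖ₑ * K := by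
  obtain ⟨-, G, hG, hφ⟩ := hf
  refine ⟨eLpNorm G 2 (volume.restrict Ω), hG.2.ne, fun S w hSm hSΩ hS => ?_⟩
  refine ENNReal.le_of_forall_pos_le_add fun ε hε _ => ?_
  -- The approximation enters once through `f` and once, multiplied by `‖w‖ₑ`, through the gradient:
  -- a total error of `(1 + ‖w‖ₑ) * δ`.
  have hδ : ((ε : ℝ≥0∞) / (1 + ‖w‖ₑ)) ≠ 0 := by simp [hε.ne']
  set δ := (ε : ℝ≥0∞) / (1 + ‖w‖ₑ) with hδd
  obtain ⟨φ, hφ, -, hsupp, h1, h2⟩ := hφ δ (pos_iff_ne_zero.2 hδ)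
  have hφ1 : ContDiff ℝ 1 φ := hφ.of_le (mod_cast le_top)
  have hgc : Continuous (gradient φ) :=
    (InnerProductSpace.toDual ℝ Plane).symm.continuous.comp (hφ1.continuous_fderiv one_ne_zero)
  have hmono : volume.restrict S ≤ volume.restrict Ω := Measure.restrict_mono hSΩ le_rfl
  have e1 : eLpNorm f 2 (volume.restrict S) ≤ eLpNorm φ 2 (volume.restrict S)
      + eLpNorm (fun x => φ x - f x) 2 (volume.restrict S) := by
    have := eLpNorm_sub_le (f := φ) (g := fun x => φ x - f x) (p := 2) (μ := volume.restrict S)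
      hφ.continuous.aestronglyMeasurable (hφ.continuous.sub hfc).aestronglyMeasurable (by norm_num)
    refine le_trans (le_of_eq ?_) this
    congr 1; ext x; simp
  have e2 : eLpNorm (gradient φ) 2 (volume.restrict Ω) ≤ eLpNorm G 2 (volume.restrict Ω) + δ := by
    have := eLpNorm_add_le (f := G) (g := fun x => gradient φ x - G x) (p := 2)
      (μ := volume.restrict Ω) hG.1 (hgc.aestronglyMeasurable.sub hG.1) (by norm_num)
    refine le_trans (le_of_eq ?_) (this.trans (add_le_add le_rfl h2.le))
    congr 1; ext1 x; simp
  calc eLpNorm f 2 (volume.restrict S)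
      ≤ ‖w‖ₑ * (eLpNorm G 2 (volume.restrict Ω) + δ) + δ := by
        refine e1.trans (add_le_add ?_ ((eLpNorm_mono_measure _ hmono).trans h1.le))
        refine (InterfaceControl.eLpNorm_le_of_translate hΩ hφ1 hsupp hS hSm).trans ?_
        gcongr
    _ = ‖w‖ₑ * eLpNorm G 2 (volume.restrict Ω) + (1 + ‖w‖ₑ) * δ := by ring
    _ ≤ _ := by
        gcongr
        rw [hδd]
        exact ENNReal.mul_div_le

/-- A function in `H¹₀(Ω)` cannot stay away from zero along segments leaving `Ω`. -/
theorem MemH10.false_of_exit {Ω : Set Plane} (hΩ : IsOpen Ω) {f : Plane → ℝ}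
    (hfc : Continuous f) (hf : MemH10 Ω f) {y v : Plane} {r c : ℝ} (hr : 0 < r) (hc : 0 < c)
    (hin : ∀ x ∈ Metric.ball y r, x ∈ Ω) (hout : ∀ x ∈ Metric.ball y r, x + v ∉ Ω)
    (hfc' : ∀ x ∈ Metric.ball y r, ∀ t ∈ Icc (0 : ℝ) 1, c ≤ |f (x + t • v)|) : False := by
  obtain ⟨K, hK, hest⟩ := MemH10.eLpNorm_le_of_translate hΩ.measurableSet hfc hf
  -- Cut `v` into `m` steps `w`. The set `S`, where `f` is large and one step leaves `Ω`, has
  -- measure `O(m⁻²)` by the translation estimate, yet `m` translates of it cover the ball. Letting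
  -- `m → ∞` contradicts the positive measure of the ball.
  have key : ∀ m : ℕ, 0 < m → ENNReal.ofReal c ^ 2 * volume (Metric.ball y r)
      ≤ (‖v‖ₑ * K) ^ 2 / m := by
    intro m hm
    have hm' : (0 : ℝ) < m := by exact_mod_cast hm
    set w : Plane := (1 / (m : ℝ)) • v with hw
    set S : Set Plane := {x | x ∈ Ω ∧ c ≤ |f x| ∧ x + w ∉ Ω} with hS
    have hSm : MeasurableSet S := by
      refine hΩ.measurableSet.inter (MeasurableSet.inter ?_ ?_)
      · exact (isClosed_le continuous_const hfc.abs).measurableSet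
      · exact (hΩ.isClosed_compl.preimage (continuous_add_const w)).measurableSet
    have h1 := hest S w hSm (fun x hx => hx.1) fun x hx => hx.2.2
    have h2 : ENNReal.ofReal c ^ 2 * volume S ≤ (‖w‖ₑ * K) ^ 2 := by
      refine le_trans ?_ (pow_le_pow_left₀ (by simp) h1 2)
      have e := eLpNorm_nnreal_pow_eq_lintegral (f := f) (μ := volume.restrict S) (p := 2)
        two_ne_zero
      have e' : eLpNorm f 2 (volume.restrict S) ^ 2 = ∫⁻ x in S, ‖f x‖ₑ ^ 2 := by simpa using e
      rw [e', ← setLIntegral_const]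
      refine setLIntegral_mono' hSm fun x hx => ?_
      gcongr
      rw [← ofReal_norm]
      exact ENNReal.ofReal_le_ofReal hx.2.1
    have h3 : volume (Metric.ball y r) ≤ m * volume S := by
      have hcov : Metric.ball y r ⊆ ⋃ j ∈ Finset.range m, (fun x => x + (j : ℝ) • w) ⁻¹' S := by
        intro x hx
        have hend : x + (m : ℝ) • w ∉ Ω := by
          rw [hw, smul_smul, mul_one_div_cancel hm'.ne', one_smul]; exact hout x hx
        classical
        -- The predecessor of the first exit index is the one that lands in `S`; it exists since `x`
        -- itself lies in `Ω`.
        have hex : ∃ j : ℕ, x + (j : ℝ) • w ∉ Ω := ⟨m, hend⟩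
        have hj := Nat.find_spec hex
        have hj0 : Nat.find hex ≠ 0 := by
          intro h0
          rw [h0] at hj
          exact hj (by simpa using hin x hx)
        obtain ⟨i, hi⟩ := Nat.exists_eq_succ_of_ne_zero hj0
        have him : i < m := by
          have : Nat.find hex ≤ m := Nat.find_min' hex hend
          omega
        have hiΩ : x + (i : ℝ) • w ∈ Ω := by
          have := Nat.find_min hex (m := i) (by omega)
          simpa using this
        rw [hi] at hj
        refine mem_biUnion (Finset.mem_coe.2 (Finset.mem_range.2 him)) ⟨hiΩ, ?_, ?_⟩
        · have := hfc' x hx (i / m) ⟨by positivity, by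
            rw [div_le_one hm']; exact_mod_cast him.le⟩
          rwa [hw, smul_smul, mul_one_div]
        · have e : x + ((i + 1 : ℕ) : ℝ) • w = x + (i : ℝ) • w + w := by
            push_cast; rw [add_smul, one_smul, add_assoc]
          rw [← e]; exact hj
      refine (measure_mono hcov).trans ((measure_biUnion_finset_le _ _).trans ?_)
      simp
    have h4 : ‖w‖ₑ = ‖v‖ₑ / m := by
      rw [hw, one_div, enorm_smul, enorm_inv hm'.ne', div_eq_mul_inv, mul_comm]
      simp
    have hm0 : (m : ℝ≥0∞) ≠ 0 := by exact_mod_cast hm.ne'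
    calc ENNReal.ofReal c ^ 2 * volume (Metric.ball y r)
        ≤ ENNReal.ofReal c ^ 2 * (m * volume S) := by gcongr
      _ = m * (ENNReal.ofReal c ^ 2 * volume S) := by ring
      _ ≤ m * (‖w‖ₑ * K) ^ 2 := by gcongr
      _ = (m * (m : ℝ≥0∞)⁻¹) * ((‖v‖ₑ * K) ^ 2 * (m : ℝ≥0∞)⁻¹) := by
        rw [h4, div_eq_mul_inv]; ring
      _ = (‖v‖ₑ * K) ^ 2 / m := by
        rw [ENNReal.mul_inv_cancel hm0 (by simp), one_mul, div_eq_mul_inv]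
  have hlim : Tendsto (fun m : ℕ => (‖v‖ₑ * K) ^ 2 / (m : ℝ≥0∞)) atTop (𝓝 0) := by
    simpa [div_eq_mul_inv] using ENNReal.Tendsto.const_mul (a := (‖v‖ₑ * K) ^ 2)
      ENNReal.tendsto_inv_nat_nhds_zero (Or.inr (by finiteness))
  have h0 : ENNReal.ofReal c ^ 2 * volume (Metric.ball y r) ≤ 0 :=
    ge_of_tendsto hlim (by filter_upwards [eventually_gt_atTop 0] with m hm using key m hm)
  have hpos : 0 < volume (Metric.ball y r) := Metric.measure_ball_pos volume y hr
  exact absurd h0 (not_le.2 (ENNReal.mul_pos (by simp [hc]) hpos.ne'))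

end BoundaryValues

/-! ### Invariance of the closed domain under tangential flows -/

section Invariance

/-- Normalise `n` by `Dρ(x₀) n = 1`. Strict differentiability then compares increments of `ρ`
between any two points near `x₀` with `s`, up to an error `s / 2`. -/
theorem exists_direction {ρ : Plane → ℝ} {x₀ : Plane} (hρ : ContDiffAt ℝ 2 ρ x₀)
    (hD : fderiv ℝ ρ x₀ ≠ 0) : ∃ n : Plane, ∃ r > 0, ∀ x ∈ Metric.ball x₀ r, ∀ s : ℝ, 0 ≤ s →
      x + s • n ∈ Metric.ball x₀ r → ρ x + s / 2 ≤ ρ (x + s • n) := by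
  obtain ⟨n₀, hn₀⟩ : ∃ n, fderiv ℝ ρ x₀ n ≠ 0 := by
    by_contra! h
    exact hD (ContinuousLinearMap.ext h)
  set n : Plane := (fderiv ℝ ρ x₀ n₀)⁻¹ • n₀ with hn
  have hn1 : fderiv ℝ ρ x₀ n = 1 := by rw [hn, map_smul, smul_eq_mul, inv_mul_cancel₀ hn₀]
  have hs := hρ.hasStrictFDerivAt (by norm_num)
  have hε : 0 < 1 / (2 * (‖n‖ + 1)) := by positivity
  have hev := hs.isLittleO.def hε
  rw [nhds_prod_eq] at hev
  obtain ⟨r, hr, hball⟩ := Metric.eventually_nhds_iff_ball.1 (nhds_prod_eq (x := x₀) (y := x₀) ▸ hev)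
  refine ⟨n, r, hr, fun x hx s hs0 hxs => ?_⟩
  have h := hball (x + s • n, x) (by
    rw [← ball_prod_same]; exact ⟨hxs, hx⟩)
  simp only [add_sub_cancel_left, map_smul, hn1, smul_eq_mul, mul_one, norm_smul,
    Real.norm_eq_abs, abs_of_nonneg hs0] at h
  have h2 : 1 / (2 * (‖n‖ + 1)) * (s * ‖n‖) ≤ s / 2 := by
    have h3 : ‖n‖ / (‖n‖ + 1) ≤ 1 := by
      rw [div_le_one (by positivity)]; linarith [norm_nonneg n]
    calc 1 / (2 * (‖n‖ + 1)) * (s * ‖n‖) = s / 2 * (‖n‖ / (‖n‖ + 1)) := by field_simp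
      _ ≤ s / 2 * 1 := by gcongr
      _ = s / 2 := mul_one _
  linarith [(abs_le.1 (h.trans h2)).1]

/-- A local description of `Ω` near a boundary point: a defining function that grows at unit rate,
up to a factor `1/2`, in a fixed direction. -/
theorem IsC2Domain.exists_local {Ω : Set Plane} (hΩ : IsC2Domain Ω) {x₀ : Plane}
    (hx₀ : x₀ ∈ frontier Ω) : ∃ (ρ : Plane → ℝ) (n : Plane) (r : ℝ), 0 < r ∧ ρ x₀ = 0 ∧
      (∀ x ∈ Metric.ball x₀ r, ContDiffAt ℝ 2 ρ x) ∧
      (∀ x ∈ Metric.ball x₀ r, fderiv ℝ ρ x ≠ 0) ∧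
      (∀ x ∈ Metric.ball x₀ r, (x ∈ Ω ↔ ρ x < 0)) ∧
      ∀ x ∈ Metric.ball x₀ r, ∀ s : ℝ, 0 ≤ s → x + s • n ∈ Metric.ball x₀ r →
        ρ x + s / 2 ≤ ρ (x + s • n) := by
  obtain ⟨ρ, hρ, hD, hiff⟩ := hΩ.c2Boundary x₀ hx₀
  obtain ⟨n, r₁, hr₁, hn⟩ := exists_direction hρ hD
  have hev1 : ∀ᶠ x in 𝓝 x₀, ContDiffAt ℝ 2 ρ x := hρ.eventually (by simp)
  have hev2 : ∀ᶠ x in 𝓝 x₀, fderiv ℝ ρ x ≠ 0 :=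
    (hρ.fderiv_right (m := 1) (by norm_num)).continuousAt.eventually_ne hD
  obtain ⟨r₂, hr₂, hb⟩ := Metric.eventually_nhds_iff_ball.1 (hev1.and (hev2.and hiff))
  have hx₀' : ρ x₀ = 0 := by
    refine le_antisymm ?_ ?_
    · by_contra! h
      have h1 : ∀ᶠ x in 𝓝 x₀, x ∉ Ω := by
        filter_upwards [hρ.continuousAt.eventually_const_lt h, hiff] with x h2 h3
        rw [h3]; exact not_lt.2 h2.le
      exact (mem_closure_iff_frequently.1 (frontier_subset_closure hx₀)) h1
    · have h1 : x₀ ∉ Ω := by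
        rw [frontier, hΩ.isOpen.interior_eq] at hx₀
        exact hx₀.2
      rw [hiff.self_of_nhds] at h1
      exact not_lt.1 h1
  have hsub : Metric.ball x₀ (min r₁ r₂) ⊆ Metric.ball x₀ r₁ :=
    Metric.ball_subset_ball (min_le_left _ _)
  have hsub' : Metric.ball x₀ (min r₁ r₂) ⊆ Metric.ball x₀ r₂ :=
    Metric.ball_subset_ball (min_le_right _ _)
  exact ⟨ρ, n, min r₁ r₂, lt_min hr₁ hr₂, hx₀', fun x hx => (hb x (hsub' hx)).1,
    fun x hx => (hb x (hsub' hx)).2.1, fun x hx => (hb x (hsub' hx)).2.2,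
    fun x hx s hs hxs => hn x (hsub hx) s hs (hsub hxs)⟩

/-- If `f x₀ ≠ 0`, then `|f|` is bounded below near `x₀`, while short segments in the direction `n`
cross from `Ω` to its complement there. `MemH10.false_of_exit` excludes this. -/
theorem MemH10.eq_zero_of_mem_frontier {Ω : Set Plane} (hΩ : IsC2Domain Ω) {f : Plane → ℝ}
    (hfc : Continuous f) (hf : MemH10 Ω f) {x₀ : Plane} (hx₀ : x₀ ∈ frontier Ω) : f x₀ = 0 := by
  by_contra hne
  obtain ⟨ρ, n, r, hr, hρ0, hρc, -, hiff, hn⟩ := hΩ.exists_local hx₀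
  have hc : 0 < |f x₀| / 2 := by positivity
  have hev : ∀ᶠ x in 𝓝 x₀, |f x₀| / 2 < |f x| :=
    hfc.abs.continuousAt.eventually_const_lt (by linarith)
  obtain ⟨r₁, hr₁, hb⟩ := Metric.eventually_nhds_iff_ball.1 hev
  set η := min r r₁ with hη
  have hη0 : 0 < η := lt_min hr hr₁
  obtain ⟨s, hs0, hs⟩ : ∃ s : ℝ, 0 < s ∧ s * ‖n‖ < η / 2 := by
    refine ⟨η / (4 * (‖n‖ + 1)), by positivity, ?_⟩
    have h3 : ‖n‖ / (‖n‖ + 1) ≤ 1 := by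
      rw [div_le_one (by positivity)]; linarith [norm_nonneg n]
    calc η / (4 * (‖n‖ + 1)) * ‖n‖ = η / 4 * (‖n‖ / (‖n‖ + 1)) := by field_simp
      _ ≤ η / 4 * 1 := by gcongr
      _ < η / 2 := by linarith
  have hmem : ∀ t : ℝ, |t| ≤ 1 → x₀ + (t * s) • n ∈ Metric.ball x₀ (η / 2) := by
    intro t ht
    rw [mem_ball_iff_norm, add_sub_cancel_left, norm_smul, norm_mul, Real.norm_eq_abs,
      Real.norm_of_nonneg hs0.le, mul_assoc]
    exact (mul_le_of_le_one_left (by positivity) ht).trans_lt hs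
  have hbη : Metric.ball x₀ (η / 2) ⊆ Metric.ball x₀ r :=
    Metric.ball_subset_ball ((by linarith : η / 2 ≤ η).trans (min_le_left _ _))
  have hx₀b : x₀ ∈ Metric.ball x₀ r := Metric.mem_ball_self hr
  set y : Plane := x₀ + (-1 * s) • n with hy
  set v : Plane := (2 * s) • n with hv
  have hyb : y ∈ Metric.ball x₀ (η / 2) := hmem (-1) (by simp)
  have hyv : y + v = x₀ + (1 * s) • n := by rw [hy, hv]; module
  have hyvb : y + v ∈ Metric.ball x₀ (η / 2) := by rw [hyv]; exact hmem 1 (by simp)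
  have hy1 : ρ y < 0 := by
    have h1 := hn y (hbη hyb) s hs0.le (by
      rw [show y + s • n = x₀ by rw [hy]; module]; exact hx₀b)
    rw [show y + s • n = x₀ by rw [hy]; module, hρ0] at h1
    linarith
  have hy2 : 0 < ρ (y + v) := by
    have h1 := hn x₀ hx₀b s hs0.le (hbη (by simpa using hmem 1 (by simp)))
    rw [hρ0] at h1
    rw [hyv, one_mul]; linarith
  have e1 : ∀ᶠ x in 𝓝 y, ρ x < 0 ∧ x ∈ Metric.ball x₀ (η / 2) :=
    ((hρc y (hbη hyb)).continuousAt.eventually_lt_const hy1).and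
      (Metric.isOpen_ball.mem_nhds hyb)
  have htr : Tendsto (fun x : Plane => x + v) (𝓝 y) (𝓝 (y + v)) :=
    (continuous_add_const v).tendsto y
  have e2 : ∀ᶠ x in 𝓝 y, 0 < ρ (x + v) ∧ x + v ∈ Metric.ball x₀ (η / 2) :=
    htr.eventually (((hρc _ (hbη hyvb)).continuousAt.eventually_const_lt hy2).and
      (Metric.isOpen_ball.mem_nhds hyvb))
  obtain ⟨r₂, hr₂, hb₂⟩ := Metric.eventually_nhds_iff_ball.1 (e1.and e2)
  refine hf.false_of_exit hΩ.isOpen hfc (y := y) (v := v) hr₂ hc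
    (fun x hx => (hiff x (hbη (hb₂ x hx).1.2)).2 (hb₂ x hx).1.1)
    (fun x hx h => ?_) fun x hx t ht => (hb _ ?_).le
  · exact absurd ((hiff _ (hbη (hb₂ x hx).2.2)).1 h) (not_lt.2 (hb₂ x hx).2.1.le)
  · have hconv := convex_ball x₀ (η / 2)
    have h1 : x + t • v ∈ Metric.ball x₀ (η / 2) :=
      hconv.add_smul_mem (hb₂ x hx).1.2 (hb₂ x hx).2.2 ht
    exact Metric.ball_subset_ball ((by linarith : η / 2 ≤ η).trans (min_le_right _ _)) h1

theorem inner_J_self (x : Plane) : inner ℝ x (J x) = 0 := by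
  have h : (J x).ofLp = !![0, -1; 1, 0] *ᵥ x.ofLp := Matrix.ofLp_toEuclideanCLM _ _
  simp only [PiLp.inner_apply, Fin.sum_univ_two, h]
  simp [Matrix.mulVec, dotProduct]
  ring

/-- Near a boundary point, rotated gradients of functions vanishing on the boundary are tangential
up to an error controlled by the defining function. -/
theorem IsC2Domain.exists_tangential {N : ℕ} {Ω : Set Plane} (hΩ : IsC2Domain Ω)
    {f : Fin N → Plane → ℝ} (hf : ∀ k, ContDiff ℝ 2 (f k))
    (hf0 : ∀ k, ∀ x ∈ frontier Ω, f k x = 0) {x₀ : Plane} (hx₀ : x₀ ∈ frontier Ω) :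
    ∃ (ρ : Plane → ℝ) (C : ℝ), 0 ≤ C ∧ ρ x₀ = 0 ∧ ∀ᶠ x in 𝓝 x₀, DifferentiableAt ℝ ρ x ∧
      (x ∉ Ω → 0 ≤ ρ x) ∧ (ρ x = 0 → x ∈ closure Ω) ∧
      ∀ k, 0 ≤ ρ x → |fderiv ℝ ρ x (J (gradient (f k) x))| ≤ C * ρ x := by
  obtain ⟨ρ, n, r, hr, hρ0, hρc, hρD, hiff, hn⟩ := hΩ.exists_local hx₀
  have hx₀b : x₀ ∈ Metric.ball x₀ r := Metric.mem_ball_self hr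
  have hcl : ∀ x ∈ Metric.ball x₀ r, ρ x = 0 → x ∈ closure Ω := by
    intro x hx h0
    have ht : Tendsto (fun s : ℝ => x - s • n) (𝓝[>] 0) (𝓝 x) := by
      have : Continuous fun s : ℝ => x - s • n := by fun_prop
      simpa using (this.tendsto 0).mono_left nhdsWithin_le_nhds
    refine mem_closure_of_tendsto ht ?_
    filter_upwards [ht.eventually (Metric.isOpen_ball.mem_nhds hx), self_mem_nhdsWithin]
      with s h1 h2
    have h2' : (0 : ℝ) < s := h2
    have h3 := hn (x - s • n) h1 s h2'.le (by simpa using hx)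
    rw [sub_add_cancel, h0] at h3
    exact (hiff _ h1).2 (by linarith)
  have hfr : ∀ x ∈ Metric.ball x₀ r, ρ x = 0 → x ∈ frontier Ω := by
    intro x hx h0
    rw [frontier, hΩ.isOpen.interior_eq]
    exact ⟨hcl x hx h0, by rw [hiff x hx, h0]; exact lt_irrefl _⟩
  -- On the level set `f k` is constant, so every point is a constrained extremum; by Lagrange
  -- multipliers `D(f k)` is a multiple of `Dρ`, and `J∇(f k)` is orthogonal to `∇(f k)`.
  have htan : ∀ k, ∀ x ∈ Metric.ball x₀ r, ρ x = 0 →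
      fderiv ℝ ρ x (J (gradient (f k) x)) = 0 := by
    intro k x hx h0
    have hev : ∀ᶠ z in 𝓝[{z | ρ z = ρ x}] x, f k z = f k x := by
      filter_upwards [mem_nhdsWithin_of_mem_nhds (Metric.isOpen_ball.mem_nhds hx),
        self_mem_nhdsWithin] with z hz1 hz2
      have hz2' : ρ z = ρ x := hz2
      rw [hf0 k z (hfr z hz1 (hz2'.trans h0)), hf0 k x (hfr x hx h0)]
    have hext : IsLocalExtrOn (f k) {z | ρ z = ρ x} x :=
      Or.inl (hev.mono fun z hz => hz.ge)
    obtain ⟨a, b, hab, h⟩ := hext.exists_multipliers_of_hasStrictFDerivAt_1d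
      ((hρc x hx).hasStrictFDerivAt (by norm_num))
      ((hf k).contDiffAt.hasStrictFDerivAt (by norm_num))
    have ha : a ≠ 0 ∨ b ≠ 0 := by
      by_contra! hc
      exact hab (by rw [hc.1, hc.2]; rfl)
    have hb : b ≠ 0 := by
      intro hb
      rw [hb, zero_smul, add_zero] at h
      rcases ha with ha | ha
      · exact hρD x hx ((smul_eq_zero.1 h).resolve_left ha)
      · exact ha hb
    have hzero : fderiv ℝ (f k) x (J (gradient (f k) x)) = 0 := by
      have : fderiv ℝ (f k) x (J (gradient (f k) x))
          = inner ℝ (gradient (f k) x) (J (gradient (f k) x)) := by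
        rw [gradient, InnerProductSpace.toDual_symm_apply]
      rw [this, inner_J_self]
    by_cases ha0 : a = 0
    · rw [ha0, zero_smul, zero_add] at h
      have hg : gradient (f k) x = 0 := by
        rw [gradient, (smul_eq_zero.1 h).resolve_left hb, map_zero]
      rw [hg, map_zero, map_zero]
    · have := congrArg (fun A : StrongDual ℝ Plane => A (J (gradient (f k) x))) h
      simp only [add_apply, smul_apply, smul_eq_mul, hzero, mul_zero,
        add_zero, zero_apply] at this
      exact (mul_eq_zero.1 this).resolve_left ha0
  have hfc : ∀ k, ContDiffAt ℝ 1 (fun x => fderiv ℝ ρ x (J (gradient (f k) x))) x₀ := by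
    intro k
    have h1 : ContDiffAt ℝ 1 (fderiv ℝ ρ) x₀ := (hρc x₀ hx₀b).fderiv_right (by norm_num)
    have h2 : ContDiff ℝ 1 (fderiv ℝ (f k)) := (hf k).fderiv_right (by norm_num)
    have h3 : ContDiff ℝ 1 (gradient (f k)) :=
      ((InnerProductSpace.toDual ℝ Plane).symm.toContinuousLinearEquiv.contDiff).comp h2
    exact h1.clm_apply (J.contDiff.comp h3).contDiffAt
  choose K t ht hK using fun k => (hfc k).exists_lipschitzOnWith
  have hnear : ∀ᶠ x in 𝓝 x₀, x ∈ Metric.ball x₀ r ∧ ∀ k, x ∈ t k :=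
    Filter.Eventually.and (Metric.isOpen_ball.mem_nhds hx₀b) (eventually_all.2 ht)
  obtain ⟨r₁, hr₁, hb₁⟩ := Metric.eventually_nhds_iff_ball.1 hnear
  have hsmall : ∀ᶠ x in 𝓝 x₀, 2 * |ρ x| * ‖n‖ < r₁ / 2 := by
    have hc : ContinuousAt (fun x => 2 * |ρ x| * ‖n‖) x₀ :=
      ((hρc x₀ hx₀b).continuousAt.abs.const_mul 2).mul_const _
    exact hc.eventually_lt_const (by simp only [hρ0, abs_zero, mul_zero, zero_mul]; positivity)
  refine ⟨ρ, (∑ k, (K k : ℝ)) * (2 * ‖n‖), by positivity, hρ0, ?_⟩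
  filter_upwards [hsmall, Metric.ball_mem_nhds x₀ (half_pos hr₁)] with x hxs hxb
  have hxb₁ : x ∈ Metric.ball x₀ r₁ := Metric.ball_subset_ball (by linarith) hxb
  have hxr := (hb₁ x hxb₁).1
  refine ⟨(hρc x hxr).differentiableAt (by norm_num),
    fun h => not_lt.1 fun h' => h ((hiff x hxr).2 h'), hcl x hxr, fun k hρx => ?_⟩
  rw [abs_of_nonneg hρx] at hxs
  have hseg : ∀ s ∈ Icc (0 : ℝ) (2 * ρ x), x - s • n ∈ Metric.ball x₀ r₁ := by
    intro s hs
    rw [mem_ball_iff_norm] at hxb ⊢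
    have : ‖s • n‖ ≤ 2 * ρ x * ‖n‖ := by
      rw [norm_smul, Real.norm_of_nonneg hs.1]
      gcongr
      exact hs.2
    calc ‖x - s • n - x₀‖ = ‖(x - x₀) - s • n‖ := by congr 1; abel
      _ ≤ ‖x - x₀‖ + ‖s • n‖ := _root_.norm_sub_le _ _
      _ < r₁ := by linarith
  have h2ρ : (0 : ℝ) ≤ 2 * ρ x := by linarith
  -- Since `ρ` grows at rate at least `1 / 2` along `n`, a zero of `ρ` is met within distance `2 * ρ
  -- x * ‖n‖` of `x`. The normal component vanishes there, and its Lipschitz bound carries the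
  -- estimate back to `x`.
  have hivt : (0 : ℝ) ∈ (fun s : ℝ => ρ (x - s • n)) '' Icc 0 (2 * ρ x) := by
    refine intermediate_value_Icc' h2ρ (fun s hs => ?_) ⟨?_, by simpa using hρx⟩
    · have h1 := (hρc _ (hb₁ _ (hseg s hs)).1).continuousAt
      exact (ContinuousAt.comp (f := fun s : ℝ => x - s • n) (g := ρ) h1
        (by fun_prop)).continuousWithinAt
    · have h1 := hn (x - (2 * ρ x) • n) (hb₁ _ (hseg _ ⟨h2ρ, le_rfl⟩)).1 (2 * ρ x) h2ρ
        (by simpa using hxr)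
      rw [sub_add_cancel] at h1
      linarith
  obtain ⟨s, hs, hs0⟩ := hivt
  simp only at hs0
  have hy := hb₁ _ (hseg s hs)
  have h3 := (hK k).norm_sub_le ((hb₁ x hxb₁).2 k) (hy.2 k)
  rw [htan k _ hy.1 hs0, sub_zero, sub_sub_cancel, norm_smul, Real.norm_of_nonneg hs.1,
    Real.norm_eq_abs] at h3
  refine h3.trans ?_
  have hKs : (K k : ℝ) ≤ ∑ k, (K k : ℝ) :=
    Finset.single_le_sum (f := fun k => (K k : ℝ)) (fun k _ => (K k).2) (Finset.mem_univ k)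
  calc (K k : ℝ) * (s * ‖n‖) ≤ (∑ k, (K k : ℝ)) * (2 * ρ x * ‖n‖) :=
        mul_le_mul hKs (mul_le_mul_of_nonneg_right hs.2 (norm_nonneg n))
          (mul_nonneg hs.1 (norm_nonneg n)) ((K k).2.trans hKs)
    _ = _ := by ring

variable {N : ℕ} {Ω : Set Plane} {f : Fin N → Plane → ℝ} {T : ℝ}
  {u : ℝ → EuclideanSpace ℝ (Fin N)} {x₀ : Plane} {X : ℝ → Plane}

theorem contDiff_gradient {f : Plane → ℝ} {m n : WithTop ℕ∞} (hf : ContDiff ℝ n f)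
    (hmn : m + 1 ≤ n) : ContDiff ℝ m (gradient f) :=
  ((InnerProductSpace.toDual ℝ Plane).symm.toContinuousLinearEquiv.contDiff).comp
    (hf.fderiv_right hmn)

/-- After a last time in `closure Ω`, at a boundary point, `ρ(X)` would be nonnegative, start at
`0`, and satisfy a linear differential inequality. Gronwall makes it vanish, which puts `X` back in
the closure. Continuity of the control supplies the derivative of `X` at every time. -/
theorem IsTraj.mem_closure_of_continuous (hΩ : IsC2Domain Ω) (hf : ∀ k, ContDiff ℝ 2 (f k))
    (hf0 : ∀ k, ∀ x ∈ frontier Ω, f k x = 0) (hu : Continuous u)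
    (hX : IsTraj (fun k x => J (gradient (f k) x)) T u x₀ X) (hx₀ : x₀ ∈ closure Ω) :
    ∀ t ∈ Icc 0 T, X t ∈ closure Ω := by
  intro t₁ ht₁
  by_contra hout
  have hT : 0 ≤ T := ht₁.1.trans ht₁.2
  set F : Fin N → Plane → Plane := fun k x => J (gradient (f k) x) with hF
  have hFc : ∀ k, Continuous (F k) := fun k =>
    J.continuous.comp (contDiff_gradient (m := 1) (hf k) (by norm_num)).continuous
  have hd : ∀ t ∈ Icc 0 T, HasDerivWithinAt X (affineField F (u t) (X t)) (Icc 0 T) t := by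
    intro t ht
    refine (ODE.hasDerivWithinAt_picard_Icc (f := fun t => affineField F (u t)) (u := univ)
      (t₀ := 0) ⟨le_rfl, hT⟩ ?_ hX.continuousOn (fun _ _ => mem_univ _) x₀ ht).congr_of_mem
        (fun t ht => hX.eq t ht) ht
    refine Continuous.continuousOn ?_
    simp only [Function.uncurry_def, affineField]
    fun_prop
  have hsub : Icc 0 t₁ ⊆ Icc 0 T := Icc_subset_Icc_right ht₁.2
  have hcomp : IsCompact (Icc 0 t₁ ∩ X ⁻¹' closure Ω) :=
    isCompact_Icc.of_isClosed_subset
      ((hX.continuousOn.mono hsub).preimage_isClosed_of_isClosed isClosed_Icc isClosed_closure)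
      inter_subset_left
  -- `t₀` is the last time before `t₁` at which the trajectory lies in the closed domain.
  obtain ⟨t₀, ⟨ht₀, hXt₀⟩, hmax⟩ := hcomp.exists_isGreatest
    ⟨0, ⟨le_rfl, ht₁.1⟩, by simpa [hX.zero_eq hT] using hx₀⟩
  have hlt : t₀ < t₁ := lt_of_le_of_ne ht₀.2 fun h => hout (h ▸ hXt₀)
  have hafter : ∀ t ∈ Ioc t₀ t₁, X t ∉ closure Ω := fun t ht h =>
    absurd (hmax ⟨⟨ht₀.1.trans ht.1.le, ht.2⟩, h⟩) (not_le.2 ht.1)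
  have hle : 𝓝[Icc t₀ t₁] t₀ ≤ 𝓝[Icc 0 T] t₀ :=
    nhdsWithin_mono _ fun t ht => ⟨ht₀.1.trans ht.1, ht.2.trans ht₁.2⟩
  have hcont : Tendsto X (𝓝[Icc t₀ t₁] t₀) (𝓝 (X t₀)) :=
    (hX.continuousOn t₀ (hsub ht₀)).mono_left hle
  have hgt : 𝓝[>] t₀ ≤ 𝓝[Icc t₀ t₁] t₀ := by
    rw [← nhdsWithin_Ioc_eq_nhdsGT hlt]
    exact nhdsWithin_mono _ Ioc_subset_Icc_self
  have hfront : X t₀ ∈ frontier Ω := by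
    rw [frontier, hΩ.isOpen.interior_eq]
    refine ⟨hXt₀, fun hin => ?_⟩
    have h1 : ∀ᶠ t in 𝓝[>] t₀, X t ∈ Ω := hgt (hcont.eventually (hΩ.isOpen.mem_nhds hin))
    obtain ⟨t, h2, h3⟩ := (h1.and (Ioc_mem_nhdsGT hlt)).exists
    exact hafter t h3 (subset_closure h2)
  obtain ⟨ρ, C, hC0, hρ0, hev⟩ := hΩ.exists_tangential hf hf0 hfront
  obtain ⟨δ, hδ, hball⟩ := Metric.mem_nhdsWithin_iff.1 (hcont.eventually hev)
  set t₂ := min t₁ (t₀ + δ / 2) with ht₂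
  have ht₀₂ : t₀ < t₂ := lt_min hlt (by linarith)
  have hgood : ∀ t ∈ Icc t₀ t₂, DifferentiableAt ℝ ρ (X t) ∧
      (X t ∉ Ω → 0 ≤ ρ (X t)) ∧ (ρ (X t) = 0 → X t ∈ closure Ω) ∧
      ∀ k, 0 ≤ ρ (X t) → |fderiv ℝ ρ (X t) (J (gradient (f k) (X t)))| ≤ C * ρ (X t) := by
    intro t ht
    refine hball ⟨?_, ht.1, ht.2.trans (min_le_left _ _)⟩
    rw [Metric.mem_ball, Real.dist_eq, abs_of_nonneg (by linarith [ht.1])]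
    linarith [ht.2.trans (min_le_right _ _)]
  have hnn : ∀ t ∈ Icc t₀ t₂, 0 ≤ ρ (X t) := by
    intro t ht
    rcases ht.1.eq_or_lt with h | h
    · rw [← h, hρ0]
    · exact (hgood t ht).2.1 fun hin =>
        hafter t ⟨h, ht.2.trans (min_le_left _ _)⟩ (subset_closure hin)
  obtain ⟨U, hU⟩ := isCompact_Icc.exists_bound_of_continuousOn (hu.continuousOn (s := Icc 0 T))
  have hsub₂ : Icc t₀ t₂ ⊆ Icc 0 T := fun t ht =>
    ⟨ht₀.1.trans ht.1, (ht.2.trans (min_le_left _ _)).trans ht₁.2⟩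
  have hgr := norm_le_gronwallBound_of_norm_deriv_right_le (f := fun t => ρ (X t))
    (f' := fun t => fderiv ℝ ρ (X t) (affineField F (u t) (X t))) (δ := 0) (K := N * C * U)
    (ε := 0) (a := t₀) (b := t₂) ?_ ?_ ?_ ?_ t₂ ⟨ht₀₂.le, le_rfl⟩
  · simp only [gronwallBound_ε0, zero_mul, norm_le_zero_iff] at hgr
    exact hafter t₂ ⟨ht₀₂, min_le_left _ _⟩ ((hgood t₂ ⟨ht₀₂.le, le_rfl⟩).2.2.1 hgr)
  · intro t ht
    exact (hgood t ht).1.continuousAt.comp_continuousWithinAt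
      ((hX.continuousOn t (hsub₂ ht)).mono hsub₂)
  · intro t ht
    have htT := hsub₂ (Ico_subset_Icc_self ht)
    have h1 : HasDerivWithinAt X (affineField F (u t) (X t)) (Ici t) t := by
      refine (hd t htT).mono_of_mem_nhdsWithin ?_
      have htT' : t < T := ht.2.trans_le ((min_le_left _ _).trans ht₁.2)
      exact mem_of_superset (Icc_mem_nhdsGE htT') (Icc_subset_Icc_left htT.1)
    exact (hgood t (Ico_subset_Icc_self ht)).1.hasFDerivAt.comp_hasDerivWithinAt t h1
  · simp [hρ0]
  · intro t ht
    have ht' := Ico_subset_Icc_self ht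
    have htT := hsub₂ ht'
    have h0 := hnn t ht'
    rw [add_zero, affineField, map_sum, Real.norm_of_nonneg h0]
    simp only [map_smul]
    refine (norm_sum_smul_le (u t) (B := C * ρ (X t)) fun k => ?_).trans ?_
    · exact (hgood t ht').2.2.2 k h0
    · calc (N : ℝ) * (C * ρ (X t)) * ‖u t‖ ≤ N * (C * ρ (X t)) * U := by
            gcongr; exact hU t htT
        _ = _ := by ring

/-- For integrable controls, invariance follows by `L¹` approximation with continuous controls,
because `closure Ω` is closed. -/
theorem IsTraj.mem_closure (hT : 0 ≤ T) (hΩ : IsC2Domain Ω) (hf : ∀ k, ContDiff ℝ 2 (f k))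
    (hfs : ∀ k, HasCompactSupport (f k)) (hf0 : ∀ k, ∀ x ∈ frontier Ω, f k x = 0)
    (hu : IntegrableOn u (Icc 0 T))
    (hX : IsTraj (fun k x => J (gradient (f k) x)) T u x₀ X) (hx₀ : x₀ ∈ closure Ω) :
    ∀ t ∈ Icc 0 T, X t ∈ closure Ω := by
  intro t ht
  set F : Fin N → Plane → Plane := fun k x => J (gradient (f k) x) with hF
  have hF1 : ∀ k, ContDiff ℝ 1 (F k) := fun k =>
    J.contDiff.comp (contDiff_gradient (hf k) (by norm_num))
  have hFs : ∀ k, HasCompactSupport (F k) := fun k =>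
    ((hfs k).fderiv ℝ).comp_left (g := fun A => J ((InnerProductSpace.toDual ℝ Plane).symm A))
      (by simp)
  obtain ⟨L, B, hB0, hL, hB⟩ := exists_lipschitz_bound_of_compactSupport hF1 hFs
  obtain ⟨v, hvc, hvu⟩ := exists_continuous_tendsto_L1 hT hu
  choose Y hY using fun n => exists_isTraj_of_continuous hT hB0 hL hB (hvc n) x₀
  have hYcl : ∀ n, Y n t ∈ closure Ω := fun n =>
    (hY n).mem_closure_of_continuous hΩ hf hf0 (hvc n) hx₀ t ht
  set M := Real.exp (2 * ∫ τ in (0 : ℝ)..T, N * L * ‖u τ‖)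
  have hlim : Tendsto (fun n : ℕ => N * B * (1 / ((n : ℝ) + 1)) * M) atTop (𝓝 0) := by
    simpa using (tendsto_one_div_add_atTop_nhds_zero_nat.const_mul (N * B : ℝ)).mul_const M
  have htend : Tendsto (fun n => Y n t) atTop (𝓝 (X t)) := by
    rw [tendsto_iff_norm_sub_tendsto_zero]
    refine squeeze_zero (fun _ => norm_nonneg _) (fun n => ?_) hlim
    have := IsTraj.norm_sub_le hB0 (fun k => (hL k).lipschitzOnWith (s := univ))
      (fun k x _ => hB k x) (fun k => (hL k).continuous) hu (hvc n).continuousOn.integrableOn_Icc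
      hX (hY n) (fun _ _ => mem_univ _) (fun _ _ => mem_univ _) t ht
    rw [norm_sub_rev]
    refine this.trans ?_
    rw [sub_self, norm_zero, zero_add]
    gcongr
    exact hvu n
  exact isClosed_closure.mem_of_tendsto htend (Eventually.of_forall hYcl)

end Invariance

/-! ### Regularity of the initial curve -/

section WeakDerivatives

/-- The primitive from `0` vanishes to the left of the support, and to the right of it because the
total integral is zero. -/
theorem exists_primitive_compactSupport {ψ : ℝ → ℝ} (hψ : ContDiff ℝ ∞ ψ)
    (hc : HasCompactSupport ψ) (hsupp : tsupport ψ ⊆ Ioo (0 : ℝ) 1) (h0 : ∫ x, ψ x = 0) :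
    ∃ φ : ℝ → ℝ, ContDiff ℝ ∞ φ ∧ HasCompactSupport φ ∧ tsupport φ ⊆ Ioo (0 : ℝ) 1 ∧
      deriv φ = ψ := by
  set φ : ℝ → ℝ := fun x => ∫ s in (0 : ℝ)..x, ψ s with hφ
  have hd : ∀ x, HasDerivAt φ (ψ x) x := fun x =>
    (hψ.continuous.integral_hasStrictDerivAt 0 x).hasDerivAt
  have hderiv : deriv φ = ψ := funext fun x => (hd x).deriv
  obtain ⟨a, b, ha, hb, hab⟩ : ∃ a b : ℝ, 0 < a ∧ b < 1 ∧ tsupport ψ ⊆ Icc a b := by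
    rcases (tsupport ψ).eq_empty_or_nonempty with h | h
    · exact ⟨1 / 2, 1 / 2, by norm_num, by norm_num, by rw [h]; exact empty_subset _⟩
    · obtain ⟨a, ha⟩ := IsCompact.exists_isLeast hc h
      obtain ⟨b, hb⟩ := IsCompact.exists_isGreatest hc h
      exact ⟨a, b, (hsupp ha.1).1, (hsupp hb.1).2, fun x hx => ⟨ha.2 hx, hb.2 hx⟩⟩
  have hψ0 : ∀ x, x ∉ Icc a b → ψ x = 0 := fun x hx =>
    image_eq_zero_of_notMem_tsupport fun h => hx (hab h)
  have hsub : Function.support φ ⊆ Icc a b := by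
    intro x hx
    by_contra hxab
    refine hx ?_
    rw [mem_Icc, not_and_or, not_le, not_le] at hxab
    rcases hxab with hxa | hxb
    · simp only [hφ]
      rw [intervalIntegral.integral_congr (g := fun _ => 0), intervalIntegral.integral_zero]
      intro s hs
      refine hψ0 s fun h => ?_
      rcases le_total 0 x with h' | h'
      · rw [uIcc_of_le h'] at hs; linarith [hs.2, h.1]
      · rw [uIcc_of_ge h'] at hs; linarith [hs.2, h.1]
    · simp only [hφ]
      rw [intervalIntegral.integral_eq_integral_of_support_subset, h0]
      intro s hs
      have : s ∈ Icc a b := by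
        by_contra h
        exact hs (hψ0 s h)
      exact ⟨ha.trans_le this.1, this.2.trans hxb.le⟩
  have hcl : tsupport φ ⊆ Icc a b := closure_minimal hsub isClosed_Icc
  refine ⟨φ, ?_, HasCompactSupport.of_support_subset_isCompact isCompact_Icc hsub,
    fun x hx => ⟨ha.trans_le (hcl hx).1, (hcl hx).2.trans_lt hb⟩, hderiv⟩
  rw [contDiff_infty_iff_deriv]
  exact ⟨fun x => (hd x).differentiableAt, by rwa [hderiv]⟩

/-- The du Bois-Reymond lemma. With `θ` a bump of integral one, `ζ - (∫ ζ) θ` is the derivative of a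
test function for every test function `ζ`; hence `f` minus its `θ`-mean is orthogonal to all `ζ`. -/
theorem ae_eq_const_of_integral_deriv_smul {f : ℝ → Plane} (hf : IntegrableOn f (Ioo 0 1))
    (h : ∀ φ : ℝ → ℝ, ContDiff ℝ ∞ φ → HasCompactSupport φ → tsupport φ ⊆ Ioo (0 : ℝ) 1 →
      ∫ s in Ioo (0 : ℝ) 1, deriv φ s • f s = 0) :
    ∃ c : Plane, ∀ᵐ x, x ∈ Ioo (0 : ℝ) 1 → f x = c := by
  let b : ContDiffBump (1 / 2 : ℝ) := ⟨1 / 8, 1 / 4, by norm_num, by norm_num⟩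
  set θ : ℝ → ℝ := b.normed volume
  have hθ : ContDiff ℝ ∞ θ := b.contDiff_normed
  have hθc : HasCompactSupport θ := b.hasCompactSupport_normed
  have hθs : tsupport θ ⊆ Ioo (0 : ℝ) 1 := by
    rw [b.tsupport_normed_eq, Real.closedBall_eq_Icc]
    intro x hx
    simp only [b, mem_Icc] at hx
    constructor <;> linarith [hx.1, hx.2]
  have hθ1 : ∫ x, θ x = 1 := b.integral_normed
  have hint : ∀ ζ : ℝ → ℝ, Continuous ζ → IntegrableOn (fun s => ζ s • f s) (Ioo 0 1) :=
    fun ζ hζ => hf.continuousOn_smul_of_subset (K := Icc 0 1) hζ.continuousOn isCompact_Icc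
      measurableSet_Ioo Ioo_subset_Icc_self
  set c : Plane := ∫ s in Ioo (0 : ℝ) 1, θ s • f s with hc
  refine ⟨c, ?_⟩
  have hset : ∀ (ζ : ℝ → ℝ) (F : ℝ → Plane), tsupport ζ ⊆ Ioo (0 : ℝ) 1 →
      ∫ x, ζ x • F x = ∫ x in Ioo (0 : ℝ) 1, ζ x • F x := by
    intro ζ F hζ
    refine (setIntegral_eq_integral_of_forall_compl_eq_zero fun x hx => ?_).symm
    rw [image_eq_zero_of_notMem_tsupport fun h => hx (hζ h), zero_smul]
  have hconst : IntegrableOn (fun _ : ℝ => c) (Ioo 0 1) := by simp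
  have key := isOpen_Ioo.ae_eq_zero_of_integral_contDiff_smul_eq_zero (μ := volume)
    (f := fun x => f x - c) (hf.sub hconst).locallyIntegrableOn ?_
  · filter_upwards [key] with x hx hxI using sub_eq_zero.1 (hx hxI)
  · intro ζ hζ hζc hζs
    rw [hset ζ _ hζs]
    have hζi : Integrable ζ := hζ.continuous.integrable_of_hasCompactSupport hζc
    have hθi : Integrable θ := hθ.continuous.integrable_of_hasCompactSupport hθc
    set I := ∫ x, ζ x with hI
    have hIset : ∫ x in Ioo (0 : ℝ) 1, ζ x = I :=
      setIntegral_eq_integral_of_forall_compl_eq_zero fun x hx =>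
        image_eq_zero_of_notMem_tsupport fun h => hx (hζs h)
    obtain ⟨φ, hφ, hφc, hφs, hφd⟩ := exists_primitive_compactSupport
      (ψ := fun x => ζ x - I * θ x) (hζ.sub (contDiff_const.mul hθ))
      (hζc.sub hθc.mul_left)
      ((tsupport_sub _ _).trans (union_subset hζs ((tsupport_mul_subset_right).trans hθs)))
      (by rw [integral_sub hζi (hθi.const_mul I), integral_const_mul, hθ1]; simp [hI])
    have h0 := h φ hφ hφc hφs
    rw [hφd] at h0
    simp_rw [sub_smul, mul_smul] at h0
    have hθf : IntegrableOn (fun s => I • θ s • f s) (Ioo 0 1) := (hint θ hθ.continuous).smul I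
    rw [integral_sub (hint ζ hζ.continuous) hθf, integral_smul] at h0
    simp_rw [smul_sub]
    rw [integral_sub (hint ζ hζ.continuous), integral_smul_const, hIset]
    · exact h0
    · exact hζi.integrableOn.smul_const c

theorem integral_deriv_smul_primitive {f : ℝ → Plane} (hf : IntegrableOn f (Icc 0 1)) {φ : ℝ → ℝ}
    (hφ : ContDiff ℝ ∞ φ) (hs : tsupport φ ⊆ Ioo (0 : ℝ) 1) :
    ∫ s in Ioo (0 : ℝ) 1, deriv φ s • (∫ τ in (0 : ℝ)..s, f τ)
      = - ∫ s in Ioo (0 : ℝ) 1, φ s • f s := by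
  have hφd : Continuous (deriv φ) := hφ.continuous_deriv (by simp)
  have h1 := integral_bilin_primitive (ContinuousLinearMap.lsmul ℝ ℝ : ℝ →L[ℝ] Plane →L[ℝ] Plane)
    zero_le_one (hφd.continuousOn.integrableOn_Icc) hf
  simp only [ContinuousLinearMap.lsmul_apply] at h1
  rw [← integral_Ioc_eq_integral_Ioo, ← integral_Ioc_eq_integral_Ioo,
    ← intervalIntegral.integral_of_le zero_le_one, ← intervalIntegral.integral_of_le zero_le_one,
    h1, ← intervalIntegral.integral_neg]
  refine intervalIntegral.integral_congr fun σ _ => ?_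
  have hφ1 : φ 1 = 0 := image_eq_zero_of_notMem_tsupport fun h => lt_irrefl _ (hs h).2
  have := intervalIntegral.integral_deriv_eq_sub (f := φ) (a := σ) (b := 1)
    (fun x _ => (hφ.differentiable (by simp)) x) (hφd.intervalIntegrable _ _)
  simp only [this, hφ1, zero_sub, neg_smul]

/-- The primitive of `g` has weak derivative `g` too, so its difference from `f` has weak derivative
zero. -/
theorem HasWeakDeriv.ae_eq_primitive {f g : ℝ → Plane} (hf : IntegrableOn f (Ioo 0 1))
    (hg : IntegrableOn g (Icc 0 1)) (h : HasWeakDeriv f g) :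
    ∃ c : Plane, ∀ᵐ x, x ∈ Ioo (0 : ℝ) 1 → f x = c + ∫ τ in (0 : ℝ)..x, g τ := by
  have hG : IntegrableOn (fun x => ∫ τ in (0 : ℝ)..x, g τ) (Ioo 0 1) :=
    (continuousOn_primitive_Icc zero_le_one hg).integrableOn_Icc.mono_set Ioo_subset_Icc_self
  obtain ⟨c, hc⟩ := ae_eq_const_of_integral_deriv_smul (hf.sub hG) fun φ h1 h2 h3 => by
    have hφd : Continuous (deriv φ) := h1.continuous_deriv (by simp)
    have hint : ∀ F : ℝ → Plane, IntegrableOn F (Ioo 0 1) →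
        IntegrableOn (fun s => deriv φ s • F s) (Ioo 0 1) :=
      fun F hF => hF.continuousOn_smul_of_subset (K := Icc 0 1) hφd.continuousOn isCompact_Icc
        measurableSet_Ioo Ioo_subset_Icc_self
    simp only [Pi.sub_apply, smul_sub]
    rw [integral_sub (hint _ hf) (hint _ hG), h φ h1 h2 h3, integral_deriv_smul_primitive hg h1 h3,
      sub_self]
  refine ⟨c, ?_⟩
  filter_upwards [hc] with x hx hxI
  rw [← hx hxI]; simp

/-- The classical derivative of a `W^{2,∞}` curve is continuous up to the end points. -/
theorem MemW2Infty.continuousOn_derivWithin {γ : ℝ → Plane} (hγ : MemW2Infty γ)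
    (hc : ContinuousOn γ (Icc 0 1)) : ContinuousOn (derivWithin γ (Icc 0 1)) (Icc 0 1) := by
  obtain ⟨-, γ₁, γ₂, h1, h2, hw1, hw2⟩ := hγ
  have hi : ∀ {f : ℝ → Plane}, MemLp f ⊤ (volume.restrict (Ioo (0 : ℝ) 1)) →
      IntegrableOn f (Icc 0 1) := fun hf =>
    (integrableOn_Icc_iff_integrableOn_Ioo (by simp) (by simp)).2 (hf.integrable le_top)
  obtain ⟨c₁, hc₁⟩ := hw2.ae_eq_primitive ((hi h1).mono_set Ioo_subset_Icc_self) (hi h2)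
  obtain ⟨c₀, hc₀⟩ := hw1.ae_eq_primitive (hc.integrableOn_Icc.mono_set Ioo_subset_Icc_self) (hi h1)
  set G : ℝ → Plane := fun x => c₁ + ∫ τ in (0 : ℝ)..x, γ₂ τ with hG
  have hGc : ContinuousOn G (Icc 0 1) :=
    continuousOn_const.add (continuousOn_primitive_Icc zero_le_one (hi h2))
  have hne : ∀ᵐ τ : ℝ, τ ≠ 1 := by simp [ae_iff]
  have hprim : ∀ x ∈ Icc (0 : ℝ) 1, ∫ τ in (0 : ℝ)..x, γ₁ τ = ∫ τ in (0 : ℝ)..x, G τ := by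
    intro x hx
    refine intervalIntegral.integral_congr_ae ?_
    filter_upwards [hc₁, hne] with τ h3 h4 h5
    rw [uIoc_of_le hx.1] at h5
    exact h3 ⟨h5.1, lt_of_le_of_ne (h5.2.trans hx.2) h4⟩
  have hΓc : ContinuousOn (fun x => c₀ + ∫ τ in (0 : ℝ)..x, G τ) (Icc 0 1) :=
    continuousOn_const.add (continuousOn_primitive_Icc zero_le_one hGc.integrableOn_Icc)
  have hae : γ =ᵐ[volume.restrict (Icc 0 1)] fun x => c₀ + ∫ τ in (0 : ℝ)..x, G τ := by
    rw [← Measure.restrict_congr_set Ioo_ae_eq_Icc, EventuallyEq, ae_restrict_iff' measurableSet_Ioo]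
    filter_upwards [hc₀] with x h3 h4
    rw [h3 h4, hprim x (Ioo_subset_Icc_self h4)]
  -- Almost everywhere equality becomes equality on the whole closed interval as both sides are
  -- continuous. The continuous representative `G` of the weak derivative then gives a one-sided
  -- derivative at the end points as well.
  have heq : EqOn γ (fun x => c₀ + ∫ τ in (0 : ℝ)..x, G τ) (Icc 0 1) :=
    Measure.eqOn_of_ae_eq hae hc hΓc (by rw [interior_Icc, closure_Ioo zero_ne_one])
  refine hGc.congr fun x hx => ?_
  have hd : HasDerivWithinAt γ (G x) (Icc 0 1) x :=
    (ODE.hasDerivWithinAt_picard_Icc (f := fun t _ => G t) (u := univ) (t₀ := 0) (α := γ)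
      ⟨le_rfl, zero_le_one⟩ (hGc.comp continuousOn_fst fun p hp => hp.1) hc
      (fun _ _ => mem_univ _) c₀ hx).congr_of_mem heq hx
  exact hd.derivWithin (uniqueDiffOn_Icc zero_lt_one x hx)

end WeakDerivatives

/-! ### The state and adjoint systems as a control-affine system and its costate equation -/

section Translation

theorem natCast_le_infty (n : ℕ) : (n : WithTop ℕ∞) ≤ (∞ : WithTop ℕ∞) := by exact_mod_cast le_top

theorem two_le_infty : (2 : WithTop ℕ∞) ≤ (∞ : WithTop ℕ∞) := natCast_le_infty 2

theorem one_add_one_le_infty : (1 + 1 : WithTop ℕ∞) ≤ (∞ : WithTop ℕ∞) := by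
  exact_mod_cast natCast_le_infty 2

theorem two_add_one_le_infty : (2 + 1 : WithTop ℕ∞) ≤ (∞ : WithTop ℕ∞) := by
  exact_mod_cast natCast_le_infty 3

theorem contDiff_hess {f : Plane → ℝ} (hf : ContDiff ℝ ∞ f) : ContDiff ℝ ∞ (hess f) :=
  (contDiff_gradient (m := ∞) hf (by simp)).fderiv_right (by simp)

theorem Filter.EventuallyEq.gradient_eventuallyEq {f g : Plane → ℝ} {x : Plane} (h : f =ᶠ[𝓝 x] g) :
    gradient f =ᶠ[𝓝 x] gradient g :=
  (h.fderiv (𝕜 := ℝ)).mono fun y hy => by simp only [gradient, hy]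

/-- Equality holds on neighbourhoods, not merely on `closure Ω`, so that all derivatives in the
state system agree there, boundary points included. -/
theorem exists_compactSupport_extension {N : ℕ} {Ω : Set Plane} (hΩ : Bornology.IsBounded Ω)
    {h : Fin N → Plane → ℝ} (hh : ∀ k, ContDiff ℝ ∞ (h k)) :
    ∃ f : Fin N → Plane → ℝ, (∀ k, ContDiff ℝ ∞ (f k)) ∧ (∀ k, HasCompactSupport (f k)) ∧
      ∀ k, ∀ x ∈ closure Ω, f k =ᶠ[𝓝 x] h k := by
  obtain ⟨R, hR⟩ := hΩ.closure.subset_ball (0 : Plane)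
  obtain ⟨χ, hχ, hχc, hχ1, -⟩ := exists_cutoff (E := Plane) R
  refine ⟨fun k x => χ x * h k x, fun k => hχ.mul (hh k), fun k => hχc.mul_right,
    fun k x hx => ?_⟩
  filter_upwards [Metric.isOpen_ball.mem_nhds (hR hx)] with y hy
  rw [hχ1 y (by simpa using (mem_ball_zero_iff.1 hy).le), one_mul]

variable {N : ℕ}

theorem gradient_stream {h : Fin N → Plane → ℝ} (hh : ∀ k, ContDiff ℝ ∞ (h k))
    (c : EuclideanSpace ℝ (Fin N)) :
    gradient (stream h c) = fun x => ∑ k, c k • gradient (h k) x := by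
  ext1 x
  have hd : ∀ k, DifferentiableAt ℝ (h k) x := fun k => (hh k).differentiable (by simp) x
  have : fderiv ℝ (stream h c) x = ∑ k, c k • fderiv ℝ (h k) x := by
    refine HasFDerivAt.fderiv ?_
    exact HasFDerivAt.fun_sum fun k _ => (hd k).hasFDerivAt.const_mul (c k)
  simp [gradient, this, map_sum]

theorem hess_stream {h : Fin N → Plane → ℝ} (hh : ∀ k, ContDiff ℝ ∞ (h k))
    (c : EuclideanSpace ℝ (Fin N)) :
    hess (stream h c) = fun x => ∑ k, c k • hess (h k) x := by
  ext1 x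
  rw [hess, gradient_stream hh]
  refine HasFDerivAt.fderiv (HasFDerivAt.fun_sum fun k _ => ?_)
  exact ((contDiff_gradient (m := 1) (hh k) one_add_one_le_infty).differentiable one_ne_zero
    x).hasFDerivAt.const_smul (c k)

theorem third_stream {h : Fin N → Plane → ℝ} (hh : ∀ k, ContDiff ℝ ∞ (h k))
    (c : EuclideanSpace ℝ (Fin N)) (x a : Plane) :
    third (stream h c) x a = ∑ k, c k • third (h k) x a := by
  have : fderiv ℝ (hess (stream h c)) x = ∑ k, c k • fderiv ℝ (hess (h k)) x := by
    rw [hess_stream hh]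
    refine HasFDerivAt.fderiv (HasFDerivAt.fun_sum fun k _ => ?_)
    exact ((contDiff_hess (hh k)).differentiable (by simp) x).hasFDerivAt.const_smul (c k)
  ext1 v
  simp [third, this]

/-- The vector fields `(J∇fₖ(X), J∇²fₖ(X)a)` of the state system. -/
def curveField (f : Fin N → Plane → ℝ) (k : Fin N) (w : Plane × Plane) : Plane × Plane :=
  (J (gradient (f k) w.1), J (hess (f k) w.1 w.2))

variable {f : Fin N → Plane → ℝ}

theorem contDiff_curveField (hf : ∀ k, ContDiff ℝ ∞ (f k)) (k : Fin N) :
    ContDiff ℝ 2 (curveField f k) := by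
  have h1 : ContDiff ℝ 2 (gradient (f k)) := contDiff_gradient (hf k) two_add_one_le_infty
  have h2 : ContDiff ℝ 2 (hess (f k)) := (contDiff_hess (hf k)).of_le two_le_infty
  exact (J.contDiff.comp (h1.comp contDiff_fst)).prodMk
    (J.contDiff.comp ((h2.comp contDiff_fst).clm_apply contDiff_snd))

theorem fderiv_curveField (hf : ∀ k, ContDiff ℝ ∞ (f k)) (k : Fin N) (w v : Plane × Plane) :
    fderiv ℝ (curveField f k) w v
      = (J (hess (f k) w.1 v.1), J (third (f k) w.1 w.2 v.1) + J (hess (f k) w.1 v.2)) := by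
  have h1 : HasFDerivAt (gradient (f k)) (hess (f k) w.1) w.1 :=
    ((contDiff_gradient (m := 1) (hf k) one_add_one_le_infty).differentiable one_ne_zero
      w.1).hasFDerivAt
  have h2 : HasFDerivAt (hess (f k)) (fderiv ℝ (hess (f k)) w.1) w.1 :=
    ((contDiff_hess (hf k)).differentiable (by simp) w.1).hasFDerivAt
  have h3 := (J.hasFDerivAt (x := gradient (f k) w.1)).comp w
    (HasFDerivAt.comp (g := gradient (f k)) w h1 hasFDerivAt_fst)
  have h4 := (J.hasFDerivAt (x := hess (f k) w.1 w.2)).comp w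
    ((HasFDerivAt.comp (g := hess (f k)) w h2 hasFDerivAt_fst).clm_apply hasFDerivAt_snd)
  have h5 : HasFDerivAt (curveField f k) _ w := h3.prodMk h4
  rw [h5.fderiv]
  simp [third, add_comm]

/-- The second component is linear in `a` with a bounded coefficient, so the growth is linear
although the field is not bounded. -/
theorem exists_growth_curveField (hf : ∀ k, ContDiff ℝ ∞ (f k))
    (hfs : ∀ k, HasCompactSupport (f k)) :
    ∃ C : ℝ, 0 ≤ C ∧ ∀ k w, ‖curveField f k w‖ ≤ C * (1 + ‖w‖) := by
  have hgs : ∀ k, HasCompactSupport (gradient (f k)) := fun k =>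
    ((hfs k).fderiv ℝ).comp_left (g := fun A => (InnerProductSpace.toDual ℝ Plane).symm A) (by simp)
  obtain ⟨-, B₁, hB₁, -, h1⟩ := exists_lipschitz_bound_of_compactSupport
    (F := fun k => gradient (f k)) (fun k => contDiff_gradient (hf k) one_add_one_le_infty) hgs
  obtain ⟨-, B₂, hB₂, -, h2⟩ := exists_lipschitz_bound_of_compactSupport
    (F := fun k => hess (f k)) (fun k => (contDiff_hess (hf k)).of_le (mod_cast le_top))
    (fun k => (hgs k).fderiv ℝ)
  refine ⟨‖J‖ * (B₁ + B₂), by positivity, fun k w => norm_prod_le_iff.2 ⟨?_, ?_⟩⟩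
  · refine (J.le_opNorm _).trans ?_
    rw [mul_assoc]
    gcongr
    refine (h1 k w.1).trans ?_
    nlinarith [mul_nonneg hB₁ (norm_nonneg w), mul_nonneg hB₂ (norm_nonneg w)]
  · refine (J.le_opNorm _).trans ?_
    rw [mul_assoc]
    gcongr
    refine ((hess (f k) w.1).le_opNorm _).trans ?_
    have := mul_le_mul (h2 k w.1) (norm_snd_le w) (norm_nonneg _) hB₂
    nlinarith [mul_nonneg hB₁ (norm_nonneg w), mul_nonneg hB₂ (norm_nonneg w)]

theorem isTraj_prod_iff {X Y : Type*} [NormedAddCommGroup X] [NormedSpace ℝ X] [CompleteSpace X]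
    [NormedAddCommGroup Y] [NormedSpace ℝ Y] [CompleteSpace Y] {G : Fin N → X × Y → X × Y}
    (hG : ∀ k, Continuous (G k)) {T : ℝ} {u : ℝ → EuclideanSpace ℝ (Fin N)}
    (hu : IntegrableOn u (Icc 0 T)) {x₀ : X} {y₀ : Y} {x : ℝ → X} {y : ℝ → Y} :
    IsTraj G T u (x₀, y₀) (fun t => (x t, y t)) ↔
      (ContinuousOn x (Icc 0 T) ∧ ContinuousOn y (Icc 0 T)) ∧ ∀ t ∈ Icc 0 T,
        x t = x₀ + ∫ τ in (0 : ℝ)..t, ∑ k, u τ k • (G k (x τ, y τ)).1 ∧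
        y t = y₀ + ∫ τ in (0 : ℝ)..t, ∑ k, u τ k • (G k (x τ, y τ)).2 := by
  have key : ContinuousOn x (Icc 0 T) → ContinuousOn y (Icc 0 T) → ∀ t ∈ Icc 0 T,
      ((x t, y t) = (x₀, y₀) + ∫ τ in (0 : ℝ)..t, affineField G (u τ) (x τ, y τ)) ↔
        (x t = x₀ + ∫ τ in (0 : ℝ)..t, ∑ k, u τ k • (G k (x τ, y τ)).1 ∧
        y t = y₀ + ∫ τ in (0 : ℝ)..t, ∑ k, u τ k • (G k (x τ, y τ)).2) := by
    intro hx hy t ht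
    have hi := intervalIntegrable_of_Icc (integrableOn_affineField hG hu (hx.prodMk hy))
      ⟨le_rfl, ht.1.trans ht.2⟩ ht
    have h1 := (ContinuousLinearMap.fst ℝ X Y).intervalIntegral_comp_comm hi
    have h2 := (ContinuousLinearMap.snd ℝ X Y).intervalIntegral_comp_comm hi
    simp only [ContinuousLinearMap.coe_fst', ContinuousLinearMap.coe_snd', affineField,
      Prod.fst_sum, Prod.snd_sum, Prod.smul_fst, Prod.smul_snd] at h1 h2
    rw [Prod.ext_iff, Prod.fst_add, Prod.snd_add, h1, h2]
    rfl
  constructor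
  · intro hz
    have hx : ContinuousOn x (Icc 0 T) := continuous_fst.comp_continuousOn hz.continuousOn
    have hy : ContinuousOn y (Icc 0 T) := continuous_snd.comp_continuousOn hz.continuousOn
    exact ⟨⟨hx, hy⟩, fun t ht => (key hx hy t ht).1 (hz.eq t ht)⟩
  · rintro ⟨⟨hx, hy⟩, h⟩
    exact ⟨hx.prodMk hy, fun t ht => (key hx hy t ht).2 (h t ht)⟩

theorem integrableOn_control {T : ℝ} (u : ControlSpace N T) : IntegrableOn u (Icc 0 T) :=
  (integrableOn_Icc_iff_integrableOn_Ioo (by simp) (by simp)).2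
    ((Lp.memLp u).integrable (by norm_num))

variable {Ω : Set Plane} {h : Fin N → Plane → ℝ} {γ₀ : ℝ → Plane} {T ε : ℝ} {u : ControlSpace N T}
  {X a p q : ℝ → ℝ → Plane}

theorem continuousOn_slice {Y : Type*} [TopologicalSpace Y] {Z : ℝ → ℝ → Y}
    (hZ : ContinuousOn (fun z : ℝ × ℝ => Z z.1 z.2) (Icc 0 T ×ˢ Icc 0 1)) {s : ℝ}
    (hs : s ∈ Icc (0 : ℝ) 1) : ContinuousOn (fun t => Z t s) (Icc 0 T) :=
  hZ.comp (f := fun t : ℝ => (t, s)) (by fun_prop) fun _ ht => ⟨ht, hs⟩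

theorem continuousOn_slice' {Y : Type*} [TopologicalSpace Y] {Z : ℝ → ℝ → Y}
    (hZ : ContinuousOn (fun z : ℝ × ℝ => Z z.1 z.2) (Icc 0 T ×ˢ Icc 0 1)) {t : ℝ}
    (ht : t ∈ Icc 0 T) : ContinuousOn (fun s => Z t s) (Icc 0 1) :=
  hZ.comp (f := fun s : ℝ => (t, s)) (by fun_prop) fun _ hs => ⟨ht, hs⟩

theorem affine_curveField_fst (hh : ∀ k, ContDiff ℝ ∞ (h k)) (c : EuclideanSpace ℝ (Fin N))
    (x b : Plane) : ∑ k, c k • (curveField h k (x, b)).1 = J (gradient (stream h c) x) := by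
  simp [curveField, gradient_stream hh]

theorem affine_curveField_snd (hh : ∀ k, ContDiff ℝ ∞ (h k)) (c : EuclideanSpace ℝ (Fin N))
    (x b : Plane) : ∑ k, c k • (curveField h k (x, b)).2 = J (hess (stream h c) x b) := by
  simp [curveField, hess_stream hh]

theorem IsState.isTraj (hh : ∀ k, ContDiff ℝ ∞ (h k)) (H : IsState Ω h γ₀ T u X a) {s : ℝ}
    (hs : s ∈ Icc (0 : ℝ) 1) :
    IsTraj (curveField h) T u (γ₀ s, derivWithin γ₀ (Icc 0 1) s) (fun t => (X t s, a t s)) := by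
  rw [isTraj_prod_iff (fun k => (contDiff_curveField hh k).continuous) (integrableOn_control u)]
  refine ⟨⟨continuousOn_slice H.continuous_X hs, continuousOn_slice H.continuous_a hs⟩,
    fun t ht => ?_⟩
  simp_rw [affine_curveField_fst hh, affine_curveField_snd hh]
  exact ⟨H.eq_X t ht s hs, H.eq_a t ht s hs⟩

theorem isState_of_isTraj (hh : ∀ k, ContDiff ℝ ∞ (h k))
    (hX : ContinuousOn (fun z : ℝ × ℝ => X z.1 z.2) (Icc 0 T ×ˢ Icc 0 1))
    (ha : ContinuousOn (fun z : ℝ × ℝ => a z.1 z.2) (Icc 0 T ×ˢ Icc 0 1))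
    (hcl : ∀ t ∈ Icc 0 T, ∀ s ∈ Icc (0 : ℝ) 1, X t s ∈ closure Ω)
    (H : ∀ s ∈ Icc (0 : ℝ) 1, IsTraj (curveField h) T u (γ₀ s, derivWithin γ₀ (Icc 0 1) s)
      (fun t => (X t s, a t s))) : IsState Ω h γ₀ T u X a := by
  have key := fun s (hs : s ∈ Icc (0 : ℝ) 1) => ((isTraj_prod_iff
    (fun k => (contDiff_curveField hh k).continuous) (integrableOn_control u)).1 (H s hs)).2
  simp_rw [affine_curveField_fst hh, affine_curveField_snd hh] at key
  exact ⟨hX, ha, hcl, fun t ht s hs => (key s hs t ht).1, fun t ht s hs => (key s hs t ht).2⟩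

theorem curveField_congr {k : Fin N} {x : Plane} (hx : f k =ᶠ[𝓝 x] h k) (b : Plane) :
    curveField f k (x, b) = curveField h k (x, b) := by
  have h1 := Filter.EventuallyEq.gradient_eventuallyEq hx
  simp only [curveField, hess, h1.eq_of_nhds, h1.fderiv_eq]

/-- The system is solved for compactly supported replacements of the `hₖ`. The first component
follows a flow tangent to the boundary, so it stays in `closure Ω`, where the replaced fields equal
the original ones. -/
theorem exists_isState (hT : 0 < T) (hΩ : IsC2Domain Ω) (hh : ∀ k, ContDiff ℝ ∞ (h k))
    (hH10 : ∀ k, MemH10 Ω (h k)) (hγc : ContinuousOn γ₀ (Icc 0 1))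
    (hγ_mem : ∀ s ∈ Icc (0 : ℝ) 1, γ₀ s ∈ closure Ω) (hγ : MemW2Infty γ₀) (u : ControlSpace N T) :
    ∃ X a, IsState Ω h γ₀ T u X a := by
  obtain ⟨f, hf, hfs, hfh⟩ := exists_compactSupport_extension hΩ.isBounded hh
  have hu := integrableOn_control u
  have hF1 : ∀ k, ContDiff ℝ 1 (curveField f k) := fun k =>
    (contDiff_curveField hf k).of_le (by norm_num)
  obtain ⟨C, hC0, hC⟩ := exists_growth_curveField hf hfs
  set ζ : ℝ → Plane × Plane := fun s => (γ₀ s, derivWithin γ₀ (Icc 0 1) s)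
  have hζ : ContinuousOn ζ (Icc 0 1) := hγc.prodMk (hγ.continuousOn_derivWithin hγc)
  choose Z hZ using fun s => exists_isTraj_of_growth hT.le hF1 hC0 hC hu (ζ s)
  have hZc := continuousOn_prod_of_isTraj hF1 hC0 hC hu hζ (Z := fun t s => Z s t) fun s _ => hZ s
  have hcl : ∀ t ∈ Icc 0 T, ∀ s ∈ Icc (0 : ℝ) 1, (Z s t).1 ∈ closure Ω := by
    intro t ht s hs
    have h1 := (hZ s).map (ContinuousLinearMap.fst ℝ Plane Plane)
      (G := fun k x => J (gradient (f k) x)) (fun k => (hF1 k).continuous) hu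
      fun k t _ => by simp [curveField]
    refine h1.mem_closure hT.le hΩ (fun k => (hf k).of_le two_le_infty) hfs
      (fun k x hx => ?_) hu (hγ_mem s hs) t ht
    rw [(hfh k x (frontier_subset_closure hx)).eq_of_nhds]
    exact (hH10 k).eq_zero_of_mem_frontier hΩ (hh k).continuous hx
  refine ⟨fun t s => (Z s t).1, fun t s => (Z s t).2, isState_of_isTraj hh
    (continuous_fst.comp_continuousOn hZc) (continuous_snd.comp_continuousOn hZc) hcl
    fun s hs => ?_⟩
  exact (hZ s).congr_field fun k t ht => curveField_congr (hfh k _ (hcl t ht s hs)) _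

theorem IsState.unique (hh : ∀ k, ContDiff ℝ ∞ (h k)) {X' a' : ℝ → ℝ → Plane}
    (H : IsState Ω h γ₀ T u X a) (H' : IsState Ω h γ₀ T u X' a') :
    ∀ t ∈ Icc 0 T, ∀ s ∈ Icc (0 : ℝ) 1, X t s = X' t s ∧ a t s = a' t s := by
  intro t ht s hs
  have := (H.isTraj hh hs).unique (fun k => (contDiff_curveField hh k).of_le (by norm_num))
    (integrableOn_control u) (H'.isTraj hh hs) t ht
  exact Prod.ext_iff.1 this

/-- Uniqueness makes the chosen state irrelevant: the cost depends on `a` only through `a T s` with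
`s ∈ [0, 1]`. -/
theorem reducedCost_eq (hT : 0 < T) (hh : ∀ k, ContDiff ℝ ∞ (h k)) {lam : ℝ}
    (H : IsState Ω h γ₀ T u X a) :
    reducedCost Ω h γ₀ T lam ε u = cost Ω h T lam ε u a := by
  have hex : ∃ Xa : (ℝ → ℝ → Plane) × (ℝ → ℝ → Plane), IsState Ω h γ₀ T u Xa.1 Xa.2 :=
    ⟨(X, a), H⟩
  rw [reducedCost, dif_pos hex, cost, cost]
  congr 2
  refine intervalIntegral.integral_congr fun s hs => ?_
  rw [uIcc_of_le zero_le_one] at hs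
  simp only [(hex.choose_spec.unique hh H T ⟨hT.le, le_rfl⟩ s hs).2]

/-- A pair of plane vectors as a linear functional on pairs of plane vectors. -/
def pairing : Plane × Plane →L[ℝ] (Plane × Plane →L[ℝ] ℝ) :=
  LinearMap.toContinuousLinearMap
    { toFun := fun m => (innerSL ℝ m.1).comp (ContinuousLinearMap.fst ℝ Plane Plane)
        + (innerSL ℝ m.2).comp (ContinuousLinearMap.snd ℝ Plane Plane)
      map_add' := fun m m' => by
        ext w <;> simp
      map_smul' := fun c m => by
        ext w <;> simp }

theorem pairing_apply (m w : Plane × Plane) :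
    pairing m w = inner ℝ m.1 w.1 + inner ℝ m.2 w.2 := by
  simp [pairing]

theorem pairing_injective : Function.Injective pairing := by
  intro m m' hm
  have h1 : ∀ w, pairing m w = pairing m' w := fun w => by rw [hm]
  simp only [pairing_apply] at h1
  refine Prod.ext (ext_inner_right ℝ fun v => ?_) (ext_inner_right ℝ fun v => ?_)
  · simpa using h1 (v, 0)
  · simpa using h1 (0, v)

/-- The pair of plane vectors that represents a linear functional. -/
def unpair (r : Plane × Plane →L[ℝ] ℝ) : Plane × Plane :=
  ((InnerProductSpace.toDual ℝ Plane).symm (r ∘L ContinuousLinearMap.inl ℝ Plane Plane),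
    (InnerProductSpace.toDual ℝ Plane).symm (r ∘L ContinuousLinearMap.inr ℝ Plane Plane))

theorem continuous_unpair : Continuous unpair := by
  unfold unpair
  have h1 := (InnerProductSpace.toDual ℝ Plane).symm.continuous
  exact (h1.comp (continuous_id.clm_comp continuous_const)).prodMk
    (h1.comp (continuous_id.clm_comp continuous_const))

theorem pairing_unpair (r : Plane × Plane →L[ℝ] ℝ) : pairing (unpair r) = r := by
  refine ContinuousLinearMap.ext fun w => ?_
  rw [pairing_apply, unpair, InnerProductSpace.toDual_symm_apply,
    InnerProductSpace.toDual_symm_apply]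
  simp only [ContinuousLinearMap.comp_apply, ← map_add]
  simp

theorem pairing_affine_curveField (hh : ∀ k, ContDiff ℝ ∞ (h k)) (c : EuclideanSpace ℝ (Fin N))
    (t s : ℝ) : pairing (p t s, q t s) (affineField (curveField h) c (X t s, a t s))
      = density (stream h c) X a p q t s := by
  rw [pairing_apply, affineField, Prod.fst_sum, Prod.snd_sum, density]
  simp only [Prod.smul_fst, Prod.smul_snd, affine_curveField_fst hh, affine_curveField_snd hh]

theorem density_stream (hh : ∀ k, ContDiff ℝ ∞ (h k)) (c : EuclideanSpace ℝ (Fin N)) (t s : ℝ) :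
    density (stream h c) X a p q t s = ∑ k, c k * density (h k) X a p q t s := by
  rw [← pairing_affine_curveField hh, affineField, map_sum]
  refine Finset.sum_congr rfl fun k _ => ?_
  rw [map_smul, smul_eq_mul, pairing_apply]
  rfl

end Translation

/-! ### The adjoint system as a costate equation -/

section AdjointTranslation

variable {N : ℕ} {Ω : Set Plane} {h : Fin N → Plane → ℝ} {γ₀ : ℝ → Plane} {T ε : ℝ}
  {u : ControlSpace N T} {X a p q : ℝ → ℝ → Plane}

/-- The right-hand side of the adjoint system for a single stream function. -/
def adjointField (f : Plane → ℝ) (x b m n : Plane) : Plane × Plane :=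
  (ContinuousLinearMap.adjoint (J ∘L hess f x) m + ContinuousLinearMap.adjoint (J ∘L third f x b) n,
    ContinuousLinearMap.adjoint (J ∘L hess f x) n)

/-- The Jacobian of `curveField` is block triangular, with `J∇²h` on the diagonal and `J∇³h[·, a]`
below it. Transposition moves the third derivative into the equation for `p`. -/
theorem pairing_adjointField (hh : ∀ k, ContDiff ℝ ∞ (h k)) (k : Fin N) (x b m n : Plane) :
    pairing (adjointField (h k) x b m n)
      = pairing (m, n) ∘L fderiv ℝ (curveField h k) (x, b) := by
  refine ContinuousLinearMap.ext fun w => ?_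
  simp only [pairing_apply, adjointField, ContinuousLinearMap.comp_apply, fderiv_curveField hh,
    inner_add_left, inner_add_right, ContinuousLinearMap.adjoint_inner_left]
  ring

theorem sum_adjointField (hh : ∀ k, ContDiff ℝ ∞ (h k)) (c : EuclideanSpace ℝ (Fin N))
    (x b m n : Plane) :
    ∑ k, c k • adjointField (h k) x b m n = adjointField (stream h c) x b m n := by
  refine Prod.ext (ext_inner_right ℝ fun v => ?_) (ext_inner_right ℝ fun v => ?_)
  · simp only [Prod.fst_sum, Prod.smul_fst, adjointField, sum_inner, inner_smul_left,
      inner_add_left, ContinuousLinearMap.adjoint_inner_left, ContinuousLinearMap.comp_apply,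
      hess_stream hh, third_stream hh, _root_.sum_apply, _root_.smul_apply, map_sum,
      map_smul, inner_sum, inner_smul_right, ← Finset.sum_add_distrib]
    exact Finset.sum_congr rfl fun k _ => by simp [mul_add]
  · simp only [Prod.snd_sum, Prod.smul_snd, adjointField, sum_inner, inner_smul_left,
      ContinuousLinearMap.adjoint_inner_left, ContinuousLinearMap.comp_apply,
      hess_stream hh, _root_.sum_apply, _root_.smul_apply, map_sum,
      map_smul, inner_sum, inner_smul_right]
    exact Finset.sum_congr rfl fun k _ => by simp

/-- The terminal cost of a single curve point. -/
def terminalCost (ε : ℝ) (w : Plane × Plane) : ℝ := -ell ε w.2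

theorem contDiff_ell (hε : 0 < ε) : ContDiff ℝ ∞ (ell ε) := by
  unfold ell
  refine ContDiff.sqrt ((contDiff_norm_sq ℝ).add contDiff_const) fun z => ?_
  positivity

theorem contDiff_terminalCost (hε : 0 < ε) : ContDiff ℝ ∞ (terminalCost ε) :=
  ((contDiff_ell hε).comp contDiff_snd).neg

/-- Explains the terminal values `p = 0` and `q = -∇ℓ_ε(a)`: the terminal cost does not depend on
the point, only on the tangent vector. -/
theorem fderiv_terminalCost (hε : 0 < ε) (w : Plane × Plane) :
    fderiv ℝ (terminalCost ε) w = pairing (0, -gradient (ell ε) w.2) := by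
  have h1 : HasFDerivAt (ell ε) (fderiv ℝ (ell ε) w.2) w.2 :=
    ((contDiff_ell hε).differentiable (by simp) w.2).hasFDerivAt
  have h2 : HasFDerivAt (terminalCost ε) _ w :=
    (HasFDerivAt.comp (g := ell ε) w h1 hasFDerivAt_snd).neg
  rw [h2.fderiv]
  refine ContinuousLinearMap.ext fun v => ?_
  rw [pairing_apply]
  simp [gradient, InnerProductSpace.toDual_symm_apply]

/-- The dictionary between the two integrated adjoint equations and the single costate equation;
used in one direction for uniqueness and in the other for existence. -/
theorem pairing_integral (hh : ∀ k, ContDiff ℝ ∞ (h k)) (hε : 0 < ε) {s : ℝ}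
    (hX : ContinuousOn (fun t => X t s) (Icc 0 T)) (ha : ContinuousOn (fun t => a t s) (Icc 0 T))
    (hp : ContinuousOn (fun t => p t s) (Icc 0 T)) (hq : ContinuousOn (fun t => q t s) (Icc 0 T))
    {t : ℝ} (ht : t ∈ Icc 0 T) :
    pairing (∫ τ in t..T,
        (ContinuousLinearMap.adjoint (J ∘L hess (stream h (u τ)) (X τ s)) (p τ s)
          + ContinuousLinearMap.adjoint (J ∘L third (stream h (u τ)) (X τ s) (a τ s)) (q τ s)),
      - gradient (ell ε) (a T s)
        + ∫ τ in t..T, ContinuousLinearMap.adjoint (J ∘L hess (stream h (u τ)) (X τ s)) (q τ s))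
      = fderiv ℝ (terminalCost ε) (X T s, a T s)
        + ∫ τ in t..T, ∑ k, u τ k •
          (pairing (p τ s, q τ s) ∘L fderiv ℝ (curveField h k) (X τ s, a τ s)) := by
  have hT : T ∈ Icc 0 T := ⟨ht.1.trans ht.2, le_rfl⟩
  -- Continuity is read off from the Jacobian form through `unpair`, which avoids treating the
  -- adjoints separately.
  have hcont : ∀ k, ContinuousOn
      (fun τ => adjointField (h k) (X τ s) (a τ s) (p τ s) (q τ s)) (Icc 0 T) := by
    intro k
    have h1 : ContinuousOn (fun τ => pairing (p τ s, q τ s) ∘L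
        fderiv ℝ (curveField h k) (X τ s, a τ s)) (Icc 0 T) :=
      (pairing.continuous.comp_continuousOn (hp.prodMk hq)).clm_comp
        (((contDiff_curveField hh k).continuous_fderiv (by norm_num)).comp_continuousOn
          (hX.prodMk ha))
    refine (continuous_unpair.comp_continuousOn h1).congr fun τ _ => pairing_injective ?_
    rw [Function.comp_apply, pairing_unpair, pairing_adjointField hh]
  have hi := intervalIntegrable_of_Icc (integrableOn_sum_smul (integrableOn_control u) hcont) ht hT
  simp_rw [← pairing_adjointField hh, ← map_smul, ← map_sum]
  rw [pairing.intervalIntegral_comp_comm hi, fderiv_terminalCost hε, ← map_add]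
  have h1 := (ContinuousLinearMap.fst ℝ Plane Plane).intervalIntegral_comp_comm hi
  have h2 := (ContinuousLinearMap.snd ℝ Plane Plane).intervalIntegral_comp_comm hi
  simp only [ContinuousLinearMap.coe_fst', ContinuousLinearMap.coe_snd', sum_adjointField hh]
    at h1 h2
  congr 1
  refine Prod.ext ?_ ?_
  · rw [Prod.fst_add, zero_add]
    simp only [sum_adjointField hh]
    rw [← h1]
    rfl
  · rw [Prod.snd_add]
    simp only [sum_adjointField hh]
    rw [← h2]
    rfl

theorem IsAdjoint.isCostate (hh : ∀ k, ContDiff ℝ ∞ (h k)) (hε : 0 < ε)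
    (H : IsState Ω h γ₀ T u X a) (A : IsAdjoint h T ε u X a p q) {s : ℝ}
    (hs : s ∈ Icc (0 : ℝ) 1) :
    IsCostate (curveField h) T u (fun t => (X t s, a t s))
      (fderiv ℝ (terminalCost ε) (X T s, a T s)) (fun t => pairing (p t s, q t s)) := by
  have hp := continuousOn_slice A.continuous_p hs
  have hq := continuousOn_slice A.continuous_q hs
  refine ⟨pairing.continuous.comp_continuousOn (hp.prodMk hq), fun t ht => ?_⟩
  rw [← pairing_integral hh hε (continuousOn_slice H.continuous_X hs)
    (continuousOn_slice H.continuous_a hs) hp hq ht, ← A.eq_p t ht s hs, ← A.eq_q t ht s hs]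

theorem IsAdjoint.unique (hh : ∀ k, ContDiff ℝ ∞ (h k)) (hε : 0 < ε)
    (H : IsState Ω h γ₀ T u X a) (A : IsAdjoint h T ε u X a p q) {p' q' : ℝ → ℝ → Plane}
    (A' : IsAdjoint h T ε u X a p' q') :
    ∀ t ∈ Icc 0 T, ∀ s ∈ Icc (0 : ℝ) 1, p t s = p' t s ∧ q t s = q' t s := by
  intro t ht s hs
  have := (A.isCostate hh hε H hs).unique (contDiff_curveField hh) (integrableOn_control u)
    (H.isTraj hh hs) (A'.isCostate hh hε H hs) t ht
  exact Prod.ext_iff.1 (pairing_injective this)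

theorem exists_isAdjoint (hT : 0 < T) (hh : ∀ k, ContDiff ℝ ∞ (h k)) (hε : 0 < ε)
    (H : IsState Ω h γ₀ T u X a) : ∃ p q, IsAdjoint h T ε u X a p q := by
  have hZc := H.continuous_X.prodMk H.continuous_a
  have hTT : T ∈ Icc 0 T := ⟨hT.le, le_rfl⟩
  have hρ : ContinuousOn (fun s => fderiv ℝ (terminalCost ε) (X T s, a T s)) (Icc 0 1) :=
    ((contDiff_terminalCost hε).continuous_fderiv (by simp)).comp_continuousOn
      (continuousOn_slice' (Z := fun t s => (X t s, a t s)) hZc hTT)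
  obtain ⟨r, hrc, hr⟩ := exists_isCostate hT.le (contDiff_curveField hh) (integrableOn_control u)
    (Z := fun t s => (X t s, a t s)) (fun s hs => H.isTraj hh hs) hZc hρ
  have huc := continuous_unpair.comp_continuousOn hrc
  have hpc : ContinuousOn (fun z : ℝ × ℝ => (unpair (r z.1 z.2)).1) (Icc 0 T ×ˢ Icc 0 1) :=
    continuous_fst.comp_continuousOn huc
  have hqc : ContinuousOn (fun z : ℝ × ℝ => (unpair (r z.1 z.2)).2) (Icc 0 T ×ˢ Icc 0 1) :=
    continuous_snd.comp_continuousOn huc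
  have key : ∀ t ∈ Icc 0 T, ∀ s ∈ Icc (0 : ℝ) 1, _ := fun t ht s hs =>
    (((hr s hs).eq t ht).trans (by simp only [Prod.mk.eta, pairing_unpair])).trans
      (pairing_integral (u := u) (p := fun t s => (unpair (r t s)).1)
        (q := fun t s => (unpair (r t s)).2) hh hε (continuousOn_slice H.continuous_X hs)
        (continuousOn_slice H.continuous_a hs)
        (continuousOn_slice (Z := fun t s => (unpair (r t s)).1) hpc hs)
        (continuousOn_slice (Z := fun t s => (unpair (r t s)).2) hqc hs) ht).symm
  have key' := fun t ht s hs => Prod.ext_iff.1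
    (pairing_injective ((pairing_unpair (r t s)).trans (key t ht s hs)))
  exact ⟨_, _, hpc, hqc, fun t ht s hs => (key' t ht s hs).1, fun t ht s hs => (key' t ht s hs).2⟩

end AdjointTranslation

/-! ### The quadratic control energy and norms of controls -/

section Energy

variable {N : ℕ} {Ω : Set Plane} {h : Fin N → Plane → ℝ} {T : ℝ}

/-- The Gram matrix as a linear map of the Euclidean space. -/
def gramOp (Ω : Set Plane) (h : Fin N → Plane → ℝ) :
    EuclideanSpace ℝ (Fin N) →L[ℝ] EuclideanSpace ℝ (Fin N) :=
  Matrix.toEuclideanCLM (n := Fin N) (𝕜 := ℝ) (gram Ω h)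

theorem gramOp_apply (c : EuclideanSpace ℝ (Fin N)) (k : Fin N) :
    gramOp Ω h c k = (gram Ω h *ᵥ c.ofLp) k := by
  simp [gramOp, Matrix.ofLp_toEuclideanCLM]

theorem inner_gramOp (c d : EuclideanSpace ℝ (Fin N)) :
    inner ℝ (gramOp Ω h c) d = (gram Ω h *ᵥ c.ofLp) ⬝ᵥ d.ofLp := by
  rw [real_inner_comm, gramOp, Matrix.inner_toEuclideanCLM, dotProduct_comm]

theorem gram_comm (k l : Fin N) : gram Ω h k l = gram Ω h l k := by
  simp only [gram, Matrix.of_apply, mul_comm]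

theorem inner_gramOp_comm (c d : EuclideanSpace ℝ (Fin N)) :
    inner ℝ (gramOp Ω h c) d = inner ℝ (gramOp Ω h d) c := by
  simp only [inner_gramOp, dotProduct, Matrix.mulVec, Finset.sum_mul]
  rw [Finset.sum_comm]
  refine Finset.sum_congr rfl fun k _ => Finset.sum_congr rfl fun l _ => ?_
  rw [gram_comm l k]
  ring

theorem integral_stream_sq (hΩ : Bornology.IsBounded Ω) (hh : ∀ k, Continuous (h k))
    (c : EuclideanSpace ℝ (Fin N)) :
    ∫ x in Ω, stream h c x ^ 2 = inner ℝ (gramOp Ω h c) c := by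
  have hint : ∀ k l, IntegrableOn (fun x => c l * (h k x * h l x) * c k) Ω := fun k l =>
    (((continuous_const.mul ((hh k).mul (hh l))).mul
      continuous_const).continuousOn.integrableOn_compact hΩ.isCompact_closure).mono_set subset_closure
  have h1 : ∀ x, stream h c x ^ 2 = ∑ k, ∑ l, c l * (h k x * h l x) * c k := fun x => by
    rw [stream, sq, Finset.sum_mul_sum]
    exact Finset.sum_congr rfl fun k _ => Finset.sum_congr rfl fun l _ => by ring
  simp only [h1]
  rw [integral_finsetSum _ fun k _ => integrable_finsetSum _ fun l _ => hint k l, inner_gramOp]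
  simp only [dotProduct, Matrix.mulVec, Finset.sum_mul]
  refine Finset.sum_congr rfl fun k _ => ?_
  rw [integral_finsetSum _ fun l _ => hint k l]
  refine Finset.sum_congr rfl fun l _ => ?_
  rw [integral_mul_const, integral_const_mul, gram, Matrix.of_apply]
  ring

/-- The Gram matrix acting pointwise on controls. -/
def gramLp (Ω : Set Plane) (h : Fin N → Plane → ℝ) (T : ℝ) :
    ControlSpace N T →L[ℝ] ControlSpace N T :=
  (gramOp Ω h).compLpL 2 (volume.restrict (Ioo (0 : ℝ) T))

theorem coeFn_gramLp (u : ControlSpace N T) :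
    ∀ᵐ t ∂(volume.restrict (Ioo (0 : ℝ) T)), gramLp Ω h T u t = gramOp Ω h (u t) :=
  ContinuousLinearMap.coeFn_compLpL _ u

theorem integrableOn_inner_gramOp (u v : ControlSpace N T) :
    IntegrableOn (fun t => inner ℝ (gramOp Ω h (u t)) (v t)) (Ioo 0 T) :=
  (L2.integrable_inner (𝕜 := ℝ) (gramLp Ω h T u) v).congr <| by
    filter_upwards [coeFn_gramLp (Ω := Ω) (h := h) u] with t ht
    rw [ht]

theorem intervalIntegral_eq_Ioo {f : ℝ → ℝ} (hT : 0 ≤ T) :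
    ∫ t in (0 : ℝ)..T, f t = ∫ t in Ioo (0 : ℝ) T, f t := by
  rw [intervalIntegral.integral_of_le hT, integral_Ioc_eq_integral_Ioo]

theorem inner_gramLp (hT : 0 ≤ T) (u v : ControlSpace N T) :
    inner ℝ (gramLp Ω h T u) v = ∫ t in (0 : ℝ)..T, inner ℝ (gramOp Ω h (u t)) (v t) := by
  rw [L2.inner_def, intervalIntegral_eq_Ioo hT]
  refine integral_congr_ae ?_
  filter_upwards [coeFn_gramLp (Ω := Ω) (h := h) u] with t ht
  rw [ht]

theorem inner_gramLp_comm (hT : 0 ≤ T) (u v : ControlSpace N T) :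
    inner ℝ (gramLp Ω h T u) v = inner ℝ (gramLp Ω h T v) u := by
  simp only [inner_gramLp hT, inner_gramOp_comm]

theorem cost_eq (hT : 0 ≤ T) (hΩ : Bornology.IsBounded Ω) (hh : ∀ k, Continuous (h k))
    {lam ε : ℝ} (u : ControlSpace N T) (a : ℝ → ℝ → Plane) :
    cost Ω h T lam ε u a
      = -(∫ s in (0 : ℝ)..1, ell ε (a T s)) + lam / 2 * inner ℝ (gramLp Ω h T u) u := by
  rw [cost, inner_gramLp hT]
  simp only [integral_stream_sq hΩ hh]

/-- By symmetry the remainder is exactly the quadratic form at `v - u`. -/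
theorem energy_expansion (hT : 0 ≤ T) (u v : ControlSpace N T) :
    |inner ℝ (gramLp Ω h T v) v - inner ℝ (gramLp Ω h T u) u
      - 2 * inner ℝ (gramLp Ω h T u) (v - u)| ≤ ‖gramLp Ω h T‖ * ‖v - u‖ ^ 2 := by
  have h1 : inner ℝ (gramLp Ω h T v) v - inner ℝ (gramLp Ω h T u) u
      - 2 * inner ℝ (gramLp Ω h T u) (v - u) = inner ℝ (gramLp Ω h T (v - u)) (v - u) := by
    simp only [map_sub, inner_sub_left, inner_sub_right, inner_gramLp_comm hT v u]
    ring
  rw [h1, sq, ← mul_assoc]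
  exact (abs_real_inner_le_norm _ _).trans
    (mul_le_mul_of_nonneg_right (ContinuousLinearMap.le_opNorm _ _) (norm_nonneg _))

/-- Cauchy–Schwarz, obtained by integrating the square of the deviation of `‖δ t‖` from its mean `I
/ T`. -/
theorem sq_integral_norm_le (hT : 0 < T) (δ : ControlSpace N T) :
    (∫ t in (0 : ℝ)..T, ‖δ t‖) ^ 2 ≤ T * ‖δ‖ ^ 2 := by
  have hI : ‖δ‖ ^ 2 = ∫ t in (0 : ℝ)..T, ‖δ t‖ ^ 2 := by
    rw [← real_inner_self_eq_norm_sq, L2.inner_def, intervalIntegral_eq_Ioo hT.le]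
    simp only [real_inner_self_eq_norm_sq]
  have h1 : IntervalIntegrable (fun t => ‖δ t‖) volume 0 T :=
    intervalIntegrable_of_Icc (integrableOn_control δ).norm ⟨le_rfl, hT.le⟩ ⟨hT.le, le_rfl⟩
  have h2 : IntervalIntegrable (fun t => ‖δ t‖ ^ 2) volume 0 T := by
    refine intervalIntegrable_of_Icc ?_ ⟨le_rfl, hT.le⟩ ⟨hT.le, le_rfl⟩
    rw [integrableOn_Icc_iff_integrableOn_Ioo (by simp) (by simp)]
    exact (Lp.memLp δ).integrable_norm_pow (by norm_num)
  set I := ∫ t in (0 : ℝ)..T, ‖δ t‖ with hIdef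
  have h3 : 0 ≤ ∫ t in (0 : ℝ)..T, (‖δ t‖ - I / T) ^ 2 :=
    intervalIntegral.integral_nonneg hT.le fun t _ => sq_nonneg _
  have h4 : ∫ t in (0 : ℝ)..T, (‖δ t‖ - I / T) ^ 2
      = ‖δ‖ ^ 2 - 2 * (I / T) * I + (I / T) ^ 2 * T := by
    have h5 : ∀ t, (‖δ t‖ - I / T) ^ 2 = ‖δ t‖ ^ 2 - 2 * (I / T) * ‖δ t‖ + (I / T) ^ 2 :=
      fun t => by ring
    simp only [h5]
    rw [intervalIntegral.integral_add (h2.sub (h1.const_mul _)) intervalIntegrable_const,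
      intervalIntegral.integral_sub h2 (h1.const_mul _), intervalIntegral.integral_const_mul, ← hI,
      ← hIdef, intervalIntegral.integral_const]
    simp only [smul_eq_mul]
    ring
  rw [h4] at h3
  have h6 : ‖δ‖ ^ 2 - 2 * (I / T) * I + (I / T) ^ 2 * T = (T * ‖δ‖ ^ 2 - I ^ 2) / T := by
    field_simp
    ring
  rw [h6] at h3
  have := mul_nonneg h3 hT.le
  rw [div_mul_cancel₀ _ hT.ne'] at this
  linarith

theorem integral_norm_le (hT : 0 < T) (δ : ControlSpace N T) :
    ∫ t in (0 : ℝ)..T, ‖δ t‖ ≤ √T * ‖δ‖ := by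
  refine le_of_abs_le (abs_le_of_sq_le_sq ?_ (by positivity))
  rw [mul_pow, Real.sq_sqrt hT.le]
  exact sq_integral_norm_le hT δ

end Energy

/-! ### Integrability of the density and its representation in the control space -/

section Density

variable {N : ℕ} {Ω : Set Plane} {h : Fin N → Plane → ℝ} {γ₀ : ℝ → Plane} {T ε : ℝ}
  {u : ControlSpace N T} {X a p q : ℝ → ℝ → Plane}

theorem continuousOn_density {f : Plane → ℝ} (hf : ContDiff ℝ ∞ f) (H : IsState Ω h γ₀ T u X a)
    (A : IsAdjoint h T ε u X a p q) :
    ContinuousOn (fun z : ℝ × ℝ => density f X a p q z.1 z.2) (Icc 0 T ×ˢ Icc 0 1) := by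
  have h1 : Continuous (gradient f) :=
    (contDiff_gradient (m := 0) hf (by simp)).continuous
  have h2 : Continuous (hess f) := (contDiff_hess hf).continuous
  unfold density
  exact (A.continuous_p.inner (J.continuous.comp_continuousOn
    (h1.comp_continuousOn H.continuous_X))).add (A.continuous_q.inner (J.continuous.comp_continuousOn
      ((h2.comp_continuousOn H.continuous_X).clm_apply H.continuous_a)))

theorem integrableOn_density_stream (hh : ∀ k, ContDiff ℝ ∞ (h k)) (H : IsState Ω h γ₀ T u X a)
    (A : IsAdjoint h T ε u X a p q) (δ : ControlSpace N T) :
    IntegrableOn (fun z : ℝ × ℝ => density (stream h (δ z.1)) X a p q z.1 z.2)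
      (Icc 0 T ×ˢ Icc 0 1) := by
  simp only [density_stream hh]
  refine integrable_finsetSum _ fun k _ => ?_
  have h1 : IntegrableOn (fun z : ℝ × ℝ => δ z.1 k) (Icc 0 T ×ˢ Icc (0 : ℝ) 1) := by
    rw [IntegrableOn, Measure.volume_eq_prod, ← Measure.prod_restrict]
    exact Integrable.comp_fst (integrableOn_coord (integrableOn_control δ) k) _
  exact h1.mul_continuousOn_of_subset (continuousOn_density (hh k) H A)
    (measurableSet_Icc.prod measurableSet_Icc) (isCompact_Icc.prod isCompact_Icc) subset_rfl

theorem integral_density_swap (hT : 0 ≤ T) (hh : ∀ k, ContDiff ℝ ∞ (h k))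
    (H : IsState Ω h γ₀ T u X a) (A : IsAdjoint h T ε u X a p q) (δ : ControlSpace N T) :
    ∫ t in (0 : ℝ)..T, ∫ s in (0 : ℝ)..1, density (stream h (δ t)) X a p q t s
      = ∫ s in (0 : ℝ)..1, ∫ t in (0 : ℝ)..T, density (stream h (δ t)) X a p q t s := by
  refine intervalIntegral_intervalIntegral_swap ?_
  rw [uIoc_of_le hT, uIoc_of_le zero_le_one]
  exact (integrableOn_density_stream hh H A δ).mono_set
    (prod_mono Ioc_subset_Icc_self Ioc_subset_Icc_self)

theorem intervalIntegrable_integral_density (hT : 0 ≤ T) (hh : ∀ k, ContDiff ℝ ∞ (h k))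
    (H : IsState Ω h γ₀ T u X a) (A : IsAdjoint h T ε u X a p q) (δ : ControlSpace N T) :
    IntervalIntegrable (fun s => ∫ t in (0 : ℝ)..T, density (stream h (δ t)) X a p q t s)
      volume 0 1 := by
  rw [intervalIntegrable_iff_integrableOn_Ioc_of_le zero_le_one]
  simp only [intervalIntegral.integral_of_le hT]
  refine Integrable.integral_prod_right
    (f := fun z : ℝ × ℝ => density (stream h (δ z.1)) X a p q z.1 z.2) ?_
  rw [Measure.prod_restrict, ← Measure.volume_eq_prod]
  exact (integrableOn_density_stream hh H A δ).mono_set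
    (prod_mono Ioc_subset_Icc_self Ioc_subset_Icc_self)

theorem intervalIntegrable_density (hh : ∀ k, ContDiff ℝ ∞ (h k))
    (H : IsState Ω h γ₀ T u X a) (A : IsAdjoint h T ε u X a p q) (k : Fin N) {t : ℝ}
    (ht : t ∈ Icc 0 T) : IntervalIntegrable (density (h k) X a p q t) volume 0 1 := by
  refine ContinuousOn.intervalIntegrable ?_
  rw [uIcc_of_le zero_le_one]
  exact continuousOn_slice' (Z := density (h k) X a p q) (continuousOn_density (hh k) H A) ht

/-- The field `t ↦ (∫₀¹ [p · J∇hₖ + q · J∇²hₖ a] ds)ₖ`. -/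
def densityVec (h : Fin N → Plane → ℝ) (X a p q : ℝ → ℝ → Plane) (t : ℝ) :
    EuclideanSpace ℝ (Fin N) :=
  WithLp.toLp 2 fun k => ∫ s in (0 : ℝ)..1, density (h k) X a p q t s

theorem memLp_densityVec (hh : ∀ k, ContDiff ℝ ∞ (h k)) (H : IsState Ω h γ₀ T u X a)
    (A : IsAdjoint h T ε u X a p q) :
    MemLp (densityVec h X a p q) 2 (volume.restrict (Ioo (0 : ℝ) T)) := by
  refine MemLp.of_eval_piLp fun k => ?_
  have hc := continuousOn_density (hh k) H A
  obtain ⟨B, hB⟩ := (isCompact_Icc.prod isCompact_Icc).exists_bound_of_continuousOn hc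
  refine MemLp.of_bound (C := B) ?_ ?_
  · have h1 : AEStronglyMeasurable (fun z : ℝ × ℝ => density (h k) X a p q z.1 z.2)
        ((volume.restrict (Ioo (0 : ℝ) T)).prod (volume.restrict (Ioc (0 : ℝ) 1))) := by
      rw [Measure.prod_restrict, ← Measure.volume_eq_prod]
      exact (hc.mono (prod_mono Ioo_subset_Icc_self Ioc_subset_Icc_self)).aestronglyMeasurable
        (measurableSet_Ioo.prod measurableSet_Ioc)
    have h2 := h1.integral_prod_right'
    simpa only [densityVec, intervalIntegral.integral_of_le zero_le_one] using h2
  · refine (ae_restrict_iff' measurableSet_Ioo).2 (ae_of_all _ fun t ht => ?_)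
    have h3 := intervalIntegral.norm_integral_le_of_norm_le_const (a := 0) (b := 1) (C := B)
      (f := fun s => density (h k) X a p q t s) fun s hs => by
        rw [uIoc_of_le zero_le_one] at hs
        exact hB (t, s) ⟨Ioo_subset_Icc_self ht, Ioc_subset_Icc_self hs⟩
    simpa [densityVec] using h3

/-- The density is linear in the stream function, so the double integral is an `L²` pairing with
`densityVec`, the candidate gradient of the terminal cost. -/
theorem inner_densityVec (hT : 0 ≤ T) (hh : ∀ k, ContDiff ℝ ∞ (h k)) (H : IsState Ω h γ₀ T u X a)
    (A : IsAdjoint h T ε u X a p q) (δ : ControlSpace N T) :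
    inner ℝ ((memLp_densityVec hh H A).toLp _) δ
      = ∫ t in (0 : ℝ)..T, ∫ s in (0 : ℝ)..1, density (stream h (δ t)) X a p q t s := by
  rw [L2.inner_def, intervalIntegral_eq_Ioo hT]
  refine integral_congr_ae ?_
  filter_upwards [(memLp_densityVec hh H A).coeFn_toLp, ae_restrict_mem measurableSet_Ioo]
    with t ht htT
  rw [ht]
  simp only [density_stream hh]
  rw [intervalIntegral.integral_finsetSum fun k _ =>
    (intervalIntegrable_density hh H A k (Ioo_subset_Icc_self htT)).const_mul _]
  simp only [intervalIntegral.integral_const_mul]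
  simp [densityVec, PiLp.inner_apply]

end Density

/-! ### Differentiability of the reduced cost -/

section Gradient

variable {N : ℕ} {Ω : Set Plane} {h : Fin N → Plane → ℝ} {γ₀ : ℝ → Plane} {T lam ε : ℝ}
  {u : ControlSpace N T} {X a p q : ℝ → ℝ → Plane}

/-- Each state also solves the system with compactly supported fields, whose growth constant is
independent of the control. The Gronwall bound then involves the control only through its `L¹` norm,
at most `√T * K`. -/
theorem exists_bound_isState (hT : 0 < T) (hΩ : IsC2Domain Ω) (hh : ∀ k, ContDiff ℝ ∞ (h k))
    (hγ₀ : ContinuousOn γ₀ (Icc 0 1)) (hγ₁ : ContinuousOn (derivWithin γ₀ (Icc 0 1)) (Icc 0 1))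
    (K : ℝ) : ∃ R : ℝ, ∀ (v : ControlSpace N T) (Y b : ℝ → ℝ → Plane), ‖v‖ ≤ K →
      IsState Ω h γ₀ T v Y b → ∀ t ∈ Icc 0 T, ∀ s ∈ Icc (0 : ℝ) 1, ‖(Y t s, b t s)‖ ≤ R := by
  obtain ⟨f, hf, hfs, hfh⟩ := exists_compactSupport_extension hΩ.isBounded hh
  obtain ⟨C, hC0, hC⟩ := exists_growth_curveField hf hfs
  obtain ⟨M, hM⟩ := exists_norm_bound_Icc (hγ₀.prodMk hγ₁)
  refine ⟨(1 + M) * Real.exp (2 * (N * C * (√T * K))), fun v Y b hv H t ht s hs => ?_⟩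
  have h1 : IsTraj (curveField f) T v (γ₀ s, derivWithin γ₀ (Icc 0 1) s)
      (fun t => (Y t s, b t s)) :=
    (H.isTraj hh hs).congr_field fun k t ht =>
      (curveField_congr (hfh k _ (H.mem_closure t ht s hs)) _).symm
  refine (h1.norm_le_of_growth hC0 hC (integrableOn_control v) t ht).trans ?_
  rw [intervalIntegral.integral_const_mul]
  have h2 := (integral_norm_le hT v).trans
    (mul_le_mul_of_nonneg_left hv (Real.sqrt_nonneg T))
  have h3 := hM s hs
  gcongr
  exact add_nonneg zero_le_one ((norm_nonneg _).trans h3)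

/-- `exists_expansion` is applied for each `s` with constants independent of `s`, integrated over
`s`, and rewritten by Fubini. The factor `T` comes from bounding the squared `L¹` norm by the
squared `L²` norm. -/
theorem terminal_expansion (hT : 0 < T) (hΩ : IsC2Domain Ω) (hh : ∀ k, ContDiff ℝ ∞ (h k))
    (hε : 0 < ε) (hγ₀ : ContinuousOn γ₀ (Icc 0 1))
    (hγ₁ : ContinuousOn (derivWithin γ₀ (Icc 0 1)) (Icc 0 1))
    (H : IsState Ω h γ₀ T u X a) (A : IsAdjoint h T ε u X a p q) :
    ∃ C : ℝ, 0 ≤ C ∧ ∀ (v : ControlSpace N T) (Y b : ℝ → ℝ → Plane), ‖v - u‖ ≤ 1 →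
      IsState Ω h γ₀ T v Y b →
      |-(∫ s in (0 : ℝ)..1, ell ε (b T s)) - -(∫ s in (0 : ℝ)..1, ell ε (a T s))
        - inner ℝ ((memLp_densityVec hh H A).toLp _) (v - u)| ≤ C * ‖v - u‖ ^ 2 := by
  obtain ⟨R, hR⟩ := exists_bound_isState hT hΩ hh hγ₀ hγ₁ (‖u‖ + 1)
  obtain ⟨P, hP⟩ := (isCompact_Icc.prod isCompact_Icc).exists_bound_of_continuousOn
    (pairing.continuous.comp_continuousOn (A.continuous_p.prodMk A.continuous_q))
  obtain ⟨C, hC0, hC⟩ := exists_expansion hT.le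
    (fun k => contDiff_curveField hh k) ((contDiff_terminalCost hε).of_le two_le_infty)
    (integrableOn_control u) R (abs_nonneg P)
  refine ⟨C * T, by positivity, fun v Y b hv HY => ?_⟩
  have hvK : ‖v‖ ≤ ‖u‖ + 1 := by
    have := norm_add_le u (v - u)
    rw [add_sub_cancel] at this
    linarith
  have hsub : ∀ᵐ t, t ∈ Ioo 0 T → (v - u : ControlSpace N T) t = v t - u t :=
    (ae_restrict_iff' measurableSet_Ioo).1 (Lp.coeFn_sub v u)
  have hT1 : T ∈ Icc 0 T := ⟨hT.le, le_rfl⟩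
  have hI : ∫ t in (0 : ℝ)..T, ‖v t - u t‖ = ∫ t in (0 : ℝ)..T, ‖(v - u : ControlSpace N T) t‖ := by
    rw [intervalIntegral_eq_Ioo hT.le, intervalIntegral_eq_Ioo hT.le]
    refine setIntegral_congr_ae measurableSet_Ioo ?_
    filter_upwards [hsub] with t ht hI
    rw [ht hI]
  have hpt : ∀ s ∈ Icc (0 : ℝ) 1, |-ell ε (b T s) - -ell ε (a T s)
      - ∫ t in (0 : ℝ)..T, density (stream h ((v - u : ControlSpace N T) t)) X a p q t s|
        ≤ C * T * ‖v - u‖ ^ 2 := by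
    intro s hs
    have h1 := hC v _ _ _ (fun t => pairing (p t s, q t s)) (integrableOn_control v)
      (H.isTraj hh hs) (HY.isTraj hh hs) (A.isCostate hh hε H hs)
      (fun t ht => hR u X a (by linarith) H t ht s hs) (fun t ht => hR v Y b hvK HY t ht s hs)
      (fun t ht => (hP (t, s) ⟨ht, hs⟩).trans (le_abs_self P))
    have h2 : ∫ t in (0 : ℝ)..T, pairing (p t s, q t s)
          (affineField (curveField h) (v t - u t) (X t s, a t s))
        = ∫ t in (0 : ℝ)..T, density (stream h ((v - u : ControlSpace N T) t)) X a p q t s := by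
      rw [intervalIntegral_eq_Ioo hT.le, intervalIntegral_eq_Ioo hT.le]
      refine setIntegral_congr_ae measurableSet_Ioo ?_
      filter_upwards [hsub] with t ht hI
      rw [pairing_affine_curveField hh, ht hI]
    rw [h2, hI] at h1
    refine h1.trans ?_
    rw [mul_assoc]
    exact mul_le_mul_of_nonneg_left (sq_integral_norm_le hT _) hC0
  have hell : ∀ {w : ControlSpace N T} {Z c : ℝ → ℝ → Plane}, IsState Ω h γ₀ T w Z c →
      IntervalIntegrable (fun s => -ell ε (c T s)) volume 0 1 := fun Hw => by
    refine ContinuousOn.intervalIntegrable ?_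
    rw [uIcc_of_le zero_le_one]
    exact ((contDiff_ell hε).continuous.comp_continuousOn
      (continuousOn_slice' Hw.continuous_a hT1)).neg
  rw [inner_densityVec hT.le hh H A, integral_density_swap hT.le hh H A,
    ← intervalIntegral.integral_neg, ← intervalIntegral.integral_neg,
    ← intervalIntegral.integral_sub (hell HY) (hell H),
    ← intervalIntegral.integral_sub ((hell HY).sub (hell H))
      (intervalIntegrable_integral_density hT.le hh H A _)]
  have h5 := intervalIntegral.norm_integral_le_of_norm_le_const (a := 0) (b := 1)
    (C := C * T * ‖v - u‖ ^ 2)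
    (f := fun s => -ell ε (b T s) - -ell ε (a T s)
      - ∫ t in (0 : ℝ)..T, density (stream h ((v - u : ControlSpace N T) t)) X a p q t s)
    fun s hs => by
      rw [uIoc_of_le zero_le_one] at hs
      exact hpt s (Ioc_subset_Icc_self hs)
  simpa using h5

theorem hasGradientAt_of_sq_le {E : Type*} [NormedAddCommGroup E] [InnerProductSpace ℝ E]
    [CompleteSpace E] {f : E → ℝ} {g x : E} {C : ℝ}
    (hf : ∀ y, ‖y - x‖ ≤ 1 → |f y - f x - inner ℝ g (y - x)| ≤ C * ‖y - x‖ ^ 2) :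
    HasGradientAt f g x := by
  rw [hasGradientAt_iff_isLittleO]
  have h1 : (fun y => f y - f x - inner ℝ g (y - x)) =O[𝓝 x] fun y => ‖y - x‖ ^ 2 := by
    refine Asymptotics.IsBigO.of_bound C ?_
    filter_upwards [Metric.closedBall_mem_nhds x zero_lt_one] with y hy
    rw [mem_closedBall_iff_norm] at hy
    simpa using hf y hy
  refine h1.trans_isLittleO ?_
  have h2 : Tendsto (fun y => y - x) (𝓝 x) (𝓝 0) := by
    simpa using (tendsto_id (x := 𝓝 x)).sub_const x
  exact (Asymptotics.isLittleO_norm_pow_id one_lt_two).comp_tendsto h2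

/-- Both parts of the cost have a first-order expansion with quadratic remainder; the factor `2`
from the energy cancels the half in `lam / 2`. -/
theorem hasGradientAt_reducedCost (hT : 0 < T) (hΩ : IsC2Domain Ω)
    (hh : ∀ k, ContDiff ℝ ∞ (h k)) (hH10 : ∀ k, MemH10 Ω (h k)) (hlam : 0 < lam)
    (hε : 0 < ε) (hγ₀ : ContinuousOn γ₀ (Icc 0 1)) (hγ_mem : ∀ s ∈ Icc (0 : ℝ) 1, γ₀ s ∈ closure Ω)
    (hγ : MemW2Infty γ₀) (H : IsState Ω h γ₀ T u X a) (A : IsAdjoint h T ε u X a p q) :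
    HasGradientAt (reducedCost Ω h γ₀ T lam ε)
      (lam • gramLp Ω h T u + (memLp_densityVec hh H A).toLp _) u := by
  obtain ⟨C, hC0, hC⟩ := terminal_expansion hT hΩ hh hε hγ₀
    (hγ.continuousOn_derivWithin hγ₀) H A
  refine hasGradientAt_of_sq_le (C := lam / 2 * ‖gramLp Ω h T‖ + C) fun v hv => ?_
  obtain ⟨Y, b, HY⟩ := exists_isState hT hΩ hh hH10 hγ₀ hγ_mem hγ v
  rw [reducedCost_eq hT hh H, reducedCost_eq hT hh HY, cost_eq hT.le hΩ.isBounded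
    (fun k => (hh k).continuous), cost_eq hT.le hΩ.isBounded (fun k => (hh k).continuous),
    inner_add_left, real_inner_smul_left]
  have h1 := abs_le.1 (hC v Y b hv HY)
  have h2 := mul_le_mul_of_nonneg_left (energy_expansion (Ω := Ω) (h := h) hT.le u v)
    (half_pos hlam).le
  rw [← abs_of_pos (half_pos hlam), ← abs_mul, abs_of_pos (half_pos hlam)] at h2
  have h3 := abs_le.1 h2
  rw [abs_le]
  constructor <;> linarith [h1.1, h1.2, h3.1, h3.2]

end Gradient

end InterfaceControl

end

theorem mainTheorem2
    (Ω : Set InterfaceControl.Plane) (hΩ : InterfaceControl.IsC2Domain Ω)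
    (T lam ε : ℝ) (hT : 0 < T) (hlam : 0 < lam) (hε : 0 < ε)
    (N : ℕ) (h : Fin N → InterfaceControl.Plane → ℝ)
    (h_smooth : ∀ k, ContDiff ℝ ∞ (h k))
    (h_H10 : ∀ k, InterfaceControl.MemH10 Ω (h k))
    (h_indep : LinearIndependent ℝ (fun k => (closure Ω).domRestrict (h k)))
    (γ₀ : ℝ → InterfaceControl.Plane)
    (hγ_cont : ContinuousOn γ₀ (Icc 0 1))
    (hγ_mem : ∀ s ∈ Icc (0 : ℝ) 1, γ₀ s ∈ closure Ω)
    (hγ_W2 : InterfaceControl.MemW2Infty γ₀) :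
    -- for every control, the state system has exactly one solution, and it gives the reduced cost
    (∀ u : InterfaceControl.ControlSpace N T,
      (∃ X a, InterfaceControl.IsState Ω h γ₀ T u X a) ∧
      (∀ X a X' a', InterfaceControl.IsState Ω h γ₀ T u X a →
        InterfaceControl.IsState Ω h γ₀ T u X' a' →
        ∀ t ∈ Icc 0 T, ∀ s ∈ Icc (0 : ℝ) 1, X t s = X' t s ∧ a t s = a' t s) ∧
      (∀ X a, InterfaceControl.IsState Ω h γ₀ T u X a →
        InterfaceControl.reducedCost Ω h γ₀ T lam ε u
          = InterfaceControl.cost Ω h T lam ε u a)) ∧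
    -- along it, the adjoint system has exactly one solution
    (∀ (u : InterfaceControl.ControlSpace N T) (X a : ℝ → ℝ → InterfaceControl.Plane),
      InterfaceControl.IsState Ω h γ₀ T u X a →
      (∃ p q, InterfaceControl.IsAdjoint h T ε u X a p q) ∧
      (∀ p q p' q', InterfaceControl.IsAdjoint h T ε u X a p q →
        InterfaceControl.IsAdjoint h T ε u X a p' q' →
        ∀ t ∈ Icc 0 T, ∀ s ∈ Icc (0 : ℝ) 1, p t s = p' t s ∧ q t s = q' t s)) ∧
    -- the reduced cost is Fréchet differentiable
    Differentiable ℝ (InterfaceControl.reducedCost Ω h γ₀ T lam ε) ∧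
    -- formulas for its derivative and its gradient
    (∀ (u : InterfaceControl.ControlSpace N T) (X a p q : ℝ → ℝ → InterfaceControl.Plane),
      InterfaceControl.IsState Ω h γ₀ T u X a →
      InterfaceControl.IsAdjoint h T ε u X a p q →
      (∀ δu : InterfaceControl.ControlSpace N T,
        IntegrableOn (fun t => (InterfaceControl.gram Ω h *ᵥ (u t).ofLp) ⬝ᵥ (δu t).ofLp)
          (Ioo 0 T) ∧
        IntegrableOn (fun z : ℝ × ℝ => InterfaceControl.density
            (InterfaceControl.stream h (δu z.1)) X a p q z.1 z.2) (Ioo 0 T ×ˢ Ioo 0 1) ∧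
        fderiv ℝ (InterfaceControl.reducedCost Ω h γ₀ T lam ε) u δu
          = lam * (∫ t in (0 : ℝ)..T,
              (InterfaceControl.gram Ω h *ᵥ (u t).ofLp) ⬝ᵥ (δu t).ofLp)
            + ∫ t in (0 : ℝ)..T, ∫ s in (0 : ℝ)..1,
                InterfaceControl.density (InterfaceControl.stream h (δu t)) X a p q t s) ∧
      (∀ k : Fin N, ∀ᵐ t ∂(volume.restrict (Ioo 0 T)),
        (gradient (InterfaceControl.reducedCost Ω h γ₀ T lam ε) u) t k
          = lam * (InterfaceControl.gram Ω h *ᵥ (u t).ofLp) k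
            + ∫ s in (0 : ℝ)..1, InterfaceControl.density (h k) X a p q t s)) := by
  refine ⟨fun u => ⟨InterfaceControl.exists_isState hT hΩ h_smooth h_H10 hγ_cont hγ_mem hγ_W2 u,
      fun X a X' a' H H' => H.unique h_smooth H',
      fun X a H => InterfaceControl.reducedCost_eq hT h_smooth H⟩,
    fun u X a H => ⟨InterfaceControl.exists_isAdjoint hT h_smooth hε H,
      fun p q p' q' A A' => A.unique h_smooth hε H A'⟩, fun u => ?_, fun u X a p q H A => ?_⟩
  · obtain ⟨X, a, H⟩ :=
      InterfaceControl.exists_isState hT hΩ h_smooth h_H10 hγ_cont hγ_mem hγ_W2 u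
    obtain ⟨p, q, A⟩ := InterfaceControl.exists_isAdjoint hT h_smooth hε H
    exact (InterfaceControl.hasGradientAt_reducedCost hT hΩ h_smooth h_H10 hlam hε hγ_cont hγ_mem
      hγ_W2 H A).differentiableAt
  · have hgrad := InterfaceControl.hasGradientAt_reducedCost hT hΩ h_smooth h_H10 hlam hε hγ_cont
      hγ_mem hγ_W2 H A
    refine ⟨fun δu => ⟨?_, ?_, ?_⟩, fun k => ?_⟩
    · simpa only [InterfaceControl.inner_gramOp] using
        InterfaceControl.integrableOn_inner_gramOp (Ω := Ω) (h := h) u δu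
    · exact (InterfaceControl.integrableOn_density_stream h_smooth H A δu).mono_set
        (prod_mono Ioo_subset_Icc_self Ioo_subset_Icc_self)
    · rw [hgrad.hasFDerivAt.fderiv, InnerProductSpace.toDual_apply_apply, inner_add_left,
        real_inner_smul_left, InterfaceControl.inner_gramLp hT.le,
        InterfaceControl.inner_densityVec hT.le h_smooth H A]
      simp only [InterfaceControl.inner_gramOp]
    -- The gradient is an equivalence class, so its value at `t` is computed only almost everywhere,
    -- from representatives of the sum, the scalar multiple and the two terms.
    · rw [hgrad.gradient]
      filter_upwards [Lp.coeFn_add (lam • InterfaceControl.gramLp Ω h T u)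
          ((InterfaceControl.memLp_densityVec h_smooth H A).toLp _),
        Lp.coeFn_smul lam (InterfaceControl.gramLp Ω h T u),
        InterfaceControl.coeFn_gramLp (Ω := Ω) (h := h) u,
        (InterfaceControl.memLp_densityVec h_smooth H A).coeFn_toLp] with t h1 h2 h3 h4
      rw [h1, Pi.add_apply, h2, Pi.smul_apply, h3, h4]
      simp [InterfaceControl.gramOp_apply, InterfaceControl.densityVec]
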